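/- **Setup.** Let $Q=(Q_0,Q_1)$ be a finite quiver (loops and multiple arrows allowed), with tail and head maps $b\mapsto tb,\,hb$, and let $t_b$ ($b\in Q_1$) be arrow variables. Let $\Lambda^Q=\bigotimes_{j\in Q_0}\Lambda^{(j)}$ be the tensor product over $\mathbb{Z}[t_b^{\pm1}\mid b\in Q_1]$ of one copy of the algebra of symmetric functions, in variables $X^{(j)}$, for each vertex $j$. It has the basis of tensor Schur functions $s_{\lambda^\bullet}[X^\bullet]=\prod_{j}s_{\lambda^{(j)}}[X^{(j)}]$, indexed by $Q_0$-tuples $\lambda^\bullet$ of partitions, and the Hall scalar product, bilinear over $\mathbb{Z}[t_b^{\pm1}]$, for which this basis is orthonormal; $f^\perp$ denotes the adjoint of multiplication by $f$. Write $\Omega=\sum_{k\ge0}h_k$, with plethystic notation. For $i\in Q_0$ and $a\in\mathbb{Z}_{>0}$ let $U=(u_1,\dots,u_a)$, $U^*=\sum_k u_k^{-1}$, $R(U)=\prod_{1\le k<l\le a}(1-u_l/u_k)$. The quiver currents $H^{(i,a)}_\beta\in\mathrm{End}(\Lambda^Q)$, $\beta\in\mathbb{Z}^a$, are defined by $$\sum_{\beta\in\mathbb{Z}^a}u^\beta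 H^{(i,a)}_\beta=R(U)\,\Omega[UX^{(i)}]\,\Omega[-U^*X^{(i)}]^\perp\prod_{b\in Q_1:\,tb=i}\Omega[t_bU^*X^{(hb)}]^\perp .$$ For dimension vectors $\alpha^\bullet,\beta^\bullet\in\mathbb{Z}_{\ge0}^{Q_0}$ and Laurent polynomials $f$ in variables $u^{(j)}_k$ ($1\le k\le\alpha^{(j)}$) and $g$ in variables $v^{(j)}_l$ ($1\le l\le\beta^{(j)}$), symmetric in the variables at each vertex, the shuffle product is $$f\star g=D\Bigl(f(u)\,g(v)\prod_{b\in Q_1}\ \prod_{k=1}^{\alpha^{(tb)}}\prod_{l=1}^{\beta^{(hb)}}\frac1{1-t_b\,u^{(tb)}_k/v^{(hb)}_l}\Bigr),$$ where the denominators are expanded in nonnegative powers of the $t_b$. Here, at each vertex $j$, the variables $u^{(j)}_1,\dots,u^{(j)}_{\alpha^{(j)}},v^{(j)}_1,\dots,v^{(j)}_{\beta^{(j)}}$ are put in this order into a single list $z^{(j)}$ of length $\nu^{(j)}=\alpha^{(j)}+\beta^{(j)}$, and $D(F)=J(z^{\rho})^{-1}J(z^{\rho}F)$, where $J=\sum_{w\in\prod_jS_{\nu^{(j)}}}\operatorname{sgn}(w)\,w$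 and $\rho^{(j)}=(\nu^{(j)}-1,\dots,1,0)$. The Schur polynomial of a dominant weight $\lambda^\bullet$ (weakly decreasing integers $\lambda^{(j)}\in\mathbb{Z}^{\nu^{(j)}}$ for each $j$) is $s_{\lambda^\bullet}=J(z^{\lambda^\bullet+\rho})/J(z^{\rho})$. The product $f\star g$ has a unique expansion into these Schur polynomials with coefficients in the ring of formal Laurent series in the $t_b$; the expansion may be infinite, but only finitely many coefficients involve any given monomial in the $t_b$. **Proposition 5.5.** Let $i\in Q_0$, $a\in\mathbb{Z}_{>0}$, and let $\mu=(\mu_1\ge\dots\ge\mu_a)$ be integers. Let $\alpha^\bullet$ be the dimension vector with $\alpha^{(i)}=a$ and $\alpha^{(j)}=0$ for $j\ne i$, and let $\beta^\bullet$ be any dimension vector. Let $U$ and $V$ be the variables $u$ and $v$ above for $\alpha^\bullet$ and $\beta^\bullet$. Let $\xi^\bullet$ be a $Q_0$-tuple of partitions such that $\xi^{(j)}$ has at most $\beta^{(j)}$ rows for every $j$. Then for every $Q_0$-tuple $\lambda^\bullet$ of partitions such that $\lambda^{(j)}$ has at most $\alpha^{(j)}+\beta^{(j)}$ rows for every $j$,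 the coefficient of $s_{\lambda^\bullet}[X^\bullet]$ in the Schur expansion of $H^{(i,a)}_\mu\cdot s_{\xi^\bullet}[X^\bullet]$ is equal to the coefficient of $s_{\lambda^\bullet}[U+V]$ in the Schur expansion of the shuffle product $s_\mu[U]\star s_{\xi^\bullet}[V]$. For every other tuple of partitions $\lambda^\bullet$, the former coefficient is zero. -/

import Mathlib

open scoped TensorProduct

namespace QuiverCurrents

noncomputable section

/-- The quotient `a / b` in a commutative ring. It is only applied when `b` is a nonzerodivisor which
divides `a`, so that the quotient exists and is unique. -/
def exactQuot {A : Type*} [CommRing A] (a b : A) : A :=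
  open Classical in if h : ∃ c, b * c = a then h.choose else 0

/-! ### Symmetric functions in one alphabet -/

/-- The algebra `Λ` of symmetric functions over `R`: formal power series in the variables
`x₀, x₁, x₂, …` which have bounded degree and are invariant under permutations of the variables. -/
def symmetricFunctions (R : Type*) [CommRing R] : Subalgebra R (MvPowerSeries ℕ R) where
  carrier := {f | (∃ d : ℕ, ∀ m : ℕ →₀ ℕ, d < m.degree → MvPowerSeries.coeff m f = 0) ∧
    ∀ σ : Equiv.Perm ℕ, MvPowerSeries.renameEquiv R σ f = f}
  mul_mem' := by
    rintro f g ⟨⟨d, hd⟩, hf⟩ ⟨⟨e, he⟩, hg⟩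
    refine ⟨⟨d + e, fun m hm => ?_⟩, fun σ => by rw [map_mul, hf, hg]⟩
    rw [MvPowerSeries.coeff_mul]
    refine Finset.sum_eq_zero fun p hp => ?_
    have hp' : p.1 + p.2 = m := Finset.HasAntidiagonal.mem_antidiagonal.mp hp
    have h : p.1.degree + p.2.degree = m.degree := by rw [← hp', map_add]
    rcases lt_or_ge d p.1.degree with h1 | h1
    · rw [hd _ h1, zero_mul]
    · rw [he _ (by omega), mul_zero]
  add_mem' := by
    rintro f g ⟨⟨d, hd⟩, hf⟩ ⟨⟨e, he⟩, hg⟩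
    refine ⟨⟨d + e, fun m hm => ?_⟩, fun σ => by rw [map_add, hf, hg]⟩
    rw [map_add, hd m (by omega), he m (by omega), add_zero]
  algebraMap_mem' := by
    intro r
    refine ⟨⟨0, fun m hm => ?_⟩, fun σ => AlgEquiv.commutes _ r⟩
    have h : m ≠ 0 := by rintro rfl; simp at hm
    rw [MvPowerSeries.algebraMap_apply, MvPowerSeries.coeff_C]
    simp [h]

/-- `Λ` as a type. -/
abbrev Sym (R : Type*) [CommRing R] : Type _ := ↥(symmetricFunctions R)

/-- The sum of all monomials of degree `n`. -/
def completeSeries (R : Type*) [CommRing R] (n : ℕ) : MvPowerSeries ℕ R :=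
  fun m => if m.degree = n then 1 else 0

theorem coeff_completeSeries (R : Type*) [CommRing R] (n : ℕ) (m : ℕ →₀ ℕ) :
    MvPowerSeries.coeff m (completeSeries R n) = if m.degree = n then 1 else 0 := rfl

/-- The complete homogeneous symmetric function `h_n`: the sum of all monomials of degree `n`. -/
def complete (R : Type*) [CommRing R] (n : ℕ) : Sym R :=
  ⟨completeSeries R n, by
    constructor
    · refine ⟨n, fun m hm => ?_⟩
      rw [coeff_completeSeries, if_neg (by omega)]
    · intro σ
      ext m
      obtain ⟨m', rfl⟩ := (Finsupp.domCongr (M := ℕ) σ).surjective m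
      have h1 : Finsupp.domCongr σ m' = Finsupp.embDomain σ.toEmbedding m' := by
        rw [Finsupp.domCongr_apply, Finsupp.embDomain_eq_mapDomain]
        exact Finsupp.equivMapDomain_eq_mapDomain _ _
      have h2 : (Finsupp.embDomain σ.toEmbedding m').degree = m'.degree := by
        rw [Finsupp.embDomain_eq_mapDomain]
        exact Finsupp.degree_mapDomain _ _
      rw [h1, MvPowerSeries.renameEquiv_apply]
      refine (MvPowerSeries.coeff_embDomain_rename σ.toEmbedding _ m').trans ?_
      rw [coeff_completeSeries, coeff_completeSeries, h2]⟩

/-- The projection `f ↦ f[x₁ + ⋯ + xₙ]`, obtained by setting all but the first `n` variables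
equal to zero. -/
def restrict {R : Type*} [CommRing R] (n : ℕ) (f : Sym R) : MvPowerSeries (Fin n) R :=
  MvPowerSeries.killCompl Fin.valEmbedding (f : MvPowerSeries ℕ R)

/-- The alternant `det (x_i ^ γ_j)` in the variables `x₁, …, xₙ`. -/
def alternant (R : Type*) [CommRing R] {n : ℕ} (γ : Fin n → ℕ) : MvPowerSeries (Fin n) R :=
  (Matrix.of fun i j : Fin n => (MvPowerSeries.X i : MvPowerSeries (Fin n) R) ^ γ j).det

/-- The Schur function `s_λ ∈ Λ`: the symmetric function whose projection to `n` variables is, for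
every `n` which is at least the number `λ.colLen 0` of rows of `λ`, the Schur polynomial
`det (x_i ^ (λ_j + n - j)) / det (x_i ^ (n - j))`. -/
def schur (R : Type*) [CommRing R] (lam : YoungDiagram) : Sym R :=
  open Classical in
  if h : ∃ f : Sym R, ∀ n : ℕ, lam.colLen 0 ≤ n →
      alternant R (fun j : Fin n => n - 1 - j) * restrict n f =
        alternant R (fun j : Fin n => lam.rowLen j + (n - 1 - j))
  then h.choose else 0

/-! ### Quiver symmetric functions

The quiver has vertex set `Q0` and arrow set `Q1`. -/

/-- The ring `ℤ[t_b^{±1} | b ∈ Q1]` of Laurent polynomials in the arrow variables. -/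
abbrev ArrowRing (Q1 : Type*) : Type _ := AddMonoidAlgebra ℤ (Q1 → ℤ)

/-- The arrow variable `t_b`. -/
def arrowVar {Q1 : Type*} [DecidableEq Q1] (b : Q1) : ArrowRing Q1 :=
  AddMonoidAlgebra.single (Pi.single b 1) 1

/-- The space `Λ^Q` of quiver symmetric functions: the tensor product over the ring of arrow
variables of one copy of `Λ` for each vertex. -/
abbrev QSym (Q0 Q1 : Type*) : Type _ := ⨂[ArrowRing Q1] _ : Q0, Sym (ArrowRing Q1)

/-- The symmetric function `f[X^{(j)}] ∈ Λ^Q`, for `f ∈ Λ` and a vertex `j`. -/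
def atVertex {Q0 Q1 : Type*} [DecidableEq Q0] (j : Q0) (f : Sym (ArrowRing Q1)) : QSym Q0 Q1 :=
  PiTensorProduct.singleAlgHom (R := ArrowRing Q1) (A := fun _ : Q0 => Sym (ArrowRing Q1)) j f

/-- The tensor Schur function `s_{λ•}[X•] = ⨂_j s_{λ^{(j)}}[X^{(j)}]`. -/
def tensorSchur {Q0 : Type*} (Q1 : Type*) (lam : Q0 → YoungDiagram) : QSym Q0 Q1 :=
  ⨂ₜ[ArrowRing Q1] j, schur (ArrowRing Q1) (lam j)

/-- `c` is the family of coefficients in an expansion of `F` into tensor Schur functions. -/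
def IsTensorSchurExpansion {Q0 Q1 : Type*} (F : QSym Q0 Q1)
    (c : (Q0 → YoungDiagram) →₀ ArrowRing Q1) : Prop :=
  F = c.sum fun lam r => r • tensorSchur Q1 lam

/-- The coefficient of `s_{λ•}[X•]` in the expansion of `F` in the basis of tensor Schur functions. -/
def tensorSchurCoeff {Q0 Q1 : Type*} (F : QSym Q0 Q1) (lam : Q0 → YoungDiagram) : ArrowRing Q1 :=
  open Classical in if h : ∃ c, IsTensorSchurExpansion F c then h.choose lam else 0

/-- The Hall scalar product on `Λ^Q`: the bilinear form over the ring of arrow variables for which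
the tensor Schur functions are orthonormal. -/
def hall {Q0 Q1 : Type*} (F G : QSym Q0 Q1) : ArrowRing Q1 :=
  ∑ᶠ lam : Q0 → YoungDiagram, tensorSchurCoeff F lam * tensorSchurCoeff G lam

/-- `F^⊥ G`, where `F^⊥` is the adjoint of multiplication by `F` for the Hall scalar product:
the element with `⟨F^⊥ G, K⟩ = ⟨G, F K⟩` for all `K`. -/
def perp {Q0 Q1 : Type*} (F G : QSym Q0 Q1) : QSym Q0 Q1 :=
  open Classical in
  if h : ∃ G' : QSym Q0 Q1, ∀ K : QSym Q0 Q1, hall G' K = hall G (F * K) then h.choose else 0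

/-! ### Quiver currents

Series in `u₁, …, u_a` (or in their inverses) with coefficients in `Λ^Q` are elements of
`MvPowerSeries (Fin a) (QSym Q0 Q1)`. -/

/-- The series `Ω[c W X^{(j)}] = ∏_k ∑_n c^n w_k^n h_n[X^{(j)}]` in the variables
`W = (w₁, …, w_a)`, given by its coefficients at the monomials `w^m`. -/
def omega {Q0 Q1 : Type*} [DecidableEq Q0] (a : ℕ) (c : ArrowRing Q1) (j : Q0) :
    MvPowerSeries (Fin a) (QSym Q0 Q1) :=
  fun m => c ^ m.degree • ∏ k, atVertex j (complete (ArrowRing Q1) (m k))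

/-- The series `Ω[-W X^{(i)}] ∏_{b ∈ Out(i)} Ω[t_b W X^{(hb)}]` in the variables `W`, where
`Ω[-W X] = 1 / Ω[W X]`. -/
def skewSeries {Q0 Q1 : Type*} [DecidableEq Q0] [Fintype Q1] [DecidableEq Q1]
    (tl hd : Q1 → Q0) (i : Q0) (a : ℕ) : MvPowerSeries (Fin a) (QSym Q0 Q1) :=
  MvPowerSeries.invOfUnit (omega a (1 : ArrowRing Q1) i) 1 *
    ∏ b : Q1 with tl b = i, omega a (arrowVar b) (hd b)

/-- The Laurent polynomial `R(U) = ∏_{k < l} (1 - u_l / u_k)`. -/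
def raising (a : ℕ) : AddMonoidAlgebra ℤ (Fin a → ℤ) :=
  ∏ p : Fin a × Fin a with p.1 < p.2,
    (1 - AddMonoidAlgebra.single (Pi.single p.2 1 - Pi.single p.1 1) 1)

/-- The quiver current `H_β^{(i,a)}` acting on `F ∈ Λ^Q`, that is, the coefficient of `u^β` in
`R(U) Ω[U X^{(i)}] Ω[-U^* X^{(i)}]^⊥ ∏_{b ∈ Out(i)} Ω[t_b U^* X^{(hb)}]^⊥ F`, where
`U^* = (u₁⁻¹, …, u_a⁻¹)`. In the sum, `p` and `q` are the exponents of `U` in `Ω[U X^{(i)}]` and of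
`U^*` in the skewing operators, and the remaining exponent `β - p + q` is supplied by `R(U)`. Only
finitely many terms are nonzero. -/
def current {Q0 Q1 : Type*} [DecidableEq Q0] [Fintype Q1] [DecidableEq Q1]
    (tl hd : Q1 → Q0) (i : Q0) {a : ℕ} (β : Fin a → ℤ) (F : QSym Q0 Q1) : QSym Q0 Q1 :=
  ∑ᶠ pq : (Fin a →₀ ℕ) × (Fin a →₀ ℕ),
    (raising a).coeff (fun k => β k - pq.1 k + pq.2 k) •
      (MvPowerSeries.coeff pq.1 (omega a (1 : ArrowRing Q1) i) *
        perp (MvPowerSeries.coeff pq.2 (skewSeries tl hd i a)) F)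

/-! ### Laurent polynomials and the shuffle product -/

/-- Integral weights of the torus `T_{ν•}`, that is, exponents of monomials in the variables
`x_k^{(i)}` with `i ∈ Q0` and `1 ≤ k ≤ ν^{(i)}`. -/
abbrev Weight {Q0 : Type*} (ν : Q0 → ℕ) : Type _ := (i : Q0) → Fin (ν i) → ℤ

/-- `R(T_{ν•})`: Laurent polynomials in the variables `x_k^{(i)}`. -/
abbrev TorusRing {Q0 : Type*} (ν : Q0 → ℕ) : Type _ := AddMonoidAlgebra ℤ (Weight ν)

/-- The completion of `R(T_{ν•}) ⊗ ℤ[t_b^{±1}]` by formal Laurent series in the arrow variables.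
A set of exponents in `Q1 → ℤ` is partially well-ordered for the product order exactly if it is bounded
below, so these are the series `t^{-N} ∑_{m ≥ 0} f_m t^m` with `f_m ∈ R(T_{ν•})`. -/
abbrev Completed {Q0 : Type*} (Q1 : Type*) (ν : Q0 → ℕ) : Type _ := HahnSeries (Q1 → ℤ) (TorusRing ν)

/-- The exponent of the variable `x_k^{(i)}`. -/
def eps {Q0 : Type*} [DecidableEq Q0] {ν : Q0 → ℕ} (i : Q0) (k : Fin (ν i)) : Weight ν :=
  Pi.single i (Pi.single k 1)

/-- Permutation of the variables at each vertex: the ring automorphism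
`x_k^{(i)} ↦ x_{w^{(i)}(k)}^{(i)}` of `R(T_{ν•})`. -/
def permute {Q0 : Type*} {ν : Q0 → ℕ} (w : (i : Q0) → Equiv.Perm (Fin (ν i))) :
    TorusRing ν →+* TorusRing ν :=
  AddMonoidAlgebra.mapDomainRingHom ℤ
    ({ toFun := fun γ i k => γ i ((w i).symm k)
       map_zero' := rfl
       map_add' := fun _ _ => rfl } : Weight ν →+ Weight ν)

/-- The antisymmetrizer `J• = ∑_{w•} (-1)^{w•} w•` over `∏_i S_{ν^{(i)}}`. -/
def antisymmetrize {Q0 : Type*} [Fintype Q0] [DecidableEq Q0] {ν : Q0 → ℕ} (f : TorusRing ν) : TorusRing ν :=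
  ∑ w : (i : Q0) → Equiv.Perm (Fin (ν i)), (∏ i, (Equiv.Perm.sign (w i) : ℤ)) • permute w f

/-- The antisymmetrizer `J•`, acting on each coefficient of a series in the arrow variables. -/
def antisymmetrizeSeries {Q0 Q1 : Type*} [Fintype Q0] [DecidableEq Q0] {ν : Q0 → ℕ}
    (F : Completed Q1 ν) : Completed Q1 ν :=
  ∑ w : (i : Q0) → Equiv.Perm (Fin (ν i)), (∏ i, (Equiv.Perm.sign (w i) : ℤ)) • F.map (permute w)

/-- The weight `ρ•` with `ρ^{(i)} = (ν^{(i)} - 1, …, 1, 0)`. -/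
def rho {Q0 : Type*} (ν : Q0 → ℕ) : Weight ν := fun i k => (ν i : ℤ) - 1 - (k : ℕ)

/-- The monomial `x^γ`. -/
def mono {Q0 : Type*} {ν : Q0 → ℕ} (γ : Weight ν) : TorusRing ν := AddMonoidAlgebra.single γ 1

/-- The Schur polynomial `s_{λ•}(x) = ∏_i s_{λ^{(i)}}(x^{(i)}) = J•(x^{λ• + ρ•}) / J•(x^{ρ•})` of a
dominant weight `λ•`. -/
def schurPoly {Q0 : Type*} [Fintype Q0] [DecidableEq Q0] {ν : Q0 → ℕ} (γ : Weight ν) : TorusRing ν :=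
  exactQuot (antisymmetrize (mono (γ + rho ν))) (antisymmetrize (mono (rho ν)))

/-- The Demazure operator `F ↦ J•(x^{ρ•} F) / J•(x^{ρ•})`. -/
def demazure {Q0 Q1 : Type*} [Fintype Q0] [DecidableEq Q0] {ν : Q0 → ℕ}
    (F : Completed Q1 ν) : Completed Q1 ν :=
  exactQuot (antisymmetrizeSeries (HahnSeries.C (mono (rho ν)) * F))
    (antisymmetrizeSeries (HahnSeries.C (mono (rho ν))))

/-- The inclusion of the variables `u`: `x_k^{(i)} ↦ x_k^{(i)}` for `1 ≤ k ≤ α^{(i)}`. -/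
def inclU {Q0 : Type*} (α β : Q0 → ℕ) : TorusRing α →+* TorusRing (fun i => α i + β i) :=
  AddMonoidAlgebra.mapDomainRingHom ℤ
    ({ toFun := fun γ i => Fin.append (γ i) 0
       map_zero' := by
        funext i k
        refine Fin.addCases (fun k => ?_) (fun k => ?_) k <;> simp
       map_add' := fun γ δ => by
        funext i k
        refine Fin.addCases (fun k => ?_) (fun k => ?_) k <;> simp } :
      Weight α →+ Weight (fun i => α i + β i))

/-- The inclusion of the variables `v`: `x_k^{(i)} ↦ x_{α^{(i)} + k}^{(i)}` for
`1 ≤ k ≤ β^{(i)}`. -/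
def inclV {Q0 : Type*} (α β : Q0 → ℕ) : TorusRing β →+* TorusRing (fun i => α i + β i) :=
  AddMonoidAlgebra.mapDomainRingHom ℤ
    ({ toFun := fun γ i => Fin.append 0 (γ i)
       map_zero' := by
        funext i k
        refine Fin.addCases (fun k => ?_) (fun k => ?_) k <;> simp
       map_add' := fun γ δ => by
        funext i k
        refine Fin.addCases (fun k => ?_) (fun k => ?_) k <;> simp } :
      Weight β →+ Weight (fun i => α i + β i))

/-- The monomial `t_b x^γ`. -/
def arrowMonomial {Q0 Q1 : Type*} [DecidableEq Q1] {ν : Q0 → ℕ} (b : Q1) (γ : Weight ν) :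
    Completed Q1 ν :=
  HahnSeries.single (Pi.single b 1) (mono γ)

/-- The factor `1 - t_b x^γ` is invertible, with inverse `∑_{n ≥ 0} t_b^n x^{nγ}`. -/
theorem isUnit_one_sub_arrowMonomial {Q0 Q1 : Type*} [DecidableEq Q1] {ν : Q0 → ℕ} (b : Q1)
    (γ : Weight ν) : IsUnit (1 - arrowMonomial b γ : Completed Q1 ν) := by
  classical
  have hpwo : (Function.support fun g : Q1 → ℤ =>
      if g = Pi.single b (g b) ∧ 0 ≤ g b then (mono (g b • γ) : TorusRing ν) else 0).IsPWO := by
    have hm : Monotone fun n : ℕ => (Pi.single b (n : ℤ) : Q1 → ℤ) := fun m n hmn =>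
      Pi.single_mono b (by exact_mod_cast hmn)
    refine ((Set.isPWO_of_wellQuasiOrderedLE (Set.univ : Set ℕ)).image_of_monotone hm).mono ?_
    intro g hg
    have h : g = Pi.single b (g b) ∧ 0 ≤ g b := by
      by_contra h
      exact hg (if_neg h)
    refine ⟨(g b).toNat, Set.mem_univ _, ?_⟩
    simp only [Int.toNat_of_nonneg h.2]
    exact h.1.symm
  let G : Completed Q1 ν := ⟨_, hpwo⟩
  have hG : ∀ g, G.coeff g = if g = Pi.single b (g b) ∧ 0 ≤ g b then mono (g b • γ) else 0 :=
    fun _ => rfl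
  refine IsUnit.of_mul_eq_one G ?_
  ext1
  funext g
  rw [sub_mul, one_mul, HahnSeries.coeff_sub, arrowMonomial, HahnSeries.coeff_single_mul, hG, hG,
    HahnSeries.coeff_one]
  by_cases h1 : g = Pi.single b (g b)
  · have h2 : g - Pi.single b 1 = Pi.single b ((g - Pi.single b 1 : Q1 → ℤ) b) := by
      conv_lhs => rw [h1]
      rw [← Pi.single_sub]
      simp
    have h3 : (g - Pi.single b 1 : Q1 → ℤ) b = g b - 1 := by simp
    have h4 : g = 0 ↔ g b = 0 := ⟨fun h => by rw [h]; rfl, fun h => by rw [h1, h]; simp⟩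
    have h5 : (g = Pi.single b (g b) ∧ 0 ≤ g b) ↔ 0 ≤ g b := and_iff_right h1
    have h6 : (g - Pi.single b 1 = Pi.single b ((g - Pi.single b 1 : Q1 → ℤ) b) ∧
        0 ≤ (g - Pi.single b 1 : Q1 → ℤ) b) ↔ 0 ≤ g b - 1 := by
      rw [and_iff_right h2, h3]
    rw [if_congr h5 rfl rfl, if_congr h6 rfl rfl, if_congr h4 rfl rfl, h3]
    rcases lt_trichotomy (g b) 0 with h | h | h
    · rw [if_neg (by omega), if_neg (by omega), if_neg (by omega)]; simp
    · rw [if_pos (by omega), if_neg (by omega), if_pos h, h]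
      simp [mono, AddMonoidAlgebra.one_def]
    · rw [if_pos (by omega), if_pos (by omega), if_neg (by omega)]
      rw [mono, mono, mono, AddMonoidAlgebra.single_mul_single, sub_smul, one_smul,
        add_sub_cancel, mul_one, sub_self]
  · have h2 : ¬ (g - Pi.single b 1 = Pi.single b ((g - Pi.single b 1 : Q1 → ℤ) b)) := by
      intro h
      apply h1
      have h5 := congrArg (fun f : Q1 → ℤ => f + Pi.single b 1) h
      simp only [sub_add_cancel] at h5
      rw [← Pi.single_add] at h5
      rw [h5]
      simp
    have h3 : g ≠ 0 := fun h => h1 (by rw [h]; simp)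
    rw [if_neg (fun h => h1 h.1), if_neg (fun h => h2 h.1), if_neg h3]
    simp

/-- The kernel `∏_{b ∈ Q1} ∏_{k,l} 1 / (1 - t_b u_k^{(tb)} / v_l^{(hb)})`. -/
def shuffleKernel {Q0 Q1 : Type*} [DecidableEq Q0] [Fintype Q1] [DecidableEq Q1]
    (tl hd : Q1 → Q0) (α β : Q0 → ℕ) : Completed Q1 (fun i => α i + β i) :=
  ∏ b : Q1, ∏ k : Fin (α (tl b)), ∏ l : Fin (β (hd b)),
    Ring.inverse (1 - arrowMonomial b
      (eps (tl b) (Fin.castAdd (β (tl b)) k) - eps (hd b) (Fin.natAdd (α (hd b)) l)))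

/-- The shuffle product `F ⋆ G` of `F` in the variables `u` of dimension `α•` and `G` in the
variables `v` of dimension `β•`. -/
def shuffle {Q0 Q1 : Type*} [Fintype Q0] [DecidableEq Q0] [Fintype Q1] [DecidableEq Q1]
    (tl hd : Q1 → Q0) {α β : Q0 → ℕ} (F : Completed Q1 α) (G : Completed Q1 β) :
    Completed Q1 (fun i => α i + β i) :=
  demazure (F.map (inclU α β) * G.map (inclV α β) * shuffleKernel tl hd α β)

/-- Dominant weights of `G_{ν•}`: weakly decreasing at each vertex. -/
abbrev DominantWeight {Q0 : Type*} (ν : Q0 → ℕ) : Type _ := {γ : Weight ν // ∀ i, Antitone (γ i)}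

/-- `d` is the family of coefficients in an expansion of `F` into Schur polynomials, indexed by all
dominant weights. The sum may be infinite, but for each monomial `t^g` in the arrow
variables only finitely many coefficients `d_λ` involve `t^g`. -/
def IsSchurExpansion {Q0 Q1 : Type*} [Fintype Q0] [DecidableEq Q0] {ν : Q0 → ℕ}
    (F : Completed Q1 ν) (d : DominantWeight ν → HahnSeries (Q1 → ℤ) ℤ) : Prop :=
  ∀ g : Q1 → ℤ, {lam | (d lam).coeff g ≠ 0}.Finite ∧
    F.coeff g = ∑ᶠ lam, (d lam).coeff g • schurPoly lam.1

/-- The weight of `G_{α•}`, for `α• = a f^{(i)}`, which is `μ` at the vertex `i`. -/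
def vertexWeight {Q0 : Type*} [DecidableEq Q0] (i : Q0) {a : ℕ} (μ : Fin a → ℤ) :
    Weight (Pi.single i a : Q0 → ℕ) :=
  fun j k => if h : j = i then μ (Fin.cast (by rw [h, Pi.single_eq_same]) k) else 0

/-- The rows of a tuple of partitions as a dominant weight of `G_{ν•}`, used for tuples in which the
`i`-th partition has at most `ν^{(i)}` rows. -/
def partitionWeight {Q0 : Type*} (ν : Q0 → ℕ) (lam : Q0 → YoungDiagram) : DominantWeight ν :=
  ⟨fun i k => ((lam i).rowLen k : ℤ), fun i _ _ hkl =>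
    Int.ofNat_le.mpr ((lam i).rowLen_anti _ _ hkl)⟩

end

end QuiverCurrents

open QuiverCurrents

namespace QuiverCurrents

noncomputable section

/-! ### Bialternants in a commutative ring -/

section Bialternant

variable {A : Type*} [CommRing A]

/-! Both coefficients turn out to be the same signed sum. For `p = (q, m)` let `k_p` be the
coefficient of `w^q x^m` in `∏_{tb = i} Ω[t_b W X^{(hb)}]`, where each `X^{(j)}` is specialised to
`β^{(j)}` variables `x^{(j)}` (`outSeries`). Let `γ_p = (μ + q, ξ - m)` be the exponent of `u^{μ+q}
v^{ξ-m}`, and let `ε(δ, κ)` be the coefficient of `z^δ` in `J(z^κ)` (`altCoeff`). Both coefficients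
of `λ` equal `∑_p k_p ε(γ_p + ρ, λ + ρ)`.

Shuffle side. The series `Ω[t W X]` is reciprocal to `∏ (1 - t w_k x_l)`, so the substitution `w =
u`, `x = v⁻¹` turns `outSeries` into the shuffle kernel (`coeff_shuffleKernel`). The kernel is
symmetric in `u` and in `v` separately, hence under antisymmetrization `s_μ[U] s_ξ[V]` may be
replaced by the monomial `u^μ v^ξ` (`antisymmetrize_mono_rho_mul_schurPoly`). What remains is to
read off the coefficient of `z^{λ+ρ}` in `∑_p k_p J(z^{γ_p+ρ})`.

Current side. Jacobi–Trudi determinants make sense for every weight `δ` (`vertexJacobiTrudi`), and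
`JT(ξ + ρ) = s_ξ`. The Hall pairing of `JT(δ)` with `K` is the coefficient of `x^δ` in `a_ρ(x) K[x]`
(`hall_vertexJacobiTrudi`). Therefore `F^⊥ JT(δ)` is the sum of `JT(δ - m)` weighted by the
coefficients of `x^m` in `F[x]` (`perp_vertexJacobiTrudi`). Evaluated in `x`, the skewing series is
`∏ (1 - w_k x_l^{(i)})` times `outSeries`, while `R(U) Ω[U X^{(i)}]` has Jacobi–Trudi coefficients
too.

The two determinants are merged by the additive map `z^δ ↦ h_{γ-δ}` (`completePairing`). It sends
`R` to `JT(γ + ρ)` and exchanges translations of `γ` with multiplication by monomials. The factor `∏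
(1 - w_k x_l^{(i)})` thus becomes `∏ (1 - v_l^{(i)} / u_k)`, exactly what `R(U) R(V)` lacks to be
`R(U + V)` (`vertexRaising_add`). So the current gives `∑_p k_p JT(γ_p + ρ)`
(`current_eq_pairingSum`). Straightening each `JT` into zero or a signed Schur function with few
enough rows produces `ε` (`repr_vertexJacobiTrudi`), and also shows that no other Schur function
occurs. -/

theorem coeff_prod_one_sub_eq_zero {κ : Type*} (s : Finset κ) (x : κ → A) {m : ℕ} (hm : s.card < m) :
    PowerSeries.coeff m (∏ l ∈ s, (1 - PowerSeries.C (x l) * PowerSeries.X)) = 0 := by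
  classical
  induction s using Finset.induction_on generalizing m with
  | empty => simp at hm; simp [PowerSeries.coeff_one, hm.ne']
  | insert a s ha ih =>
    rw [Finset.card_insert_of_notMem ha] at hm
    obtain ⟨m, rfl⟩ : ∃ k, m = k + 1 := ⟨m - 1, by omega⟩
    rw [Finset.prod_insert ha, sub_mul, one_mul, map_sub, mul_assoc, PowerSeries.coeff_C_mul,
      PowerSeries.coeff_succ_X_mul, ih (by omega), ih (by omega)]
    simp

/-- Only `n` coefficients of `P` enter the convolution. They are listed from degree `n - 1` down, to
match the staircase exponents of an alternant. -/
theorem coeff_mul_mk_of_bounded (h : ℤ → A) (hneg : ∀ m < 0, h m = 0) {n : ℕ} (P : PowerSeries A)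
    (hP : ∀ m, n ≤ m → PowerSeries.coeff m P = 0) (m : ℕ) :
    PowerSeries.coeff m (P * PowerSeries.mk fun k : ℕ => h k) =
      ∑ r : Fin n, PowerSeries.coeff (n - 1 - (r : ℕ)) P * h (m - (n - 1 - (r : ℕ) : ℕ)) := by
  have h1 : ∑ r : Fin n, PowerSeries.coeff (n - 1 - (r : ℕ)) P * h (m - (n - 1 - (r : ℕ) : ℕ)) =
      ∑ r ∈ Finset.range n, PowerSeries.coeff r P * h (m - (r : ℕ)) := by
    rw [Fin.sum_univ_eq_sum_range
      (fun r => PowerSeries.coeff (n - 1 - r) P * h (m - (n - 1 - r : ℕ)))]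
    exact Finset.sum_range_reflect (fun r => PowerSeries.coeff r P * h (m - (r : ℕ))) n
  rw [h1, PowerSeries.coeff_mul, Finset.Nat.sum_antidiagonal_eq_sum_range_succ_mk]
  have h2 : ∀ r ∈ Finset.range m.succ, PowerSeries.coeff r P *
      PowerSeries.coeff (m - r) (PowerSeries.mk fun k : ℕ => h k) =
      PowerSeries.coeff r P * h (m - (r : ℕ)) := by
    intro r hr
    rw [Finset.mem_range] at hr
    rw [PowerSeries.coeff_mk, Nat.cast_sub (by omega)]
  rw [Finset.sum_congr rfl h2]
  rcases le_total n m.succ with hn | hn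
  · refine (Finset.sum_subset (Finset.range_mono hn) fun r _ hr => ?_).symm
    rw [hP r (by simpa using hr), zero_mul]
  · refine Finset.sum_subset (Finset.range_mono hn) fun r _ hr => ?_
    rw [hneg _ (by simp at hr; omega), mul_zero]

/-- The matrix of powers factors. Multiplying the generating series of the `h_m` by `∏_{l ≠ k} (1 -
x_l X)` leaves `1 / (1 - x_k X)`, so each power of `x_k` is a combination of `h_m` whose
coefficients do not depend on the power. The staircase case identifies the determinant of the
coefficient matrix with the Vandermonde determinant. Nothing is divided, so any commutative ring is
allowed. -/
theorem det_pow_eq_mul {n : ℕ} (x : Fin n → A) (h : ℤ → A) (hneg : ∀ m < 0, h m = 0)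
    (hH : (PowerSeries.mk fun m : ℕ => h m) * ∏ l, (1 - PowerSeries.C (x l) * PowerSeries.X) = 1)
    (δ : Fin n → ℕ) :
    (Matrix.of fun i j => x i ^ δ j).det =
      (Matrix.of fun i j : Fin n => x i ^ (n - 1 - (j : ℕ))).det *
        (Matrix.of fun r j : Fin n => h (δ j - (n - 1 - (r : ℕ) : ℕ))).det := by
  classical
  let P : Fin n → PowerSeries A := fun k =>
    ∏ l ∈ Finset.univ.erase k, (1 - PowerSeries.C (x l) * PowerSeries.X)
  let M : Matrix (Fin n) (Fin n) A :=
    Matrix.of fun k r => PowerSeries.coeff (n - 1 - (r : ℕ)) (P k)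
  have hPH : ∀ k, P k * (PowerSeries.mk fun m : ℕ => h m) = PowerSeries.mk fun m => x k ^ m := by
    intro k
    have h1 : (1 - PowerSeries.C (x k) * PowerSeries.X) *
        (P k * (PowerSeries.mk fun m : ℕ => h m)) = 1 := by
      rw [← mul_assoc, Finset.mul_prod_erase Finset.univ
        (fun l => 1 - PowerSeries.C (x l) * PowerSeries.X) (Finset.mem_univ k), mul_comm, hH]
    have h2 : (PowerSeries.mk fun m => x k ^ m) * (1 - PowerSeries.C (x k) * PowerSeries.X) = 1 := by
      ext m
      rw [mul_sub, mul_one, map_sub, mul_comm (PowerSeries.C _), ← mul_assoc,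
        PowerSeries.coeff_mul_C]
      cases m with
      | zero => simp [PowerSeries.coeff_one]
      | succ m => simp [PowerSeries.coeff_one, PowerSeries.coeff_succ_mul_X, pow_succ]
    calc _ = ((PowerSeries.mk fun m => x k ^ m) * (1 - PowerSeries.C (x k) * PowerSeries.X)) *
        (P k * (PowerSeries.mk fun m : ℕ => h m)) := by rw [h2, one_mul]
      _ = _ := by rw [mul_assoc, h1, mul_one]
  have hP : ∀ k m, n ≤ m → PowerSeries.coeff m (P k) = 0 := by
    intro k m hm
    refine coeff_prod_one_sub_eq_zero _ _ ?_
    rw [Finset.card_erase_of_mem (Finset.mem_univ k), Finset.card_univ, Fintype.card_fin]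
    have := k.pos
    omega
  have key : ∀ γ : Fin n → ℕ, (Matrix.of fun i j => x i ^ γ j) =
      M * Matrix.of fun r j : Fin n => h (γ j - (n - 1 - (r : ℕ) : ℕ)) := by
    intro γ
    ext i j
    rw [Matrix.mul_apply, Matrix.of_apply]
    have := coeff_mul_mk_of_bounded h hneg (P i) (hP i) (γ j)
    rw [hPH, PowerSeries.coeff_mk] at this
    exact this
  have h0 : h 0 = 1 := by
    have := congrArg (PowerSeries.coeff 0) hH
    simpa [map_prod] using this
  have hM : (Matrix.of fun i j : Fin n => x i ^ (n - 1 - (j : ℕ))).det = M.det := by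
    rw [key, Matrix.det_mul]
    -- For the staircase the entries are `h_{r-j}`, so the matrix is unitriangular.
    have h1 : (Matrix.of fun r j : Fin n =>
        h ((n - 1 - (j : ℕ) : ℕ) - (n - 1 - (r : ℕ) : ℕ))).det = 1 := by
      rw [Matrix.det_of_isLowerTriangular]
      · simp [h0]
      · intro i j hij
        have hij' : i < j := hij
        rw [Matrix.of_apply]
        exact hneg _ (by omega)
    rw [h1, mul_one]
  rw [hM, key, Matrix.det_mul]

/-- The coefficients of `∏ (1 - x_l X)`, of degree at most `n < N`, form a row vector that
annihilates the matrix: the products are coefficients of the series `1` in the positive degrees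
`δ_j`. This is why a Schur function vanishes in fewer variables than it has rows. -/
theorem det_complete_eq_zero {n N : ℕ} (hnN : n < N) (x : Fin n → A) (h : ℤ → A)
    (hneg : ∀ m < 0, h m = 0)
    (hH : (PowerSeries.mk fun m : ℕ => h m) * ∏ l, (1 - PowerSeries.C (x l) * PowerSeries.X) = 1)
    (δ : Fin N → ℕ) (hδ : ∀ j, 0 < δ j) :
    (Matrix.of fun r j : Fin N => h (δ j - (N - 1 - (r : ℕ) : ℕ))).det = 0 := by
  classical
  let P : PowerSeries A := ∏ l, (1 - PowerSeries.C (x l) * PowerSeries.X)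
  have hP : ∀ m, N ≤ m → PowerSeries.coeff m P = 0 := fun m hm =>
    coeff_prod_one_sub_eq_zero _ _ (by simp; omega)
  let v : Fin N → A := fun r => PowerSeries.coeff (N - 1 - (r : ℕ)) P
  set B := Matrix.of fun r j : Fin N => h (δ j - (N - 1 - (r : ℕ) : ℕ))
  have hv : Matrix.vecMul v B = 0 := by
    ext j
    have := coeff_mul_mk_of_bounded h hneg P hP (δ j)
    rw [mul_comm, hH, PowerSeries.coeff_one, if_neg (hδ j).ne'] at this
    exact this.symm
  have h1 : Matrix.vecMul v (B * B.adjugate) = 0 := by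
    rw [← Matrix.vecMul_vecMul, hv, Matrix.zero_vecMul]
  rw [Matrix.mul_adjugate, Matrix.vecMul_smul, Matrix.vecMul_one] at h1
  -- The last entry of `v` is the constant coefficient of `P`, which is `1`; hence the determinant
  -- itself is zero.
  have h2 := congrFun h1 ⟨N - 1, by omega⟩
  simpa [v, P, map_prod] using h2

end Bialternant

/-! ### Restriction to finitely many variables -/

section Restriction

variable {R : Type*} [CommRing R]

/-- The projection to `n` variables as an algebra homomorphism. -/
def restrictHom (R : Type*) [CommRing R] (n : ℕ) : Sym R →ₐ[R] MvPowerSeries (Fin n) R :=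
  (MvPowerSeries.killCompl Fin.valEmbedding).comp (symmetricFunctions R).val

theorem coeff_restrictHom (n : ℕ) (f : Sym R) (m : Fin n →₀ ℕ) :
    MvPowerSeries.coeff m (restrictHom R n f) =
      MvPowerSeries.coeff (Finsupp.embDomain Fin.valEmbedding m) (f : MvPowerSeries ℕ R) :=
  MvPowerSeries.coeff_killCompl _ _

theorem coeff_embDomain_perm (f : Sym R) (σ : Equiv.Perm ℕ) (m : ℕ →₀ ℕ) :
    MvPowerSeries.coeff (Finsupp.embDomain σ.toEmbedding m) (f : MvPowerSeries ℕ R) =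
      MvPowerSeries.coeff m (f : MvPowerSeries ℕ R) := by
  conv_lhs => rw [← f.2.2 σ, MvPowerSeries.renameEquiv_apply]
  exact MvPowerSeries.coeff_embDomain_rename σ.toEmbedding _ m

/-- A finite injection into `ℕ` extends to a permutation, so the support of `m` can be moved into
the first `n` variables. The exponent `m'` serves all `f` at once. -/
theorem exists_coeff_restrictHom (n : ℕ) (m : ℕ →₀ ℕ) (hm : m.support.card ≤ n) :
    ∃ m' : Fin n →₀ ℕ, ∀ f : Sym R, MvPowerSeries.coeff m (f : MvPowerSeries ℕ R) =
      MvPowerSeries.coeff m' (restrictHom R n f) := by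
  let x : Fin m.support.card ↪ ℕ := (m.support.orderEmbOfFin rfl).toEmbedding
  have := Equiv.Perm.isMultiplyPretransitive ℕ m.support.card
  obtain ⟨σ, hσ⟩ := MulAction.exists_smul_eq (Equiv.Perm ℕ) x Fin.valEmbedding
  have h2 : ∀ k ∈ (Finsupp.embDomain σ.toEmbedding m).support, k ∈ Set.range (Fin.val (n := n)) := by
    intro k hk
    rw [Finsupp.support_embDomain, Finset.mem_map] at hk
    obtain ⟨l, hl, rfl⟩ := hk
    have : l ∈ Set.range (m.support.orderEmbOfFin rfl) := by
      rw [Finset.range_orderEmbOfFin]; exact hl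
    obtain ⟨i, rfl⟩ := this
    have h3 : σ (m.support.orderEmbOfFin rfl i) = (i : ℕ) := DFunLike.congr_fun hσ i
    refine ⟨⟨i, i.2.trans_le hm⟩, h3.symm⟩
  refine ⟨Finsupp.comapDomain Fin.val (Finsupp.embDomain σ.toEmbedding m)
    (Fin.val_injective.injOn), fun f => ?_⟩
  rw [coeff_restrictHom]
  have h4 : Finsupp.embDomain Fin.valEmbedding (Finsupp.comapDomain (Fin.val (n := n))
      (Finsupp.embDomain σ.toEmbedding m) Fin.val_injective.injOn) =
      Finsupp.embDomain σ.toEmbedding m := by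
    rw [Finsupp.embDomain_eq_mapDomain]
    exact Finsupp.mapDomain_comapDomain _ Fin.val_injective _ h2
  rw [h4, coeff_embDomain_perm]

theorem card_support_le_degree (m : ℕ →₀ ℕ) : m.support.card ≤ m.degree := by
  rw [Finsupp.degree, Finset.card_eq_sum_ones]
  refine Finset.sum_le_sum fun i hi => ?_
  exact Nat.one_le_iff_ne_zero.mpr (Finsupp.mem_support_iff.mp hi)

/-- The degree of `f` is at most `d`. -/
def DegreeLE (d : ℤ) (f : Sym R) : Prop :=
  ∀ m : ℕ →₀ ℕ, d < m.degree → MvPowerSeries.coeff m (f : MvPowerSeries ℕ R) = 0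

theorem exists_degreeLE (f : Sym R) : ∃ d : ℕ, DegreeLE d f := by
  obtain ⟨d, hd⟩ := f.2.1
  exact ⟨d, fun m hm => hd m (by exact_mod_cast hm)⟩

theorem DegreeLE.add {d : ℤ} {f g : Sym R} (hf : DegreeLE d f) (hg : DegreeLE d g) :
    DegreeLE d (f + g) := fun m hm => by
  have h : ((f + g : Sym R) : MvPowerSeries ℕ R) = f + g := rfl
  rw [h, map_add, hf m hm, hg m hm, add_zero]

theorem DegreeLE.smul {d : ℤ} {f : Sym R} (hf : DegreeLE d f) (r : R) : DegreeLE d (r • f) :=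
  fun m hm => by
  have h : ((r • f : Sym R) : MvPowerSeries ℕ R) = r • (f : MvPowerSeries ℕ R) := rfl
  rw [h, MvPowerSeries.coeff_smul, hf m hm, mul_zero]

theorem DegreeLE.zero (d : ℤ) : DegreeLE d (0 : Sym R) := fun m _ => by
  have h : ((0 : Sym R) : MvPowerSeries ℕ R) = 0 := rfl
  rw [h, map_zero]

theorem DegreeLE.sum {d : ℤ} {κ : Type*} (s : Finset κ) (f : κ → Sym R)
    (hf : ∀ k ∈ s, DegreeLE d (f k)) : DegreeLE d (∑ k ∈ s, f k) :=
  Finset.sum_induction f (DegreeLE d) (fun _ _ => DegreeLE.add) (DegreeLE.zero d) hf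

theorem DegreeLE.mul {d e : ℤ} {f g : Sym R} (hf : DegreeLE d f) (hg : DegreeLE e g) :
    DegreeLE (d + e) (f * g) := fun m hm => by
  have h : ((f * g : Sym R) : MvPowerSeries ℕ R) = f * g := rfl
  rw [h, MvPowerSeries.coeff_mul]
  refine Finset.sum_eq_zero fun p hp => ?_
  have hp' : p.1 + p.2 = m := Finset.HasAntidiagonal.mem_antidiagonal.mp hp
  have h : p.1.degree + p.2.degree = m.degree := by rw [← hp', map_add]
  rcases lt_or_ge d p.1.degree with h1 | h1
  · rw [hf _ h1, zero_mul]
  · rw [hg _ (by omega), mul_zero]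

theorem DegreeLE.one : DegreeLE 0 (1 : Sym R) := fun m hm => by
  have h : ((1 : Sym R) : MvPowerSeries ℕ R) = 1 := rfl
  classical
  rw [h, MvPowerSeries.coeff_one, if_neg]
  rintro rfl
  simp at hm

theorem DegreeLE.prod {κ : Type*} (s : Finset κ) (d : κ → ℤ) (f : κ → Sym R)
    (hf : ∀ k ∈ s, DegreeLE (d k) (f k)) : DegreeLE (∑ k ∈ s, d k) (∏ k ∈ s, f k) := by
  classical
  induction s using Finset.induction_on with
  | empty => simpa using DegreeLE.one
  | insert a s ha ih =>
    rw [Finset.sum_insert ha, Finset.prod_insert ha]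
    exact (hf a (Finset.mem_insert_self a s)).mul
      (ih fun k hk => hf k (Finset.mem_insert_of_mem hk))

/-- A monomial of degree at most `n` involves at most `n` variables. -/
theorem eq_of_restrictHom_eq {n : ℕ} {f g : Sym R} (hf : DegreeLE n f) (hg : DegreeLE n g)
    (h : restrictHom R n f = restrictHom R n g) : f = g := by
  apply Subtype.ext
  ext m
  rcases lt_or_ge n m.degree with h1 | h1
  · rw [hf m (by exact_mod_cast h1), hg m (by exact_mod_cast h1)]
  · obtain ⟨m', hm'⟩ := exists_coeff_restrictHom (R := R) n m ((card_support_le_degree m).trans h1)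
    rw [hm', hm', h]

/-- The complete homogeneous symmetric function `h_m` for an integer `m`. -/
def completeInt (R : Type*) [CommRing R] (m : ℤ) : Sym R :=
  if 0 ≤ m then complete R m.toNat else 0

@[simp] theorem completeInt_natCast (m : ℕ) : completeInt R m = complete R m := by
  simp [completeInt]

theorem completeInt_of_neg {m : ℤ} (hm : m < 0) : completeInt R m = 0 := by
  rw [completeInt, if_neg (by omega)]

theorem complete_zero : complete R 0 = 1 := by
  apply Subtype.ext
  ext m
  classical
  have h : ((1 : Sym R) : MvPowerSeries ℕ R) = 1 := rfl
  rw [h, MvPowerSeries.coeff_one]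
  refine (coeff_completeSeries R 0 m).trans ?_
  simp [Finsupp.degree_eq_zero_iff]

/-- With integer bounds this includes negative `m`, so the degrees of the factors in a Jacobi–Trudi
determinant can be added without case distinctions. -/
theorem degreeLE_completeInt (m : ℤ) : DegreeLE m (completeInt R m) := by
  intro k hk
  rcases lt_or_ge m 0 with h | h
  · rw [completeInt_of_neg h]; rfl
  · rw [completeInt, if_pos h]
    refine (coeff_completeSeries R _ k).trans (if_neg ?_)
    omega

theorem coeff_restrictHom_complete (n m : ℕ) (k : Fin n →₀ ℕ) :
    MvPowerSeries.coeff k (restrictHom R n (complete R m)) = if k.degree = m then 1 else 0 := by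
  rw [coeff_restrictHom]
  refine (coeff_completeSeries R _ _).trans ?_
  rw [Finsupp.embDomain_eq_mapDomain, Finsupp.degree_mapDomain]

/-- Picking one power from each geometric series produces every monomial of degree `m` exactly once.
-/
theorem prod_mk_pow (n : ℕ) :
    (PowerSeries.mk fun m : ℕ => restrictHom R n (complete R m)) =
      ∏ l : Fin n, PowerSeries.mk fun m => (MvPowerSeries.X l : MvPowerSeries (Fin n) R) ^ m := by
  classical
  ext m k
  rw [PowerSeries.coeff_mk, coeff_restrictHom_complete, PowerSeries.coeff_prod, map_sum]
  have h : ∀ l : Fin n →₀ ℕ, ∏ i, PowerSeries.coeff (l i)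
      (PowerSeries.mk fun m => (MvPowerSeries.X i : MvPowerSeries (Fin n) R) ^ m) =
      MvPowerSeries.monomial l 1 := by
    intro l
    simp only [PowerSeries.coeff_mk, MvPowerSeries.X_pow_eq]
    rw [MvPowerSeries.prod_monomial]
    simp [Finsupp.univ_sum_single]
  simp only [h, MvPowerSeries.coeff_monomial]
  rw [Finset.sum_ite_eq]
  refine if_congr ?_ rfl rfl
  simp [Finset.mem_finsuppAntidiag, Finsupp.degree_eq_sum]

theorem mk_pow_mul {A : Type*} [CommRing A] (x : A) :
    (PowerSeries.mk fun m => x ^ m) * (1 - PowerSeries.C x * PowerSeries.X) = 1 := by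
  ext m
  rw [mul_sub, mul_one, map_sub, mul_comm (PowerSeries.C _), ← mul_assoc, PowerSeries.coeff_mul_C]
  cases m with
  | zero => simp [PowerSeries.coeff_one]
  | succ m => simp [PowerSeries.coeff_one, PowerSeries.coeff_succ_mul_X, pow_succ]

theorem mk_complete_mul_prod (n : ℕ) :
    (PowerSeries.mk fun m : ℕ => restrictHom R n (completeInt R m)) *
      ∏ l : Fin n, (1 - PowerSeries.C (MvPowerSeries.X l : MvPowerSeries (Fin n) R) *
        PowerSeries.X) = 1 := by
  simp only [completeInt_natCast]
  rw [prod_mk_pow, ← Finset.prod_mul_distrib]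
  exact Finset.prod_eq_one fun l _ => mk_pow_mul _

end Restriction

/-! ### Alternants -/

section Alternant

variable {R : Type*} [CommRing R]

theorem alternant_eq_sum {n : ℕ} (γ : Fin n → ℕ) :
    alternant R γ = ∑ σ : Equiv.Perm (Fin n), (Equiv.Perm.sign σ : ℤ) •
      MvPowerSeries.monomial (Finsupp.equivFunOnFinite.symm fun k => γ (σ.symm k)) (1 : R) := by
  rw [alternant, Matrix.det_apply]
  refine Finset.sum_congr rfl fun σ _ => ?_
  rw [Units.smul_def]
  congr 1
  simp only [Matrix.of_apply, MvPowerSeries.X_pow_eq]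
  rw [MvPowerSeries.prod_monomial, Finset.prod_const_one]
  congr 1
  rw [← Equiv.sum_comp σ.symm]
  simp only [Equiv.apply_symm_apply]
  exact congrArg _ (Finsupp.univ_sum_single
    (Finsupp.equivFunOnFinite.symm fun k => γ (σ.symm k)))

/-- Such a permutation is increasing, and a finite chain has no increasing bijection to itself
except the identity. -/
theorem perm_eq_one_of_strictAnti {n : ℕ} {α : Type*} [LinearOrder α] {γ δ : Fin n → α}
    (hγ : StrictAnti γ) (hδ : StrictAnti δ) {σ : Equiv.Perm (Fin n)}
    (h : ∀ k, γ (σ k) = δ k) : σ = 1 := by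
  have hm : StrictMono σ := by
    intro a b hab
    have h1 := hδ hab
    rw [← h, ← h] at h1
    exact hγ.lt_iff_gt.mp h1
  have h2 := Subsingleton.elim (α := Fin n ≃o Fin n) (hm.orderIsoOfSurjective _ σ.surjective)
    (OrderIso.refl _)
  ext k
  have := DFunLike.congr_fun h2 k
  exact congrArg Fin.val this

/-- Of all rearrangements of `γ` only `γ` itself is strictly decreasing, so strictly decreasing
exponents tell alternants apart. -/
theorem coeff_alternant {n : ℕ} {γ : Fin n → ℕ} (hγ : StrictAnti γ) {m : Fin n →₀ ℕ}
    (hm : StrictAnti m) :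
    MvPowerSeries.coeff m (alternant R γ) = if ⇑m = γ then 1 else 0 := by
  classical
  rw [alternant_eq_sum, map_sum, Finset.sum_eq_single 1]
  · rw [map_zsmul, MvPowerSeries.coeff_monomial]
    have : m = (Finsupp.equivFunOnFinite.symm fun k => γ ((1 : Equiv.Perm (Fin n)).symm k)) ↔ ⇑m = γ := by
      rw [Equiv.eq_symm_apply]; rfl
    rw [if_congr this rfl rfl]
    simp
  · intro σ _ hσ
    rw [map_zsmul, MvPowerSeries.coeff_monomial, if_neg, smul_zero]
    rintro rfl
    refine hσ ?_
    rw [← inv_eq_one]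
    exact perm_eq_one_of_strictAnti hγ hm fun k => rfl
  · simp

theorem strictAnti_staircase (n : ℕ) : StrictAnti fun j : Fin n => n - 1 - (j : ℕ) := by
  intro a b hab
  have : (a : ℕ) < b := hab
  have := b.2
  show n - 1 - (b : ℕ) < n - 1 - a
  omega

theorem strictAnti_add_staircase {n : ℕ} {γ : Fin n → ℕ} (hγ : Antitone γ) :
    StrictAnti fun j : Fin n => γ j + (n - 1 - (j : ℕ)) := fun _ _ hab =>
  add_lt_add_of_le_of_lt (hγ hab.le) (strictAnti_staircase n hab)

theorem alternant_staircase_ne_zero [Nontrivial R] (n : ℕ) :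
    alternant R (fun j : Fin n => n - 1 - (j : ℕ)) ≠ 0 := by
  intro h
  have := coeff_alternant (R := R) (strictAnti_staircase n)
    (m := Finsupp.equivFunOnFinite.symm fun j => n - 1 - (j : ℕ)) (strictAnti_staircase n)
  rw [h, map_zero] at this
  exact zero_ne_one (this.trans (if_pos rfl))

theorem rename_perm_alternant {n : ℕ} (σ : Equiv.Perm (Fin n)) (γ : Fin n → ℕ) :
    MvPowerSeries.rename σ (alternant R γ) = (Equiv.Perm.sign σ : ℤ) • alternant R γ := by
  rw [alternant, AlgHom.map_det]
  have : (MvPowerSeries.rename (R := R) σ).mapMatrix (Matrix.of fun i j : Fin n =>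
      (MvPowerSeries.X i : MvPowerSeries (Fin n) R) ^ γ j) = (Matrix.of fun i j : Fin n =>
      (MvPowerSeries.X i : MvPowerSeries (Fin n) R) ^ γ j).submatrix σ id := by
    ext1 i j
    simp [MvPowerSeries.rename_X]
  rw [this, Matrix.det_permute, zsmul_eq_mul]

/-- A permutation of the first `n` variables extends to a permutation of all variables, under which
`f` is invariant. -/
theorem rename_perm_restrictHom {n : ℕ} (σ : Equiv.Perm (Fin n)) (f : Sym R) :
    MvPowerSeries.rename σ (restrictHom R n f) = restrictHom R n f := by
  ext m
  obtain ⟨m, rfl⟩ : ∃ m', m = Finsupp.embDomain σ.toEmbedding m' :=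
    ⟨Finsupp.embDomain σ.symm.toEmbedding m, by
      ext k
      obtain ⟨k, rfl⟩ := σ.surjective k
      obtain ⟨l, rfl⟩ := σ.symm.surjective k
      rw [show σ (σ.symm l) = σ.toEmbedding (σ.symm l) from rfl, Finsupp.embDomain_apply_self,
        show σ.symm l = σ.symm.toEmbedding l from rfl, Finsupp.embDomain_apply_self]
      simp⟩
  refine (MvPowerSeries.coeff_embDomain_rename σ.toEmbedding _ m).trans ?_
  rw [coeff_restrictHom, coeff_restrictHom]
  rw [← coeff_embDomain_perm f (σ.viaFintypeEmbedding Fin.valEmbedding)]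
  congr 2
  simp only [Finsupp.embDomain_eq_mapDomain]
  rw [← Finsupp.mapDomain_comp, ← Finsupp.mapDomain_comp]
  congr 1
  ext k
  exact Equiv.Perm.viaFintypeEmbedding_apply_image σ Fin.valEmbedding k

end Alternant

/-! ### Jacobi–Trudi determinants and Schur functions -/

theorem exists_eq_or_exists_strictAnti {n : ℕ} {α : Type*} [LinearOrder α] (δ : Fin n → α) :
    (∃ i j, i ≠ j ∧ δ i = δ j) ∨ ∃ σ : Equiv.Perm (Fin n), StrictAnti fun k => δ (σ k) := by
  by_cases h : Function.Injective δ
  · right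
    let f : Fin n → αᵒᵈ := fun k => OrderDual.toDual (δ k)
    refine ⟨Tuple.sort f, ?_⟩
    have h1 : StrictMono (f ∘ Tuple.sort f) := (Tuple.monotone_sort f).strictMono_of_injective
      ((OrderDual.toDual.injective.comp h).comp (Tuple.sort f).injective)
    exact fun a b hab => h1 hab
  · left
    rw [Function.Injective] at h
    push Not at h
    obtain ⟨i, j, h1, h2⟩ := h
    exact ⟨i, j, h2, h1⟩

/-- The partition with rows `γ₀ ≥ γ₁ ≥ ⋯ ≥ γₙ₋₁`. -/
def ofRows {n : ℕ} (γ : Fin n → ℕ) (hγ : Antitone γ) : YoungDiagram where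
  cells := Finset.univ.biUnion fun k : Fin n => (Finset.range (γ k)).image fun l => ((k : ℕ), l)
  isLowerSet := by
    rintro ⟨a, b⟩ ⟨c, d⟩ ⟨h1 : c ≤ a, h2 : d ≤ b⟩ h
    simp only [Finset.coe_biUnion, Finset.coe_univ, Set.mem_univ, Set.iUnion_true, Set.mem_iUnion,
      Finset.coe_image, Set.mem_image, Finset.coe_range, Set.mem_Iio, Prod.mk.injEq] at h ⊢
    obtain ⟨k, l, hl, rfl, rfl⟩ := h
    exact ⟨⟨c, h1.trans_lt k.2⟩, d, (h2.trans_lt hl).trans_le (hγ h1), rfl, rfl⟩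

theorem mem_ofRows {n : ℕ} {γ : Fin n → ℕ} {hγ : Antitone γ} {a b : ℕ} :
    (a, b) ∈ ofRows γ hγ ↔ ∃ h : a < n, b < γ ⟨a, h⟩ := by
  rw [← YoungDiagram.mem_cells]
  simp only [ofRows, Finset.mem_biUnion, Finset.mem_univ, true_and, Finset.mem_image,
    Finset.mem_range, Prod.mk.injEq]
  constructor
  · rintro ⟨k, l, hl, rfl, rfl⟩
    exact ⟨k.2, hl⟩
  · rintro ⟨h, hb⟩
    exact ⟨⟨a, h⟩, b, hb, rfl, rfl⟩

theorem rowLen_ofRows {n : ℕ} {γ : Fin n → ℕ} {hγ : Antitone γ} (k : Fin n) :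
    (ofRows γ hγ).rowLen k = γ k := by
  refine eq_of_forall_lt_iff fun b => ?_
  rw [← YoungDiagram.mem_iff_lt_rowLen, mem_ofRows]
  simp

theorem colLen_ofRows_le {n : ℕ} {γ : Fin n → ℕ} {hγ : Antitone γ} :
    (ofRows γ hγ).colLen 0 ≤ n := by
  by_contra h
  rw [not_le, ← YoungDiagram.mem_iff_lt_colLen, mem_ofRows] at h
  obtain ⟨h, _⟩ := h
  exact lt_irrefl _ h

theorem rowLen_eq_zero_iff (lam : YoungDiagram) (k : ℕ) : lam.rowLen k = 0 ↔ lam.colLen 0 ≤ k := by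
  rw [← not_iff_not, not_le, ← YoungDiagram.mem_iff_lt_colLen, YoungDiagram.mem_iff_lt_rowLen]
  omega

theorem ext_of_rowLen {n : ℕ} {lam mu : YoungDiagram} (h1 : lam.colLen 0 ≤ n)
    (h2 : mu.colLen 0 ≤ n) (h : ∀ k : Fin n, lam.rowLen k = mu.rowLen k) : lam = mu := by
  ext ⟨a, b⟩
  rw [YoungDiagram.mem_cells, YoungDiagram.mem_cells, YoungDiagram.mem_iff_lt_rowLen,
    YoungDiagram.mem_iff_lt_rowLen]
  rcases lt_or_ge a n with ha | ha
  · rw [h ⟨a, ha⟩]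
  · rw [(rowLen_eq_zero_iff lam a).mpr (h1.trans ha), (rowLen_eq_zero_iff mu a).mpr (h2.trans ha)]

section JacobiTrudi

variable {R : Type*} [CommRing R]

/-- The Jacobi–Trudi determinant `det (h_{δ_j - (N - r)})`, where `δ` includes the shift by the
staircase. -/
def jacobiTrudi (R : Type*) [CommRing R] {N : ℕ} (δ : Fin N → ℤ) : Sym R :=
  (Matrix.of fun r j : Fin N => completeInt R (δ j - (N - 1 - (r : ℕ) : ℕ))).det

theorem jacobiTrudi_eq_sum {N : ℕ} (δ : Fin N → ℤ) :
    jacobiTrudi R δ = ∑ σ : Equiv.Perm (Fin N), (Equiv.Perm.sign σ : ℤ) •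
      ∏ j, completeInt R (δ j - (N - 1 - (σ j : ℕ) : ℕ)) := by
  rw [jacobiTrudi, Matrix.det_apply]
  rfl

theorem degreeLE_jacobiTrudi {N : ℕ} (δ : Fin N → ℤ) :
    DegreeLE (∑ j, δ j - ∑ j : Fin N, ((N - 1 - (j : ℕ) : ℕ) : ℤ)) (jacobiTrudi R δ) := by
  rw [jacobiTrudi_eq_sum]
  refine DegreeLE.sum _ _ fun σ _ => ?_
  rw [← Int.cast_smul_eq_zsmul R]
  refine DegreeLE.smul ?_ _
  rw [← Equiv.sum_comp σ (fun j : Fin N => ((N - 1 - (j : ℕ) : ℕ) : ℤ)), ← Finset.sum_sub_distrib]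
  exact DegreeLE.prod _ _ _ fun k _ => degreeLE_completeInt _

theorem restrictHom_jacobiTrudi (n : ℕ) {N : ℕ} (δ : Fin N → ℤ) :
    restrictHom R n (jacobiTrudi R δ) = (Matrix.of fun r j : Fin N =>
      restrictHom R n (completeInt R (δ j - (N - 1 - (r : ℕ) : ℕ)))).det := by
  rw [jacobiTrudi, AlgHom.map_det]
  rfl

theorem alternant_mul_jacobiTrudi {n : ℕ} (δ : Fin n → ℕ) :
    alternant R (fun j : Fin n => n - 1 - (j : ℕ)) *
      restrictHom R n (jacobiTrudi R fun j => (δ j : ℤ)) = alternant R δ := by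
  rw [restrictHom_jacobiTrudi]
  exact (det_pow_eq_mul _ (fun m => restrictHom R n (completeInt R m))
    (fun m hm => by simp only [completeInt_of_neg hm, map_zero]) (mk_complete_mul_prod n) δ).symm

theorem restrictHom_jacobiTrudi_eq_zero {n N : ℕ} (hn : n < N) (δ : Fin N → ℕ)
    (hδ : ∀ j, 0 < δ j) : restrictHom R n (jacobiTrudi R fun j => (δ j : ℤ)) = 0 := by
  rw [restrictHom_jacobiTrudi]
  exact det_complete_eq_zero hn _ (fun m => restrictHom R n (completeInt R m))
    (fun m hm => by simp only [completeInt_of_neg hm, map_zero]) (mk_complete_mul_prod n) δ hδ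

/-- The Jacobi–Trudi determinant of size `N` of a partition. -/
def rowsJacobiTrudi (R : Type*) [CommRing R] (lam : YoungDiagram) (N : ℕ) : Sym R :=
  jacobiTrudi R fun j : Fin N => ((lam.rowLen j + (N - 1 - (j : ℕ)) : ℕ) : ℤ)

theorem rowsJacobiTrudi_eq_det (lam : YoungDiagram) (N : ℕ) : rowsJacobiTrudi R lam N =
    (Matrix.of fun r j : Fin N => completeInt R (lam.rowLen j + (r : ℕ) - (j : ℕ))).det := by
  rw [rowsJacobiTrudi, jacobiTrudi]
  congr 2
  ext1 r
  ext1 j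
  congr 1
  have := r.2
  have := j.2
  omega

/-- For an empty last row the last column has entries `h_{r-N}`, that is `(0, …, 0, 1)`. -/
theorem rowsJacobiTrudi_succ (lam : YoungDiagram) {N : ℕ} (hN : lam.colLen 0 ≤ N) :
    rowsJacobiTrudi R lam (N + 1) = rowsJacobiTrudi R lam N := by
  rw [rowsJacobiTrudi_eq_det, rowsJacobiTrudi_eq_det, Matrix.det_succ_column _ (Fin.last N),
    Finset.sum_eq_single (Fin.last N)]
  · rw [Matrix.of_apply, Fin.val_last, (rowLen_eq_zero_iff lam N).mpr hN]
    have h : completeInt R ((0 : ℕ) + (N : ℤ) - N) = 1 := by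
      rw [show ((0 : ℕ) + (N : ℤ) - N) = (0 : ℕ) by simp, completeInt_natCast, complete_zero]
    have hs := Even.neg_one_pow (α := Sym R) (n := N + N) ⟨N, rfl⟩
    rw [h]
    refine (congrArg (fun t => t * 1 * _) hs).trans ?_
    rw [mul_one, one_mul]
    refine congrArg Matrix.det ?_
    ext1 r j
    simp
  · intro r _ hr
    rw [Matrix.of_apply, Fin.val_last, (rowLen_eq_zero_iff lam N).mpr hN, completeInt_of_neg]
    · simp
    · have := Fin.val_lt_last hr
      push_cast
      omega
  · simp

theorem rowsJacobiTrudi_eq (lam : YoungDiagram) {N : ℕ} (hN : lam.colLen 0 ≤ N) :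
    rowsJacobiTrudi R lam N = rowsJacobiTrudi R lam (lam.colLen 0) := by
  induction N, hN using Nat.le_induction with
  | base => rfl
  | succ N hN ih => rw [rowsJacobiTrudi_succ lam hN, ih]

theorem embDomain_perm_apply {n : ℕ} (σ : Equiv.Perm (Fin n)) (m : Fin n →₀ ℕ) (k : Fin n) :
    Finsupp.embDomain σ.toEmbedding m k = m (σ.symm k) := by
  obtain ⟨k, rfl⟩ := σ.surjective k
  rw [Equiv.symm_apply_apply]
  exact Finsupp.embDomain_apply_self _ _ _

theorem coeff_embDomain_of_rename {n : ℕ} {σ : Equiv.Perm (Fin n)} {P : MvPowerSeries (Fin n) R}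
    (h : MvPowerSeries.rename σ P = (Equiv.Perm.sign σ : ℤ) • P) (m : Fin n →₀ ℕ) :
    MvPowerSeries.coeff (Finsupp.embDomain σ.toEmbedding m) P =
      (Equiv.Perm.sign σ : ℤ) • MvPowerSeries.coeff m P := by
  have h2 : MvPowerSeries.coeff (Finsupp.embDomain σ.toEmbedding m) (MvPowerSeries.rename σ P) =
      MvPowerSeries.coeff m P := MvPowerSeries.coeff_embDomain_rename σ.toEmbedding P m
  rw [h, map_zsmul] at h2
  rw [← h2, smul_smul, Int.units_coe_mul_self, one_smul]

variable [IsDomain R]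

/-- The determinant satisfies the equation defining the Schur function, and that equation has only
one solution: once the number of variables exceeds both degrees, the Vandermonde cancels in a domain
and restriction loses nothing. -/
theorem schur_eq (lam : YoungDiagram) {N : ℕ} (hN : lam.colLen 0 ≤ N) :
    schur R lam = rowsJacobiTrudi R lam N := by
  have h : ∃ f : Sym R, ∀ n : ℕ, lam.colLen 0 ≤ n →
      alternant R (fun j : Fin n => n - 1 - j) * restrict n f =
        alternant R (fun j : Fin n => lam.rowLen j + (n - 1 - j)) := by
    refine ⟨rowsJacobiTrudi R lam (lam.colLen 0), fun n hn => ?_⟩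
    rw [← rowsJacobiTrudi_eq lam hn]
    exact alternant_mul_jacobiTrudi _
  rw [schur, dif_pos h]
  obtain ⟨d, hd⟩ := exists_degreeLE h.choose
  obtain ⟨e, he⟩ := exists_degreeLE (rowsJacobiTrudi R lam N)
  let n := max (max d e) (lam.colLen 0)
  have hn : lam.colLen 0 ≤ n := le_max_right _ _
  refine eq_of_restrictHom_eq (n := n) (fun m hm => hd m ?_) (fun m hm => he m ?_) ?_
  · have : d ≤ n := (le_max_left _ _).trans (le_max_left _ _)
    omega
  · have : e ≤ n := (le_max_right _ _).trans (le_max_left _ _)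
    omega
  · refine mul_left_cancel₀ (alternant_staircase_ne_zero (R := R) n) ?_
    refine (h.choose_spec n hn).trans ?_
    rw [rowsJacobiTrudi_eq lam hN, ← rowsJacobiTrudi_eq lam hn]
    exact (alternant_mul_jacobiTrudi _).symm

theorem alternant_mul_schur (lam : YoungDiagram) {n : ℕ} (hn : lam.colLen 0 ≤ n) :
    alternant R (fun j : Fin n => n - 1 - (j : ℕ)) * restrictHom R n (schur R lam) =
      alternant R (fun j : Fin n => lam.rowLen j + (n - 1 - (j : ℕ))) := by
  rw [schur_eq lam hn]
  exact alternant_mul_jacobiTrudi _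

theorem restrictHom_schur_eq_zero (lam : YoungDiagram) {n : ℕ} (hn : n < lam.colLen 0) :
    restrictHom R n (schur R lam) = 0 := by
  rw [schur_eq lam le_rfl]
  refine restrictHom_jacobiTrudi_eq_zero hn _ fun j => ?_
  have := (rowLen_eq_zero_iff lam j).not.mpr (not_le.mpr j.2)
  omega

theorem antitone_rowLen (lam : YoungDiagram) (n : ℕ) : Antitone fun j : Fin n => lam.rowLen j :=
  fun _ _ h => lam.rowLen_anti _ _ h

/-- Multiplied by the Vandermonde in enough variables, Schur functions become alternants, which are
separated by their coefficients at the exponents `mu + ρ`. -/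
theorem linearIndependent_schur : LinearIndependent R (schur R) := by
  classical
  rw [linearIndependent_iff']
  intro s g hg mu hmu
  let n := s.sup fun lam => lam.colLen 0
  have hn : ∀ lam ∈ s, lam.colLen 0 ≤ n := fun lam hlam =>
    Finset.le_sup (f := fun lam : YoungDiagram => lam.colLen 0) hlam
  have h1 : ∑ lam ∈ s, g lam •
      alternant R (fun j : Fin n => lam.rowLen j + (n - 1 - (j : ℕ))) = 0 := by
    have h2 := congrArg (fun f => alternant R (fun j : Fin n => n - 1 - (j : ℕ)) *
      restrictHom R n f) hg
    simp only [map_sum, map_smul, map_zero, mul_zero, Finset.mul_sum, mul_smul_comm] at h2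
    rw [← h2]
    exact Finset.sum_congr rfl fun lam hlam => by rw [alternant_mul_schur lam (hn lam hlam)]
  have h3 := congrArg (MvPowerSeries.coeff (Finsupp.equivFunOnFinite.symm
    fun j : Fin n => mu.rowLen j + (n - 1 - (j : ℕ)))) h1
  rw [map_sum, map_zero, Finset.sum_eq_single mu] at h3
  · rw [MvPowerSeries.coeff_smul, coeff_alternant (strictAnti_add_staircase (antitone_rowLen mu n))
      (strictAnti_add_staircase (antitone_rowLen mu n))] at h3
    simpa using h3
  · intro lam hlam hne
    rw [MvPowerSeries.coeff_smul, coeff_alternant (strictAnti_add_staircase (antitone_rowLen lam n))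
      (strictAnti_add_staircase (antitone_rowLen mu n)), if_neg, mul_zero]
    intro h
    refine hne (ext_of_rowLen (hn lam hlam) (hn mu hmu) fun k => ?_)
    have := congrFun h k
    simp only [Finsupp.equivFunOnFinite_symm_apply_apply] at this
    omega
  · exact fun h => absurd hmu h

/-- Subtracting the staircase from a strictly decreasing sequence of natural numbers leaves a
partition. -/
theorem jacobiTrudi_mem_span {n : ℕ} {δ : Fin n → ℕ} (hδ : StrictAnti δ) :
    jacobiTrudi R (fun j => (δ j : ℤ)) ∈ Submodule.span R (Set.range (schur R)) := by
  have h1 : ∀ a b : Fin n, a ≤ b → (δ b + (b - a : ℕ) : ℕ) ≤ δ a := by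
    intro a b hab
    obtain ⟨b, hb⟩ := b
    induction b with
    | zero =>
      have : a = ⟨0, hb⟩ := le_antisymm hab (Nat.zero_le _)
      subst this; simp
    | succ b ih =>
      rcases eq_or_lt_of_le hab with h | h
      · subst h; simp
      · have h2 : a ≤ ⟨b, by omega⟩ := Nat.lt_succ_iff.mp h
        have h3 := ih (by omega) h2
        have h4 : δ ⟨b + 1, hb⟩ < δ ⟨b, by omega⟩ := hδ (Nat.lt_succ_self b)
        have h5 : (a : ℕ) ≤ b := h2
        simp only at h3 ⊢
        omega
  have h2 : ∀ a : Fin n, n - 1 - (a : ℕ) ≤ δ a := by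
    intro a
    have h3 : a ≤ ⟨n - 1, by have := a.2; omega⟩ := Nat.le_sub_one_of_lt a.2
    have := h1 a _ h3
    simp only at this
    omega
  have h3 : Antitone fun a : Fin n => δ a - (n - 1 - (a : ℕ)) := by
    intro a b hab
    have h4 := h1 a b hab
    have h5 : (a : ℕ) ≤ b := hab
    have := b.2
    show δ b - (n - 1 - (b : ℕ)) ≤ δ a - (n - 1 - (a : ℕ))
    have := h2 a
    have := h2 b
    omega
  have h4 : jacobiTrudi R (fun j => (δ j : ℤ)) = schur R (ofRows _ h3) := by
    rw [schur_eq _ colLen_ofRows_le, rowsJacobiTrudi]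
    congr 1
    ext j
    rw [rowLen_ofRows, Nat.sub_add_cancel (h2 j)]
  rw [h4]
  exact Submodule.subset_span ⟨_, rfl⟩

theorem sum_eq_sum_degree {n : ℕ} (m : Fin n →₀ ℕ) : ∑ j, (m j : ℤ) = m.degree := by
  rw [Finsupp.degree_eq_sum]
  push_cast
  rfl

/-- Let `n` bound the degree of `f`. The Vandermonde times `f[x₁ + ⋯ + xₙ]` is antisymmetric, hence
a combination of alternants. The same combination of Jacobi–Trudi determinants has degree at most
`n` and the same product with the Vandermonde, so it is `f`. -/
theorem span_schur [CharZero R] : ⊤ ≤ Submodule.span R (Set.range (schur R)) := by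
  classical
  rintro f -
  obtain ⟨n, hf⟩ := exists_degreeLE f
  let D : ℕ := ∑ j : Fin n, (n - 1 - (j : ℕ))
  set G := alternant R (fun j : Fin n => n - 1 - (j : ℕ)) * restrictHom R n f with hG
  -- The Vandermonde is homogeneous of degree `D`; the bound leaves only finitely many exponents.
  have hdeg : ∀ m : Fin n →₀ ℕ, n + D < m.degree → MvPowerSeries.coeff m G = 0 := by
    intro m hm
    rw [hG, MvPowerSeries.coeff_mul]
    refine Finset.sum_eq_zero fun p hp => ?_
    have hp' : p.1 + p.2 = m := Finset.HasAntidiagonal.mem_antidiagonal.mp hp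
    have h : p.1.degree + p.2.degree = m.degree := by rw [← hp', map_add]
    rcases lt_or_ge n p.2.degree with h1 | h1
    · rw [coeff_restrictHom, hf, mul_zero]
      rw [Finsupp.embDomain_eq_mapDomain, Finsupp.degree_mapDomain]
      exact_mod_cast h1
    · rw [alternant_eq_sum, map_sum, Finset.sum_eq_zero, zero_mul]
      intro σ _
      rw [map_zsmul, MvPowerSeries.coeff_monomial, if_neg, smul_zero]
      intro h2
      have h3 : p.1.degree = D := by
        rw [h2, Finsupp.degree_eq_sum]
        exact Equiv.sum_comp σ.symm (fun j : Fin n => n - 1 - (j : ℕ))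
      omega
  have hanti : ∀ (σ : Equiv.Perm (Fin n)) (m : Fin n →₀ ℕ),
      MvPowerSeries.coeff (Finsupp.embDomain σ.toEmbedding m) G =
        (Equiv.Perm.sign σ : ℤ) • MvPowerSeries.coeff m G := by
    intro σ m
    have h1 : MvPowerSeries.rename σ G = (Equiv.Perm.sign σ : ℤ) • G := by
      rw [hG, map_mul, rename_perm_alternant, rename_perm_restrictHom, smul_mul_assoc]
    exact coeff_embDomain_of_rename h1 m
  let T : Finset (Fin n →₀ ℕ) :=
    (Finsupp.finite_of_degree_le (σ := Fin n) (n + D)).toFinset.filter fun m => StrictAnti m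
  have hT : ∀ m : Fin n →₀ ℕ, m ∈ T ↔ m.degree ≤ n + D ∧ StrictAnti m := by
    intro m
    simp [T]
  let F : Sym R := ∑ m ∈ T, MvPowerSeries.coeff m G • jacobiTrudi R (fun j => (m j : ℤ))
  have hF : F ∈ Submodule.span R (Set.range (schur R)) :=
    Submodule.sum_mem _ fun m hm => Submodule.smul_mem _ _ (jacobiTrudi_mem_span ((hT m).mp hm).2)
  have hFd : DegreeLE n F := by
    refine DegreeLE.sum _ _ fun m hm => DegreeLE.smul (fun k hk => degreeLE_jacobiTrudi _ k ?_) _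
    rw [sum_eq_sum_degree]
    have h1 := ((hT m).mp hm).1
    have h2 : ∑ j : Fin n, ((n - 1 - (j : ℕ) : ℕ) : ℤ) = D := by simp [D]
    rw [h2]
    omega
  have hGF : alternant R (fun j : Fin n => n - 1 - (j : ℕ)) * restrictHom R n F =
      ∑ m ∈ T, MvPowerSeries.coeff m G • alternant R m := by
    simp only [F, map_sum, map_smul, Finset.mul_sum, mul_smul_comm]
    exact Finset.sum_congr rfl fun m _ => by rw [alternant_mul_jacobiTrudi]
  have hanti' : ∀ (σ : Equiv.Perm (Fin n)) (m : Fin n →₀ ℕ),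
      MvPowerSeries.coeff (Finsupp.embDomain σ.toEmbedding m)
        (∑ m ∈ T, MvPowerSeries.coeff m G • alternant R m) = (Equiv.Perm.sign σ : ℤ) •
      MvPowerSeries.coeff m (∑ m ∈ T, MvPowerSeries.coeff m G • alternant R m) := by
    intro σ m
    have h1 : MvPowerSeries.rename σ (∑ m ∈ T, MvPowerSeries.coeff m G • alternant R m) =
        (Equiv.Perm.sign σ : ℤ) • ∑ m ∈ T, MvPowerSeries.coeff m G • alternant R m := by
      rw [map_sum, Finset.smul_sum]
      refine Finset.sum_congr rfl fun m _ => ?_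
      rw [map_smul, rename_perm_alternant, smul_comm]
    exact coeff_embDomain_of_rename h1 m
  -- At an exponent with two equal entries a transposition gives `c = -c`; characteristic zero is
  -- needed to conclude `c = 0`.
  have hzero : ∀ (P : MvPowerSeries (Fin n) R), (∀ (σ : Equiv.Perm (Fin n)) (m : Fin n →₀ ℕ),
      MvPowerSeries.coeff (Finsupp.embDomain σ.toEmbedding m) P =
        (Equiv.Perm.sign σ : ℤ) • MvPowerSeries.coeff m P) → ∀ (m : Fin n →₀ ℕ) (i j : Fin n),
      i ≠ j → m i = m j → MvPowerSeries.coeff m P = 0 := by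
    intro P hP m i j hij hm
    have h1 := hP (Equiv.swap i j) m
    have h2 : Finsupp.embDomain (Equiv.swap i j).toEmbedding m = m := by
      ext k
      rw [embDomain_perm_apply, Equiv.symm_swap]
      rcases eq_or_ne k i with rfl | hki
      · rw [Equiv.swap_apply_left, hm]
      · rcases eq_or_ne k j with rfl | hkj
        · rw [Equiv.swap_apply_right, hm]
        · rw [Equiv.swap_apply_of_ne_of_ne hki hkj]
    rw [h2, Equiv.Perm.sign_swap hij] at h1
    simpa [self_eq_neg] using h1
  have hGG : G = ∑ m ∈ T, MvPowerSeries.coeff m G • alternant R m := by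
    ext m
    rcases exists_eq_or_exists_strictAnti m with ⟨i, j, hij, hm⟩ | ⟨σ, hσ⟩
    · rw [hzero G hanti m i j hij hm, hzero _ hanti' m i j hij hm]
    · let k : Fin n →₀ ℕ := Finsupp.equivMapDomain σ.symm m
      have hk : Finsupp.embDomain σ.toEmbedding k = m := by
        ext l
        rw [embDomain_perm_apply]
        simp [k]
      have hk' : StrictAnti k := hσ
      rw [← hk, hanti, hanti']
      congr 1
      have h5 : ∀ l ∈ T, MvPowerSeries.coeff k (MvPowerSeries.coeff l G • alternant R l) =
          if k = l then MvPowerSeries.coeff l G else 0 := by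
        intro l hl
        rw [MvPowerSeries.coeff_smul, coeff_alternant ((hT l).mp hl).2 hk']
        simp only [DFunLike.coe_fn_eq, mul_ite, mul_one, mul_zero]
      rw [map_sum, Finset.sum_congr rfl h5, Finset.sum_ite_eq]
      split_ifs with h6
      · rfl
      · refine hdeg k ?_
        by_contra h7
        exact h6 ((hT k).mpr ⟨not_lt.mp h7, hk'⟩)
  have : f = F := by
    refine eq_of_restrictHom_eq hf hFd ?_
    refine mul_left_cancel₀ (alternant_staircase_ne_zero (R := R) n) ?_
    rw [hGF, ← hGG]
  rw [this]
  exact hF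

/-- The basis of Schur functions. -/
def schurBasis (R : Type*) [CommRing R] [IsDomain R] [CharZero R] :
    Module.Basis YoungDiagram R (Sym R) :=
  Module.Basis.mk linearIndependent_schur span_schur

theorem schurBasis_apply (R : Type*) [CommRing R] [IsDomain R] [CharZero R] (lam : YoungDiagram) :
    schurBasis R lam = schur R lam :=
  Module.Basis.mk_apply _ _ _

end JacobiTrudi

/-! ### Permutations of weights -/

section Weights

variable {Q0 : Type*} {ν : Q0 → ℕ}

/-- The group of permutations of the variables at each vertex. -/
abbrev VertexPerm (ν : Q0 → ℕ) : Type _ := (i : Q0) → Equiv.Perm (Fin (ν i))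

/-- The action of permutations on weights. -/
def permWeight (w : VertexPerm ν) : Weight ν →+ Weight ν where
  toFun := fun γ i k => γ i ((w i).symm k)
  map_zero' := rfl
  map_add' := fun _ _ => rfl

theorem permWeight_apply (w : VertexPerm ν) (γ : Weight ν) (i : Q0) (k : Fin (ν i)) :
    permWeight w γ i k = γ i ((w i).symm k) := rfl

theorem permWeight_mul (w w' : VertexPerm ν) (γ : Weight ν) :
    permWeight (w * w') γ = permWeight w (permWeight w' γ) := rfl

theorem permWeight_one (γ : Weight ν) : permWeight 1 γ = γ := rfl

theorem permWeight_inv_apply (w : VertexPerm ν) (γ : Weight ν) :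
    permWeight w⁻¹ (permWeight w γ) = γ := by
  rw [← permWeight_mul, inv_mul_cancel, permWeight_one]

theorem permWeight_apply_inv (w : VertexPerm ν) (γ : Weight ν) :
    permWeight w (permWeight w⁻¹ γ) = γ := by
  rw [← permWeight_mul, mul_inv_cancel, permWeight_one]

theorem permWeight_eq_iff (w : VertexPerm ν) (γ δ : Weight ν) :
    permWeight w γ = δ ↔ γ = permWeight w⁻¹ δ := by
  constructor
  · rintro rfl; rw [permWeight_inv_apply]
  · rintro rfl; rw [permWeight_apply_inv]

theorem permWeight_injective (w : VertexPerm ν) : Function.Injective (permWeight w) := fun γ δ h =>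
  by rw [← permWeight_inv_apply w γ, h, permWeight_inv_apply]

theorem strictAnti_int_add_le {n : ℕ} {δ : Fin n → ℤ} (hδ : StrictAnti δ) :
    ∀ a b : Fin n, a ≤ b → δ b + ((b : ℕ) - (a : ℕ) : ℤ) ≤ δ a := by
  intro a b hab
  obtain ⟨b, hb⟩ := b
  induction b with
  | zero =>
    have : a = ⟨0, hb⟩ := le_antisymm hab (Nat.zero_le _)
    subst this; simp
  | succ b ih =>
    rcases eq_or_lt_of_le hab with h | h
    · subst h; simp
    · have h3 := ih (by omega) (Nat.lt_succ_iff.mp h)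
      have h4 : δ ⟨b + 1, hb⟩ < δ ⟨b, by omega⟩ := hδ (Nat.lt_succ_self b)
      simp only at h3 ⊢
      push_cast
      omega

theorem strictAnti_add_rho (lam : DominantWeight ν) (i : Q0) : StrictAnti ((lam.1 + rho ν) i) := by
  intro a b hab
  have h1 := lam.2 i hab.le
  have h2 : (a : ℕ) < b := hab
  show lam.1 i b + ((ν i : ℤ) - 1 - (b : ℕ)) < lam.1 i a + ((ν i : ℤ) - 1 - (a : ℕ))
  omega

theorem eq_of_permWeight_add_rho {w : VertexPerm ν} {lam mu : DominantWeight ν}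
    (h : permWeight w (lam.1 + rho ν) = mu.1 + rho ν) : w = 1 ∧ lam = mu := by
  have h1 : w⁻¹ = 1 := by
    funext i
    exact perm_eq_one_of_strictAnti (strictAnti_add_rho lam i) (strictAnti_add_rho mu i)
      fun k => congrFun (congrFun h i) k
  have h2 : w = 1 := inv_eq_one.mp h1
  subst h2
  exact ⟨rfl, Subtype.ext (add_right_cancel h)⟩

variable [Fintype Q0]

/-- The product of the signs of the permutations at each vertex. -/
def vertexSign (w : VertexPerm ν) : ℤ := ∏ i, (Equiv.Perm.sign (w i) : ℤ)

theorem vertexSign_mul (w w' : VertexPerm ν) :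
    vertexSign (w * w') = vertexSign w * vertexSign w' := by
  simp [vertexSign, Finset.prod_mul_distrib]

theorem vertexSign_one : vertexSign (1 : VertexPerm ν) = 1 := by simp [vertexSign]

theorem vertexSign_inv (w : VertexPerm ν) : vertexSign w⁻¹ = vertexSign w := by simp [vertexSign]

theorem vertexSign_mul_self (w : VertexPerm ν) : vertexSign w * vertexSign w = 1 := by
  simp [vertexSign, ← Finset.prod_mul_distrib]

/-- A repeated entry is fixed by a transposition. Otherwise the entries can be sorted into a
strictly decreasing sequence, and subtracting `ρ` leaves a weakly decreasing one. Identities between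
antisymmetric quantities are checked on these two cases. -/
theorem weight_cases [DecidableEq Q0] (δ : Weight ν) :
    (∃ w : VertexPerm ν, vertexSign w = -1 ∧ permWeight w δ = δ) ∨
      ∃ (w : VertexPerm ν) (lam : DominantWeight ν), δ = permWeight w (lam.1 + rho ν) := by
  by_cases h : ∃ j, ∃ a b, a ≠ b ∧ δ j a = δ j b
  · left
    obtain ⟨j, a, b, hab, h⟩ := h
    refine ⟨Function.update 1 j (Equiv.swap a b), ?_, ?_⟩
    · rw [vertexSign, Finset.prod_eq_single j]
      · simp [Equiv.Perm.sign_swap hab]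
      · intro i _ hi
        simp [Function.update_of_ne hi]
      · simp
    · funext i k
      rw [permWeight_apply]
      rcases eq_or_ne i j with rfl | hi
      · rw [Function.update_self, Equiv.symm_swap]
        rcases eq_or_ne k a with rfl | hka
        · rw [Equiv.swap_apply_left, h]
        · rcases eq_or_ne k b with rfl | hkb
          · rw [Equiv.swap_apply_right, h]
          · rw [Equiv.swap_apply_of_ne_of_ne hka hkb]
      · rw [Function.update_of_ne hi]
        rfl
  · right
    have h1 : ∀ j, ∃ σ : Equiv.Perm (Fin (ν j)), StrictAnti fun k => δ j (σ k) := fun j =>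
      (exists_eq_or_exists_strictAnti (δ j)).resolve_left fun hj => h ⟨j, hj⟩
    choose w hw using h1
    refine ⟨w, ⟨fun i k => δ i (w i k) - rho ν i k, fun i a b hab => ?_⟩, ?_⟩
    · have h2 := strictAnti_int_add_le (hw i) a b hab
      simp only [rho]
      omega
    · funext i k
      simp [permWeight_apply]

variable [DecidableEq Q0]

/-- The coefficient of `x^δ` in the alternant of `x^κ`. -/
def altCoeff (δ κ : Weight ν) : ℤ :=
  ∑ w : VertexPerm ν, if permWeight w κ = δ then vertexSign w else 0

/-- Inverting `w` exchanges the roles of the two weights and preserves the sign. The current and the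
shuffle product produce the two arguments in opposite orders. -/
theorem altCoeff_comm (δ κ : Weight ν) : altCoeff δ κ = altCoeff κ δ := by
  classical
  rw [altCoeff, altCoeff, ← Equiv.sum_comp (Equiv.inv (VertexPerm ν))]
  refine Finset.sum_congr rfl fun w _ => ?_
  rw [Equiv.inv_apply, vertexSign_inv]
  refine if_congr ?_ rfl rfl
  rw [permWeight_eq_iff, inv_inv, eq_comm]

theorem altCoeff_permWeight (w : VertexPerm ν) (δ κ : Weight ν) :
    altCoeff (permWeight w δ) κ = vertexSign w * altCoeff δ κ := by
  classical
  rw [altCoeff, altCoeff, Finset.mul_sum, ← Equiv.sum_comp (Equiv.mulLeft w)]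
  refine Finset.sum_congr rfl fun w' _ => ?_
  rw [Equiv.coe_mulLeft, vertexSign_mul, mul_ite, mul_zero]
  refine if_congr ?_ rfl rfl
  rw [permWeight_mul, (permWeight_injective w).eq_iff]

theorem altCoeff_eq_zero {w : VertexPerm ν} {δ : Weight ν} (hw : vertexSign w = -1)
    (hδ : permWeight w δ = δ) (κ : Weight ν) : altCoeff δ κ = 0 := by
  have h := altCoeff_permWeight w δ κ
  rw [hδ, hw] at h
  omega

theorem altCoeff_add_rho (lam mu : DominantWeight ν) [Decidable (lam = mu)] :
    altCoeff (lam.1 + rho ν) (mu.1 + rho ν) = if lam = mu then 1 else 0 := by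
  classical
  rw [altCoeff, Finset.sum_eq_single 1]
  · rw [permWeight_one, vertexSign_one]
    refine if_congr ⟨fun h => Subtype.ext (add_right_cancel h.symm), fun h => by rw [h]⟩ rfl rfl
  · intro w _ hw
    rw [if_neg]
    exact fun h => hw (eq_of_permWeight_add_rho h).1
  · simp

end Weights

/-! ### Alternants of Laurent polynomials and Schur polynomials -/

section Torus

variable {Q0 : Type*} {ν : Q0 → ℕ}

theorem mono_mul (γ δ : Weight ν) : (mono γ * mono δ : TorusRing ν) = mono (γ + δ) := by
  rw [mono, mono, mono, AddMonoidAlgebra.single_mul_single, mul_one]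

theorem mono_zero : (mono 0 : TorusRing ν) = 1 := rfl

theorem mono_pow (γ : Weight ν) (n : ℕ) : (mono γ ^ n : TorusRing ν) = mono (n • γ) := by
  induction n with
  | zero => rw [pow_zero, zero_smul, mono_zero]
  | succ n ih => rw [pow_succ, ih, mono_mul, succ_nsmul]

theorem prod_mono {κ : Type*} (s : Finset κ) (γ : κ → Weight ν) :
    (∏ k ∈ s, mono (γ k) : TorusRing ν) = mono (∑ k ∈ s, γ k) := by
  classical
  induction s using Finset.induction_on with
  | empty => rfl
  | insert a s ha ih => rw [Finset.prod_insert ha, Finset.sum_insert ha, ih, mono_mul]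

theorem coeff_mono [DecidableEq (Weight ν)] (γ δ : Weight ν) :
    (mono γ : TorusRing ν).coeff δ = if γ = δ then 1 else 0 := by
  rw [mono, AddMonoidAlgebra.coeff_single, Finsupp.single_apply]

theorem permute_mono (w : VertexPerm ν) (γ : Weight ν) :
    permute w (mono γ) = mono (permWeight w γ) :=
  AddMonoidAlgebra.mapDomain_single

theorem torus_induction {P : TorusRing ν → Prop} (f : TorusRing ν) (hm : ∀ γ, P (mono γ))
    (ha : ∀ f g, P f → P g → P (f + g)) (hn : ∀ f, P f → P (-f)) (h0 : P 0) : P f := by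
  refine AddMonoidAlgebra.induction_linear f h0 (fun f g => ha f g) fun γ n => ?_
  have h1 : ∀ n : ℕ, P (n • mono γ) := by
    intro n
    induction n with
    | zero => rw [zero_smul]; exact h0
    | succ n ih => rw [succ_nsmul]; exact ha _ _ ih (hm γ)
  have h2 : ∀ n : ℤ, (AddMonoidAlgebra.single γ n : TorusRing ν) = n • mono γ := fun n => by
    rw [mono, AddMonoidAlgebra.smul_single, smul_eq_mul, mul_one]
  rw [h2]
  obtain ⟨m, rfl | rfl⟩ := n.eq_nat_or_neg
  · rw [natCast_zsmul]; exact h1 m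
  · rw [neg_smul, natCast_zsmul]; exact hn _ (h1 m)

theorem permute_mul (w w' : VertexPerm ν) (f : TorusRing ν) :
    permute (w * w') f = permute w (permute w' f) := by
  induction f using torus_induction with
  | hm γ => simp only [permute_mono, permWeight_mul]
  | ha f g hf hg => simp only [map_add, hf, hg]
  | hn f hf => simp only [map_neg, hf]
  | h0 => simp only [map_zero]

theorem coeff_sum_torus {κ : Type*} (s : Finset κ) (f : κ → TorusRing ν) (δ : Weight ν) :
    (∑ k ∈ s, f k).coeff δ = ∑ k ∈ s, (f k).coeff δ := by
  classical
  induction s using Finset.induction_on with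
  | empty => rfl
  | insert a s ha ih => rw [Finset.sum_insert ha, Finset.sum_insert ha, ← ih]; rfl

theorem coeff_zsmul_torus (n : ℤ) (f : TorusRing ν) (δ : Weight ν) :
    (n • f).coeff δ = n * f.coeff δ := by
  rw [AddMonoidAlgebra.coeff_smul]; rfl

variable [Fintype Q0] [DecidableEq Q0]

theorem antisymmetrize_eq (f : TorusRing ν) :
    antisymmetrize f = ∑ w : VertexPerm ν, vertexSign w • permute w f := rfl

theorem antisymmetrize_add (f g : TorusRing ν) :
    antisymmetrize (f + g) = antisymmetrize f + antisymmetrize g := by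
  simp only [antisymmetrize_eq, map_add, smul_add, Finset.sum_add_distrib]

/-- The antisymmetrizer as an additive homomorphism. -/
def antisymmetrizeHom (ν : Q0 → ℕ) : TorusRing ν →+ TorusRing ν where
  toFun := antisymmetrize
  map_zero' := by simp [antisymmetrize_eq]
  map_add' := antisymmetrize_add

theorem antisymmetrizeHom_apply (f : TorusRing ν) : antisymmetrizeHom ν f = antisymmetrize f := rfl

theorem permute_antisymmetrize (w : VertexPerm ν) (f : TorusRing ν) :
    permute w (antisymmetrize f) = vertexSign w • antisymmetrize f := by
  rw [antisymmetrize_eq, map_sum, Finset.smul_sum]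
  conv_rhs => rw [← Equiv.sum_comp (Equiv.mulLeft w)]
  refine Finset.sum_congr rfl fun w' _ => ?_
  rw [map_zsmul, Equiv.coe_mulLeft, vertexSign_mul, smul_smul, ← mul_assoc, vertexSign_mul_self,
    one_mul, permute_mul]

theorem antisymmetrize_permute (w : VertexPerm ν) (f : TorusRing ν) :
    antisymmetrize (permute w f) = vertexSign w • antisymmetrize f := by
  rw [antisymmetrize_eq, antisymmetrize_eq, Finset.smul_sum]
  conv_rhs => rw [← Equiv.sum_comp (Equiv.mulRight w)]
  refine Finset.sum_congr rfl fun w' _ => ?_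
  rw [Equiv.coe_mulRight, vertexSign_mul, smul_smul, mul_comm (vertexSign w'), ← mul_assoc,
    vertexSign_mul_self, one_mul, permute_mul]

theorem antisymmetrize_mul_of_symmetric (f g : TorusRing ν) (hg : ∀ w, permute w g = g) :
    antisymmetrize (f * g) = antisymmetrize f * g := by
  rw [antisymmetrize_eq, antisymmetrize_eq, Finset.sum_mul]
  refine Finset.sum_congr rfl fun w _ => ?_
  rw [map_mul, hg, smul_mul_assoc]

theorem coeff_antisymmetrize_mono (δ κ : Weight ν) :
    (antisymmetrize (mono κ)).coeff δ = altCoeff δ κ := by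
  classical
  rw [antisymmetrize_eq, coeff_sum_torus, altCoeff]
  refine Finset.sum_congr rfl fun w _ => ?_
  rw [permute_mono, coeff_zsmul_torus, coeff_mono, mul_ite, mul_one, mul_zero]

theorem antisymmetrize_mono_rho_ne_zero : antisymmetrize (mono (rho ν)) ≠ 0 := by
  classical
  intro h
  have h1 := coeff_antisymmetrize_mono (rho ν) (rho ν)
  let lam : DominantWeight ν := ⟨0, fun _ => antitone_const⟩
  have h2 := altCoeff_add_rho lam lam
  rw [if_pos rfl, show lam.1 + rho ν = rho ν from zero_add _, ← h1, h] at h2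
  exact zero_ne_one h2

theorem zsmul_eps_sum (κ : Weight ν) : ∑ i, ∑ k, κ i k • eps i k = κ := by
  funext i k
  rw [Finset.sum_apply, Finset.sum_apply, Finset.sum_eq_single i]
  · rw [Finset.sum_apply, Finset.sum_apply, Finset.sum_eq_single k]
    · simp [eps]
    · intro l _ hl
      simp [eps, hl.symm]
    · simp
  · intro j _ hj
    rw [Finset.sum_apply, Finset.sum_apply]
    refine Finset.sum_eq_zero fun l _ => ?_
    simp [eps, Pi.single_eq_of_ne hj.symm]
  · simp

/-- Multiplying out the Leibniz expansions at all vertices gives a sum over tuples of permutations,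
which is the antisymmetrizer. -/
theorem antisymmetrize_mono_eq_prod_det (κ : Weight ν) : antisymmetrize (mono κ) =
    ∏ i, (Matrix.of fun k l : Fin (ν i) => (mono (κ i l • eps i k) : TorusRing ν)).det := by
  simp only [Matrix.det_apply', Matrix.of_apply]
  rw [Finset.prod_univ_sum, Fintype.piFinset_univ, antisymmetrize_eq]
  refine Finset.sum_congr rfl fun w _ => ?_
  rw [Finset.prod_mul_distrib, zsmul_eq_mul, vertexSign, Int.cast_prod, permute_mono]
  congr 1
  simp only [prod_mono]
  congr 1
  rw [← zsmul_eps_sum (permWeight w κ)]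
  refine Finset.sum_congr rfl fun i _ => ?_
  rw [← Equiv.sum_comp (w i)]
  simp [permWeight_apply]

/-- The quotient is supplied by `det_pow_eq_mul`, with the `h_m` read off from the inverse of `∏ (1
- x_l X)`. -/
theorem det_mono_rho_dvd (i : Q0) (κ : Fin (ν i) → ℤ) :
    (Matrix.of fun k l : Fin (ν i) => (mono (rho ν i l • eps i k) : TorusRing ν)).det ∣
      (Matrix.of fun k l : Fin (ν i) => (mono (κ l • eps i k) : TorusRing ν)).det := by
  classical
  -- A common shift that makes all exponents nonnegative; it costs only a unit `x_k^{-M}` in each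
  -- row.
  let M : ℕ := ∑ l, (κ l).natAbs
  have hM : ∀ l, 0 ≤ κ l + M := by
    intro l
    have : (κ l).natAbs ≤ M :=
      Finset.single_le_sum (f := fun l => (κ l).natAbs) (fun _ _ => Nat.zero_le _) (Finset.mem_univ l)
    omega
  let x : Fin (ν i) → TorusRing ν := fun k => mono (eps i k)
  have h1 : (Matrix.of fun k l : Fin (ν i) => (mono (κ l • eps i k) : TorusRing ν)) =
      Matrix.of fun k l : Fin (ν i) => mono (-(M : ℤ) • eps i k) *
        (Matrix.of fun k l => x k ^ (κ l + M).toNat) k l := by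
    ext1 k l
    simp only [Matrix.of_apply, x]
    rw [mono_pow, mono_mul]
    congr 1
    rw [← natCast_zsmul, Int.toNat_of_nonneg (hM l), ← add_smul]
    congr 1
    ring
  have h2 : (Matrix.of fun k l : Fin (ν i) => (mono (rho ν i l • eps i k) : TorusRing ν)) =
      Matrix.of fun k l : Fin (ν i) => x k ^ (ν i - 1 - (l : ℕ)) := by
    ext1 k l
    simp only [Matrix.of_apply, x]
    rw [mono_pow, ← natCast_zsmul, rho]
    congr 2
    have := l.2
    omega
  rw [h1, Matrix.det_mul_column, h2]
  refine Dvd.dvd.mul_left ?_ _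
  let P : PowerSeries (TorusRing ν) := ∏ l, (1 - PowerSeries.C (x l) * PowerSeries.X)
  let H : PowerSeries (TorusRing ν) := PowerSeries.invOfUnit P 1
  let h : ℤ → TorusRing ν := fun m => if 0 ≤ m then PowerSeries.coeff m.toNat H else 0
  have hH : (PowerSeries.mk fun m : ℕ => h m) = H := by
    ext m
    simp [h]
  rw [det_pow_eq_mul x h (fun m hm => if_neg (not_le.mpr hm))
    (by rw [hH, mul_comm]; exact PowerSeries.mul_invOfUnit P 1 (by simp [P]))
    (fun l => (κ l + M).toNat)]
  exact dvd_mul_right _ _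

theorem antisymmetrize_dvd (f : TorusRing ν) :
    antisymmetrize (mono (rho ν)) ∣ antisymmetrize f := by
  induction f using torus_induction with
  | hm γ =>
    rw [antisymmetrize_mono_eq_prod_det, antisymmetrize_mono_eq_prod_det]
    exact Finset.prod_dvd_prod_of_dvd _ _ fun i _ => det_mono_rho_dvd i _
  | ha f g hf hg => rw [antisymmetrize_add]; exact dvd_add hf hg
  | hn f hf => rw [← antisymmetrizeHom_apply (-f), map_neg]; exact (dvd_neg).mpr hf
  | h0 => rw [← antisymmetrizeHom_apply 0, map_zero]; exact dvd_zero _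

theorem mul_exactQuot {A : Type*} [CommRing A] {a b : A} (h : b ∣ a) : b * exactQuot a b = a := by
  obtain ⟨c, hc⟩ := h
  have h' : ∃ c, b * c = a := ⟨c, hc.symm⟩
  rw [exactQuot, dif_pos h']
  exact h'.choose_spec

theorem antisymmetrize_mul_schurPoly (γ : Weight ν) :
    antisymmetrize (mono (rho ν)) * schurPoly γ = antisymmetrize (mono (γ + rho ν)) :=
  mul_exactQuot (antisymmetrize_dvd _)

/-- Numerator and denominator change by the same sign, and the nonzero denominator cancels. -/
theorem permute_schurPoly (w : VertexPerm ν) (γ : Weight ν) :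
    permute w (schurPoly γ) = schurPoly γ := by
  have h := congrArg (permute w) (antisymmetrize_mul_schurPoly γ)
  rw [map_mul, permute_antisymmetrize, permute_antisymmetrize,
    ← antisymmetrize_mul_schurPoly, ← smul_mul_assoc] at h
  refine mul_left_cancel₀ ?_ h
  intro h0
  have h1 := congrArg (fun f => vertexSign w • f) h0
  simp only [smul_smul, vertexSign_mul_self, one_smul, smul_zero] at h1
  exact antisymmetrize_mono_rho_ne_zero h1

/-- The Weyl denominator formula: the entry of `ρ` at `k` counts the indices `l > k`, so `z^ρ` gives
one factor `z_k` to every pair `k < l` and turns `1 - z_l / z_k` into `z_k - z_l`. -/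
theorem mono_rho_mul_prod : mono (rho ν) * ∏ i, ∏ p : Fin (ν i) × Fin (ν i) with p.1 < p.2,
    (1 - mono (eps i p.2 - eps i p.1)) = (antisymmetrize (mono (rho ν)) : TorusRing ν) := by
  classical
  rw [antisymmetrize_mono_eq_prod_det]
  conv_lhs => rw [← zsmul_eps_sum (rho ν), ← prod_mono, ← Finset.prod_mul_distrib]
  refine Finset.prod_congr rfl fun i _ => ?_
  have h2 : (Matrix.of fun k l : Fin (ν i) => (mono (rho ν i l • eps i k) : TorusRing ν)) =
      Matrix.projVandermonde (fun _ => 1) fun k => mono (eps i k) := by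
    ext1 k l
    rw [Matrix.projVandermonde_apply, one_pow, one_mul, Matrix.of_apply, mono_pow, ← natCast_zsmul,
      rho, Fin.val_rev]
    congr 2
    have := l.2
    omega
  rw [h2, Matrix.det_projVandermonde, ← prod_mono]
  have h3 : ∏ p : Fin (ν i) × Fin (ν i) with p.1 < p.2,
      (1 - mono (eps i p.2 - eps i p.1) : TorusRing ν) =
      ∏ k, ∏ l ∈ Finset.Ioi k, (1 - mono (eps i l - eps i k)) := by
    rw [Finset.prod_sigma']
    refine Finset.prod_bij' (fun p _ => ⟨p.1, p.2⟩) (fun p _ => (p.1, p.2)) ?_ ?_ ?_ ?_ ?_ <;> simp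
  rw [h3, ← Finset.prod_mul_distrib]
  refine Finset.prod_congr rfl fun k _ => ?_
  have h4 : (mono (rho ν i k • eps i k) : TorusRing ν) = ∏ l ∈ Finset.Ioi k, mono (eps i k) := by
    rw [Finset.prod_const, mono_pow, ← natCast_zsmul, Fin.card_Ioi, rho]
    congr 2
    have := k.2
    omega
  rw [h4, ← Finset.prod_mul_distrib]
  refine Finset.prod_congr rfl fun l _ => ?_
  rw [mul_sub, mul_one, mono_mul, one_mul, one_mul, add_sub_cancel]

/-- The expansion of an antisymmetric Laurent polynomial into alternants. -/
theorem antisymmetrize_eq_finsum (f : TorusRing ν) :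
    {lam : DominantWeight ν | (antisymmetrize f).coeff (lam.1 + rho ν) ≠ 0}.Finite ∧
    antisymmetrize f = ∑ᶠ lam : DominantWeight ν,
      (antisymmetrize f).coeff (lam.1 + rho ν) • antisymmetrize (mono (lam.1 + rho ν)) := by
  classical
  set g := antisymmetrize f with hg
  have hfin : {lam : DominantWeight ν | g.coeff (lam.1 + rho ν) ≠ 0}.Finite := by
    refine (Set.Finite.preimage (f := fun lam : DominantWeight ν => lam.1 + rho ν)
      (fun a _ b _ h => Subtype.ext (add_right_cancel h)) g.coeff.support.finite_toSet).subset ?_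
    intro lam hlam
    exact Finsupp.mem_support_iff.mpr hlam
  refine ⟨hfin, ?_⟩
  have hperm : ∀ (w : VertexPerm ν) (δ : Weight ν),
      g.coeff (permWeight w δ) = vertexSign w * g.coeff δ := by
    intro w δ
    have h1 := permute_antisymmetrize w f
    have h2 : (permute w g).coeff (permWeight w δ) = g.coeff δ :=
      Finsupp.mapDomain_apply (permWeight_injective w) _ _
    rw [← hg] at h1
    rw [h1, coeff_zsmul_torus] at h2
    rw [← h2, ← mul_assoc, vertexSign_mul_self, one_mul]
  have hsub : Function.support (fun lam : DominantWeight ν =>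
      g.coeff (lam.1 + rho ν) • antisymmetrize (mono (lam.1 + rho ν))) ⊆ ↑hfin.toFinset := by
    intro lam h
    simp only [Set.Finite.coe_toFinset, Set.mem_ofPred_eq]
    intro h0
    exact h (by simp only [h0, zero_smul])
  rw [finsum_eq_sum_of_support_subset _ hsub]
  ext δ
  rw [coeff_sum_torus]
  simp only [coeff_zsmul_torus, coeff_antisymmetrize_mono]
  -- If an odd permutation fixes `δ`, both coefficients at `δ` vanish; otherwise antisymmetry
  -- reduces to a weight `mu + ρ`, which only the alternant of `mu` contains.
  rcases weight_cases δ with ⟨w, hw, hδ⟩ | ⟨w, mu, rfl⟩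
  · have h1 := hperm w δ
    rw [hδ, hw] at h1
    rw [Finset.sum_eq_zero fun lam _ => by rw [altCoeff_eq_zero hw hδ, mul_zero]]
    omega
  · rw [hperm]
    simp only [altCoeff_permWeight, altCoeff_add_rho, mul_left_comm _ (vertexSign w)]
    rw [← Finset.mul_sum]
    congr 1
    simp only [mul_ite, mul_one, mul_zero, Finset.sum_ite_eq]
    split_ifs with h
    · rfl
    · by_contra h1
      exact h (by simpa using h1)

end Torus

/-! ### The basis of tensor Schur functions -/

section TensorBasis

variable {Q0 Q1 : Type*}

instance : CharZero (ArrowRing Q1) :=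
  ⟨fun m n h => by
    have h1 := congrArg (fun f : ArrowRing Q1 => f.coeff 0) h
    simpa [AddMonoidAlgebra.natCast_def] using h1⟩

theorem hall_comm (F G : QSym Q0 Q1) : hall F G = hall G F := by
  rw [hall, hall]
  simp only [mul_comm]

variable [Fintype Q0]

/-- The basis of tensor Schur functions. -/
def tensorBasis (Q0 Q1 : Type*) [Fintype Q0] :
    Module.Basis (Q0 → YoungDiagram) (ArrowRing Q1) (QSym Q0 Q1) :=
  Basis.piTensorProduct fun _ => schurBasis (ArrowRing Q1)

theorem tensorBasis_apply (lam : Q0 → YoungDiagram) :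
    tensorBasis Q0 Q1 lam = tensorSchur Q1 lam := by
  rw [tensorBasis, Basis.piTensorProduct_apply, tensorSchur]
  simp only [schurBasis_apply]

theorem isTensorSchurExpansion_iff (F : QSym Q0 Q1) (c : (Q0 → YoungDiagram) →₀ ArrowRing Q1) :
    IsTensorSchurExpansion F c ↔ c = (tensorBasis Q0 Q1).repr F := by
  have h : (c.sum fun lam r => r • tensorSchur Q1 lam) = (tensorBasis Q0 Q1).repr.symm c := by
    rw [Module.Basis.repr_symm_apply, Finsupp.linearCombination_apply]
    simp only [tensorBasis_apply]
  rw [IsTensorSchurExpansion, h, eq_comm, LinearEquiv.symm_apply_eq]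

theorem tensorSchurCoeff_eq (F : QSym Q0 Q1) (lam : Q0 → YoungDiagram) :
    tensorSchurCoeff F lam = (tensorBasis Q0 Q1).repr F lam := by
  have h : ∃ c, IsTensorSchurExpansion F c := ⟨_, (isTensorSchurExpansion_iff F _).mpr rfl⟩
  rw [tensorSchurCoeff, dif_pos h, (isTensorSchurExpansion_iff F _).mp h.choose_spec]

theorem hall_eq (F G : QSym Q0 Q1) : hall F G =
    Finsupp.linearCombination (ArrowRing Q1) (fun lam => (tensorBasis Q0 Q1).repr G lam)
      ((tensorBasis Q0 Q1).repr F) := by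
  rw [hall, Finsupp.linearCombination_apply, Finsupp.sum]
  simp only [tensorSchurCoeff_eq, smul_eq_mul]
  refine finsum_eq_sum_of_support_subset _ fun lam h => ?_
  refine Finsupp.mem_support_iff.mpr fun h0 => h ?_
  simp only [h0, zero_mul]

theorem hall_tensorSchur_right (F : QSym Q0 Q1) (lam : Q0 → YoungDiagram) :
    hall F (tensorSchur Q1 lam) = (tensorBasis Q0 Q1).repr F lam := by
  classical
  rw [hall_comm, hall_eq, ← tensorBasis_apply, Module.Basis.repr_self,
    Finsupp.linearCombination_single, one_smul]

theorem eq_of_hall_eq {F G : QSym Q0 Q1} (h : ∀ K, hall F K = hall G K) : F = G := by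
  refine (tensorBasis Q0 Q1).repr.injective (Finsupp.ext fun lam => ?_)
  rw [← hall_tensorSchur_right, h, hall_tensorSchur_right]

/-- An adjoint characterizes `perp`. -/
theorem perp_eq {F G G' : QSym Q0 Q1} (h : ∀ K, hall G' K = hall G (F * K)) : perp F G = G' := by
  have h' : ∃ G' : QSym Q0 Q1, ∀ K : QSym Q0 Q1, hall G' K = hall G (F * K) := ⟨G', h⟩
  rw [perp, dif_pos h']
  exact eq_of_hall_eq fun K => (h'.choose_spec K).trans (h K).symm

/-- The linear form which pairs with `G` from the left. -/
theorem hall_eq_of_linear {G : QSym Q0 Q1} (φ : QSym Q0 Q1 →ₗ[ArrowRing Q1] ArrowRing Q1)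
    (h : ∀ lam, (tensorBasis Q0 Q1).repr G lam = φ (tensorSchur Q1 lam)) (K : QSym Q0 Q1) :
    hall G K = φ K := by
  rw [hall_comm, hall_eq]
  conv_rhs => rw [← (tensorBasis Q0 Q1).linearCombination_repr K]
  rw [Finsupp.linearCombination_apply, Finsupp.linearCombination_apply, map_finsuppSum]
  simp only [h, map_smul, tensorBasis_apply]

end TensorBasis

/-! ### Evaluation in finitely many variables at each vertex -/

section Evaluation

variable {Q0 Q1 : Type*} [Fintype Q0]

/-- The variables `x_k^{(j)}` with `1 ≤ k ≤ n^{(j)}`. -/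
abbrev Vars {Q0 : Type*} (n : Q0 → ℕ) : Type _ := (j : Q0) × Fin (n j)

/-- The inclusion of the variables at a vertex. -/
def varEmb {Q0 : Type*} (n : Q0 → ℕ) (j : Q0) : Fin (n j) ↪ Vars n :=
  ⟨fun k => ⟨j, k⟩, fun _ _ h => eq_of_heq (Sigma.mk.inj h).2⟩

/-- The evaluation of a symmetric function in the variables at a vertex. -/
def vertexEval (Q1 : Type*) (n : Q0 → ℕ) (j : Q0) :
    Sym (ArrowRing Q1) →ₐ[ArrowRing Q1] MvPowerSeries (Vars n) (ArrowRing Q1) :=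
  (MvPowerSeries.rename (varEmb n j)).comp (restrictHom (ArrowRing Q1) (n j))

/-- The product of the evaluations at each vertex as a multilinear map. -/
def evalMultilinear (Q1 : Type*) (n : Q0 → ℕ) :
    MultilinearMap (ArrowRing Q1) (fun _ : Q0 => Sym (ArrowRing Q1))
      (MvPowerSeries (Vars n) (ArrowRing Q1)) :=
  (MultilinearMap.mkPiAlgebra (ArrowRing Q1) Q0 (MvPowerSeries (Vars n) (ArrowRing Q1))).compLinearMap
    fun j => (vertexEval Q1 n j).toLinearMap

theorem evalMultilinear_apply (n : Q0 → ℕ) (f : Q0 → Sym (ArrowRing Q1)) :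
    evalMultilinear Q1 n f = ∏ j, vertexEval Q1 n j (f j) := by
  simp [evalMultilinear]

/-- The evaluation of a quiver symmetric function in finitely many variables at each vertex. -/
def eval (Q1 : Type*) (n : Q0 → ℕ) :
    QSym Q0 Q1 →ₐ[ArrowRing Q1] MvPowerSeries (Vars n) (ArrowRing Q1) :=
  PiTensorProduct.liftAlgHom (evalMultilinear Q1 n)
    (by rw [evalMultilinear_apply]; simp)
    (fun x y => by simp only [evalMultilinear_apply, Pi.mul_apply, map_mul, Finset.prod_mul_distrib])

theorem eval_tprod (n : Q0 → ℕ) (f : Q0 → Sym (ArrowRing Q1)) :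
    eval Q1 n (⨂ₜ[ArrowRing Q1] j, f j) = ∏ j, vertexEval Q1 n j (f j) := by
  rw [← evalMultilinear_apply]
  exact PiTensorProduct.lift.tprod _

variable [DecidableEq Q0]

theorem eval_atVertex (n : Q0 → ℕ) (j : Q0) (f : Sym (ArrowRing Q1)) :
    eval Q1 n (atVertex j f) = vertexEval Q1 n j f := by
  rw [atVertex, PiTensorProduct.singleAlgHom_apply, eval_tprod, Finset.prod_eq_single j]
  · simp
  · intro i _ hi
    rw [MonoidHom.mulSingle_apply, Pi.mulSingle_eq_of_ne hi, map_one]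
  · simp

theorem tprod_eq_prod_atVertex (f : Q0 → Sym (ArrowRing Q1)) :
    (⨂ₜ[ArrowRing Q1] j, f j : QSym Q0 Q1) = ∏ j, atVertex j (f j) := by
  conv_lhs => rw [← Finset.univ_prod_mulSingle f]
  rw [PiTensorProduct.tprod_prod]
  rfl

end Evaluation

/-! ### Scalar multiplication on quiver symmetric functions -/

section Scalars

variable {Q0 Q1 : Type*}

theorem qsym_smul_def (r : ArrowRing Q1) (F : QSym Q0 Q1) :
    r • F = algebraMap (ArrowRing Q1) (QSym Q0 Q1) r * F := Algebra.smul_def r F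

theorem qsym_smul_mul (r : ArrowRing Q1) (F G : QSym Q0 Q1) : r • F * G = r • (F * G) :=
  Algebra.smul_mul_assoc r F G

theorem qsym_mul_smul (r : ArrowRing Q1) (F G : QSym Q0 Q1) : F * r • G = r • (F * G) :=
  Algebra.mul_smul_comm r F G

theorem qsym_prod_smul {κ : Type*} (s : Finset κ) (r : κ → ArrowRing Q1) (F : κ → QSym Q0 Q1) :
    ∏ k ∈ s, r k • F k = (∏ k ∈ s, r k) • ∏ k ∈ s, F k := by
  simp only [qsym_smul_def, map_prod, Finset.prod_mul_distrib]

/-- Scalar multiplication as a homomorphism in the scalar. -/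
def qsymSmulHom (F : QSym Q0 Q1) : ArrowRing Q1 →+ QSym Q0 Q1 :=
  (AddMonoidHom.mulRight F).comp (algebraMap (ArrowRing Q1) (QSym Q0 Q1)).toAddMonoidHom

theorem qsymSmulHom_apply (r : ArrowRing Q1) (F : QSym Q0 Q1) : qsymSmulHom F r = r • F :=
  (qsym_smul_def r F).symm

theorem qsym_zsmul_eq (n : ℤ) (F : QSym Q0 Q1) : n • F = (n : ArrowRing Q1) • F := by
  have h : qsymSmulHom F (n • 1) = n • qsymSmulHom F 1 := map_zsmul (qsymSmulHom F) n 1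
  rw [qsymSmulHom_apply, qsymSmulHom_apply, one_smul, zsmul_one] at h
  exact h.symm

end Scalars

/-! ### Coefficients at weights -/

section WeightCoeff

variable {Q0 R : Type*} [CommRing R] {n : Q0 → ℕ}

/-- The exponent of a monomial as a weight. -/
def expWeight (m : Vars n →₀ ℕ) : Weight n := fun j k => m ⟨j, k⟩

theorem expWeight_add (m m' : Vars n →₀ ℕ) : expWeight (m + m') = expWeight m + expWeight m' := by
  funext j k
  simp [expWeight]

theorem expWeight_injective : Function.Injective (expWeight (n := n)) := fun m m' h => by
  ext ⟨j, k⟩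
  have := congrFun (congrFun h j) k
  simpa [expWeight] using this

theorem expWeight_nonneg (m : Vars n →₀ ℕ) (j : Q0) (k : Fin (n j)) : 0 ≤ expWeight m j k :=
  Int.natCast_nonneg _

/-- The coefficient of the monomial `x^δ`, which is zero if `δ` has a negative entry. -/
def weightCoeff (δ : Weight n) : MvPowerSeries (Vars n) R →ₗ[R] R :=
  open Classical in if h : ∃ m : Vars n →₀ ℕ, expWeight m = δ then MvPowerSeries.coeff h.choose
    else 0

theorem weightCoeff_expWeight (m : Vars n →₀ ℕ) (F : MvPowerSeries (Vars n) R) :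
    weightCoeff (expWeight m) F = MvPowerSeries.coeff m F := by
  have h : ∃ m' : Vars n →₀ ℕ, expWeight m' = expWeight m := ⟨m, rfl⟩
  rw [weightCoeff, dif_pos h, expWeight_injective h.choose_spec]

theorem weightCoeff_of_not_exists {δ : Weight n} (h : ¬ ∃ m : Vars n →₀ ℕ, expWeight m = δ)
    (F : MvPowerSeries (Vars n) R) : weightCoeff δ F = 0 := by
  rw [weightCoeff, dif_neg h, LinearMap.zero_apply]

theorem weightCoeff_monomial [DecidableEq (Weight n)] (δ : Weight n) (m : Vars n →₀ ℕ) (r : R) :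
    weightCoeff δ (MvPowerSeries.monomial m r) = if expWeight m = δ then r else 0 := by
  classical
  by_cases h : ∃ m' : Vars n →₀ ℕ, expWeight m' = δ
  · obtain ⟨m', rfl⟩ := h
    rw [weightCoeff_expWeight, MvPowerSeries.coeff_monomial]
    exact if_congr ⟨fun h => by rw [h], fun h => expWeight_injective h.symm⟩ rfl rfl
  · rw [weightCoeff_of_not_exists h, if_neg fun h' => h ⟨m, h'⟩]

/-- Any finite `s` that contains the exponents below `δ` will do: for the others `δ - expWeight m`
has a negative entry, where `weightCoeff` is zero by convention. -/
theorem weightCoeff_mul (δ : Weight n) (F G : MvPowerSeries (Vars n) R) (s : Finset (Vars n →₀ ℕ))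
    (hs : ∀ m : Vars n →₀ ℕ, (∀ j k, 0 ≤ (δ - expWeight m) j k) → m ∈ s) :
    weightCoeff δ (F * G) =
      ∑ m ∈ s, MvPowerSeries.coeff m G * weightCoeff (δ - expWeight m) F := by
  classical
  by_cases h : ∃ m' : Vars n →₀ ℕ, expWeight m' = δ
  · obtain ⟨m', rfl⟩ := h
    rw [weightCoeff_expWeight, MvPowerSeries.coeff_mul]
    have h1 : ∀ p ∈ Finset.HasAntidiagonal.antidiagonal m',
        MvPowerSeries.coeff p.1 F * MvPowerSeries.coeff p.2 G =
        MvPowerSeries.coeff p.2 G * weightCoeff (expWeight m' - expWeight p.2) F := by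
      intro p hp
      rw [← Finset.HasAntidiagonal.mem_antidiagonal.mp hp, expWeight_add, add_sub_cancel_right,
        weightCoeff_expWeight, mul_comm]
    rw [Finset.sum_congr rfl h1]
    refine Finset.sum_of_injOn Prod.snd ?_ ?_ ?_ fun _ _ => rfl
    · intro p hp q hq hpq
      have hp' := Finset.HasAntidiagonal.mem_antidiagonal.mp (Finset.mem_coe.mp hp)
      have hq' := Finset.HasAntidiagonal.mem_antidiagonal.mp (Finset.mem_coe.mp hq)
      rw [← hq', ← hpq] at hp'
      exact Prod.ext (add_right_cancel hp') hpq
    · intro p hp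
      refine hs _ fun j k => ?_
      rw [← Finset.HasAntidiagonal.mem_antidiagonal.mp (Finset.mem_coe.mp hp), expWeight_add,
        add_sub_cancel_right]
      exact expWeight_nonneg _ _ _
    · intro m _ hm
      rw [weightCoeff_of_not_exists, mul_zero]
      rintro ⟨k, hk⟩
      refine hm ⟨(k, m), ?_, rfl⟩
      refine Finset.mem_coe.mpr (Finset.HasAntidiagonal.mem_antidiagonal.mpr
        (expWeight_injective ?_))
      rw [expWeight_add, hk, sub_add_cancel]
  · rw [weightCoeff_of_not_exists h, Finset.sum_eq_zero]
    intro m _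
    rw [weightCoeff_of_not_exists, mul_zero]
    rintro ⟨k, hk⟩
    exact h ⟨k + m, by rw [expWeight_add, hk, sub_add_cancel]⟩

end WeightCoeff

/-! ### Alternants in the variables at all vertices -/

section VertexAlternant

variable {Q0 : Type*} {n : Q0 → ℕ}

/-- The rows of a tuple of partitions, shifted by the staircase. -/
theorem partitionWeight_add_rho (lam : Q0 → YoungDiagram) (j : Q0) (k : Fin (n j)) :
    ((partitionWeight n lam).1 + rho n) j k =
      (((lam j).rowLen k + (n j - 1 - (k : ℕ)) : ℕ) : ℤ) := by
  have := k.2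
  show ((lam j).rowLen k : ℤ) + ((n j : ℤ) - 1 - (k : ℕ)) = _
  omega

theorem rename_monomial_varEmb (R : Type*) [CommRing R] (j : Q0) (m : Fin (n j) →₀ ℕ) (r : R) :
    MvPowerSeries.rename (varEmb n j) (MvPowerSeries.monomial m r) =
      MvPowerSeries.monomial (Finsupp.mapDomain (varEmb n j) m) r :=
  MvPowerSeries.rename_monomial _ _ _

theorem exists_partitionWeight_eq {lam : DominantWeight n} (h : ∀ j k, 0 ≤ lam.1 j k) :
    ∃ mu : Q0 → YoungDiagram, (∀ j, (mu j).colLen 0 ≤ n j) ∧ partitionWeight n mu = lam := by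
  have hanti : ∀ j, Antitone fun k => (lam.1 j k).toNat := fun j a b hab =>
    Int.toNat_le_toNat (lam.2 j hab)
  refine ⟨fun j => ofRows _ (hanti j), fun j => colLen_ofRows_le, Subtype.ext ?_⟩
  funext j k
  show ((ofRows _ (hanti j)).rowLen k : ℤ) = lam.1 j k
  rw [rowLen_ofRows, Int.toNat_of_nonneg (h j k)]

theorem partitionWeight_injective {lam mu : Q0 → YoungDiagram} (h1 : ∀ j, (lam j).colLen 0 ≤ n j)
    (h2 : ∀ j, (mu j).colLen 0 ≤ n j) (h : partitionWeight n lam = partitionWeight n mu) :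
    lam = mu := by
  funext j
  refine ext_of_rowLen (h1 j) (h2 j) fun k => ?_
  have := congrFun (congrFun (congrArg Subtype.val h) j) k
  exact Int.ofNat_inj.mp this

/-- The last entry of a dominant weight is its smallest and `ρ` vanishes there, so adding `ρ` cannot
hide a negative entry. -/
theorem exists_add_rho_neg {lam : DominantWeight n} (h : ¬ ∀ j k, 0 ≤ lam.1 j k) :
    ∃ j k, (lam.1 + rho n) j k < 0 := by
  push Not at h
  obtain ⟨j, k, hk⟩ := h
  have hpos := k.pos
  refine ⟨j, ⟨n j - 1, by omega⟩, ?_⟩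
  have h1 : lam.1 j ⟨n j - 1, by omega⟩ ≤ lam.1 j k := lam.2 j (Nat.le_sub_one_of_lt k.2)
  show lam.1 j ⟨n j - 1, by omega⟩ + ((n j : ℤ) - 1 - ((n j - 1 : ℕ) : ℤ)) < 0
  omega

variable [Fintype Q0]

theorem sum_mapDomain_varEmb (m : (j : Q0) → Fin (n j) →₀ ℕ) :
    expWeight (∑ j, Finsupp.mapDomain (varEmb n j) (m j)) = fun j k => (m j k : ℤ) := by
  classical
  funext j k
  rw [expWeight, Finsupp.finsetSum_apply, Finset.sum_eq_single j]
  · congr 1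
    exact Finsupp.mapDomain_apply (varEmb n j).injective _ _
  · intro i _ hi
    refine Finsupp.mapDomain_of_notMem_range _ _ ?_
    rintro ⟨l, hl⟩
    exact hi (congrArg Sigma.fst hl)
  · simp

variable [DecidableEq Q0]

theorem weightCoeff_prod_alternant (R : Type*) [CommRing R] (δ : Weight n)
    (κ : (j : Q0) → Fin (n j) → ℕ) :
    weightCoeff δ (∏ j, MvPowerSeries.rename (varEmb n j) (alternant R (κ j))) =
      ((altCoeff δ fun j k => (κ j k : ℤ) : ℤ) : R) := by
  simp only [alternant_eq_sum, map_sum, map_zsmul, rename_monomial_varEmb]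
  rw [Finset.prod_univ_sum, Fintype.piFinset_univ, map_sum, altCoeff, Int.cast_sum]
  refine Finset.sum_congr rfl fun w _ => ?_
  have h : (∏ j, (Equiv.Perm.sign (w j) : ℤ) • MvPowerSeries.monomial (Finsupp.mapDomain (varEmb n j)
      (Finsupp.equivFunOnFinite.symm fun k => κ j ((w j).symm k))) (1 : R)) =
      vertexSign w • MvPowerSeries.monomial (∑ j, Finsupp.mapDomain (varEmb n j)
        (Finsupp.equivFunOnFinite.symm fun k => κ j ((w j).symm k))) (1 : R) := by
    simp only [zsmul_eq_mul]
    rw [Finset.prod_mul_distrib, MvPowerSeries.prod_monomial, Finset.prod_const_one, vertexSign,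
      Int.cast_prod]
  rw [h, map_zsmul, weightCoeff_monomial, sum_mapDomain_varEmb]
  have h2 : (fun j k => ((Finsupp.equivFunOnFinite.symm fun k => κ j ((w j).symm k)) k : ℤ)) =
      permWeight w fun j k => (κ j k : ℤ) := rfl
  rw [h2]
  split_ifs <;> simp

end VertexAlternant

/-! ### The Jacobi–Trudi elements -/

section VertexJacobiTrudi

variable {Q0 Q1 : Type*} [Fintype Q0] [DecidableEq Q0] {n : Q0 → ℕ}

/-- The product of the complete symmetric functions `h_{δ_k^{(j)}}[X^{(j)}]`. -/
def completeProd (Q1 : Type*) (δ : Weight n) : QSym Q0 Q1 :=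
  ∏ j, atVertex j (∏ k, completeInt (ArrowRing Q1) (δ j k))

theorem completeProd_eq_zero {δ : Weight n} {j : Q0} {k : Fin (n j)} (h : δ j k < 0) :
    completeProd Q1 δ = 0 := by
  refine Finset.prod_eq_zero (Finset.mem_univ j) ?_
  rw [Finset.prod_eq_zero (Finset.mem_univ k) (completeInt_of_neg h), atVertex, map_zero]

theorem completeProd_permWeight (w : VertexPerm n) (δ : Weight n) :
    completeProd Q1 (permWeight w δ) = completeProd Q1 δ := by
  refine Finset.prod_congr rfl fun j _ => ?_
  congr 1
  exact Equiv.prod_comp (w j).symm fun k => completeInt (ArrowRing Q1) (δ j k)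

/-- The tensor product of the Jacobi–Trudi determinants `det (h_{δ_k - ρ_l})` over all vertices. -/
def vertexJacobiTrudi (Q1 : Type*) (δ : Weight n) : QSym Q0 Q1 :=
  ∑ w : VertexPerm n, (vertexSign w : ArrowRing Q1) • completeProd Q1 (δ - permWeight w (rho n))

theorem vertexJacobiTrudi_permWeight (w : VertexPerm n) (δ : Weight n) :
    vertexJacobiTrudi Q1 (permWeight w δ) = (vertexSign w : ArrowRing Q1) • vertexJacobiTrudi Q1 δ := by
  rw [vertexJacobiTrudi, vertexJacobiTrudi, Finset.smul_sum, ← Equiv.sum_comp (Equiv.mulLeft w)]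
  refine Finset.sum_congr rfl fun w' _ => ?_
  rw [Equiv.coe_mulLeft, permWeight_mul, ← map_sub, completeProd_permWeight, vertexSign_mul,
    smul_smul, Int.cast_mul]

theorem vertexJacobiTrudi_eq_zero {δ : Weight n} {j : Q0} {k : Fin (n j)} (h : δ j k < 0) :
    vertexJacobiTrudi Q1 δ = 0 := by
  refine Finset.sum_eq_zero fun w _ => ?_
  rw [completeProd_eq_zero (j := j) (k := k), smul_zero]
  have h1 : 0 ≤ permWeight w (rho n) j k := by
    rw [permWeight_apply, rho]
    have := ((w j).symm k).2
    omega
  show δ j k - permWeight w (rho n) j k < 0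
  omega

/-- The element equals its own negative; in coordinates over a ring of characteristic zero it must
vanish. -/
theorem vertexJacobiTrudi_eq_zero_of_odd {w : VertexPerm n} {δ : Weight n} (hw : vertexSign w = -1)
    (hδ : permWeight w δ = δ) : vertexJacobiTrudi Q1 δ = 0 := by
  have h := vertexJacobiTrudi_permWeight (Q1 := Q1) w δ
  rw [hδ, hw] at h
  refine (tensorBasis Q0 Q1).repr.injective (Finsupp.ext fun lam => ?_)
  have h1 := DFunLike.congr_fun (congrArg (tensorBasis Q0 Q1).repr h) lam
  rw [map_smul, Finsupp.smul_apply, Int.cast_neg, Int.cast_one, smul_eq_mul, neg_one_mul,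
    self_eq_neg] at h1
  rw [h1, map_zero, Finsupp.zero_apply]

theorem vertexJacobiTrudi_partitionWeight (lam : Q0 → YoungDiagram)
    (hlam : ∀ j, (lam j).colLen 0 ≤ n j) :
    vertexJacobiTrudi Q1 ((partitionWeight n lam).1 + rho n) = tensorSchur Q1 lam := by
  rw [tensorSchur, tprod_eq_prod_atVertex]
  have h : ∀ j, schur (ArrowRing Q1) (lam j) = ∑ σ : Equiv.Perm (Fin (n j)),
      ((Equiv.Perm.sign σ : ℤ) : ArrowRing Q1) • ∏ k, completeInt (ArrowRing Q1)
        (((partitionWeight n lam).1 + rho n) j k - rho n j (σ k)) := by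
    intro j
    rw [schur_eq (lam j) (hlam j), rowsJacobiTrudi, jacobiTrudi_eq_sum]
    refine Finset.sum_congr rfl fun σ _ => ?_
    rw [Int.cast_smul_eq_zsmul]
    congr 1
    refine Finset.prod_congr rfl fun k _ => ?_
    rw [partitionWeight_add_rho]
    congr 2
    rw [rho]
    have := (σ k).2
    omega
  simp only [h, atVertex, map_sum, map_smul]
  rw [Finset.prod_univ_sum, Fintype.piFinset_univ, vertexJacobiTrudi,
    ← Equiv.sum_comp (Equiv.inv (VertexPerm n))]
  refine Finset.sum_congr rfl fun w _ => ?_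
  rw [qsym_prod_smul, Equiv.inv_apply, vertexSign_inv, vertexSign, Int.cast_prod]
  rfl

-- Straightening. Sorting the entries reduces to `δ = mu + ρ` with `mu` dominant. If `mu` is
-- nonnegative the element is a tensor Schur function. Otherwise the last shifted entry at some
-- vertex is negative and the element vanishes, as does the right side, whose weights come from
-- partitions only.
open Classical in
theorem repr_vertexJacobiTrudi (δ : Weight n) (lam : Q0 → YoungDiagram) :
    (tensorBasis Q0 Q1).repr (vertexJacobiTrudi Q1 δ) lam =
      if ∀ j, (lam j).colLen 0 ≤ n j then
        ((altCoeff δ ((partitionWeight n lam).1 + rho n) : ℤ) : ArrowRing Q1) else 0 := by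
  rcases weight_cases δ with ⟨w, hw, hδ⟩ | ⟨w, mu, rfl⟩
  · rw [vertexJacobiTrudi_eq_zero_of_odd hw hδ, altCoeff_eq_zero hw hδ]
    simp
  · rw [vertexJacobiTrudi_permWeight, altCoeff_permWeight, altCoeff_add_rho]
    by_cases hmu : ∀ j k, 0 ≤ mu.1 j k
    · obtain ⟨mu, hfit, rfl⟩ := exists_partitionWeight_eq hmu
      rw [vertexJacobiTrudi_partitionWeight mu hfit, ← tensorBasis_apply, map_smul,
        Module.Basis.repr_self, Finsupp.smul_apply, Finsupp.single_apply]
      by_cases h : mu = lam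
      · subst h
        simp [hfit]
      · rw [if_neg h, smul_zero]
        split_ifs with h1 h2
        · exact absurd (partitionWeight_injective hfit h1 h2) h
        · simp
        · rfl
    · obtain ⟨j, k, hk⟩ := exists_add_rho_neg hmu
      have h : mu ≠ partitionWeight n lam := by
        rintro rfl
        exact hmu fun j k => Int.natCast_nonneg _
      rw [vertexJacobiTrudi_eq_zero hk, if_neg h]
      simp

/-- The linear form `F ↦ [x^δ] a_ρ(x) F[x]`. -/
def alternantForm (Q1 : Type*) (δ : Weight n) : QSym Q0 Q1 →ₗ[ArrowRing Q1] ArrowRing Q1 :=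
  (weightCoeff δ).comp ((LinearMap.mulLeft (ArrowRing Q1) (∏ j, MvPowerSeries.rename (varEmb n j)
    (alternant (ArrowRing Q1) fun k : Fin (n j) => n j - 1 - (k : ℕ)))).comp
      (eval Q1 n).toLinearMap)

theorem alternantForm_apply (δ : Weight n) (F : QSym Q0 Q1) : alternantForm Q1 δ F =
    weightCoeff δ ((∏ j, MvPowerSeries.rename (varEmb n j)
      (alternant (ArrowRing Q1) fun k : Fin (n j) => n j - 1 - (k : ℕ))) * eval Q1 n F) := rfl

-- The Vandermonde times a Schur polynomial is an alternant, and a Schur function with more rows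
-- than variables evaluates to zero. The values agree with those of `repr_vertexJacobiTrudi`.
open Classical in
theorem alternantForm_tensorSchur (δ : Weight n) (lam : Q0 → YoungDiagram) :
    alternantForm Q1 δ (tensorSchur Q1 lam) =
      if ∀ j, (lam j).colLen 0 ≤ n j then
        ((altCoeff δ ((partitionWeight n lam).1 + rho n) : ℤ) : ArrowRing Q1) else 0 := by
  rw [alternantForm_apply, tensorSchur, eval_tprod, ← Finset.prod_mul_distrib]
  split_ifs with h
  · have h1 : ∀ j, MvPowerSeries.rename (varEmb n j)
        (alternant (ArrowRing Q1) fun k : Fin (n j) => n j - 1 - (k : ℕ)) *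
        vertexEval Q1 n j (schur (ArrowRing Q1) (lam j)) = MvPowerSeries.rename (varEmb n j)
        (alternant (ArrowRing Q1) fun k : Fin (n j) => (lam j).rowLen k + (n j - 1 - (k : ℕ))) := by
      intro j
      rw [vertexEval, AlgHom.comp_apply, ← map_mul, alternant_mul_schur (lam j) (h j)]
    rw [Finset.prod_congr rfl fun j _ => h1 j, weightCoeff_prod_alternant]
    congr 2
    funext j k
    exact (partitionWeight_add_rho lam j k).symm
  · push Not at h
    obtain ⟨j, hj⟩ := h
    rw [Finset.prod_eq_zero (Finset.mem_univ j), map_zero]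
    rw [vertexEval, AlgHom.comp_apply, restrictHom_schur_eq_zero _ hj, map_zero, mul_zero]

/-- This turns Hall adjoints into ordinary multiplication of series in finitely many variables. -/
theorem hall_vertexJacobiTrudi (δ : Weight n) (K : QSym Q0 Q1) :
    hall (vertexJacobiTrudi Q1 δ) K = alternantForm Q1 δ K :=
  hall_eq_of_linear _ (fun lam => by rw [repr_vertexJacobiTrudi, alternantForm_tensorSchur]) K

theorem hall_sum_smul_left {κ : Type*} (s : Finset κ) (r : κ → ArrowRing Q1) (F : κ → QSym Q0 Q1)
    (K : QSym Q0 Q1) : hall (∑ k ∈ s, r k • F k) K = ∑ k ∈ s, r k * hall (F k) K := by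
  simp only [hall_eq, map_sum, map_smul, smul_eq_mul]

/-- The adjoint of multiplication by `F`, on Jacobi–Trudi elements. -/
theorem perp_vertexJacobiTrudi (F : QSym Q0 Q1) (δ : Weight n) (s : Finset (Vars n →₀ ℕ))
    (hs : ∀ m : Vars n →₀ ℕ, (∀ j k, 0 ≤ (δ - expWeight m) j k) → m ∈ s) :
    perp F (vertexJacobiTrudi Q1 δ) = ∑ m ∈ s, MvPowerSeries.coeff m (eval Q1 n F) •
      vertexJacobiTrudi Q1 (δ - expWeight m) := by
  refine perp_eq fun K => ?_
  rw [hall_sum_smul_left]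
  simp only [hall_vertexJacobiTrudi, alternantForm_apply]
  -- Pairing with `F K` takes the coefficient of `x^δ` in `a_ρ(x) K[x] F[x]`; expanding along the
  -- monomials of `F[x]` gives the shifted weights `δ - m`.
  rw [map_mul (eval Q1 n), mul_comm (eval Q1 n F), ← mul_assoc, weightCoeff_mul δ _ _ s hs]

end VertexJacobiTrudi

/-! ### Concatenation of weights -/

section Append

variable {Q0 : Type*}

/-- The concatenation of weights in the variables `u` and `v`. -/
def appendWeight (α β : Q0 → ℕ) : Weight α × Weight β →+ Weight (fun j => α j + β j) where
  toFun := fun p j => Fin.append (p.1 j) (p.2 j)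
  map_zero' := by
    funext j k
    refine Fin.addCases (fun k => ?_) (fun k => ?_) k <;> simp
  map_add' := fun p q => by
    funext j k
    refine Fin.addCases (fun k => ?_) (fun k => ?_) k <;> simp

variable {α β : Q0 → ℕ}

@[simp] theorem appendWeight_castAdd (γ : Weight α) (δ : Weight β) (j : Q0) (k : Fin (α j)) :
    appendWeight α β (γ, δ) j (Fin.castAdd (β j) k) = γ j k :=
  Fin.append_left _ _ _

@[simp] theorem appendWeight_natAdd (γ : Weight α) (δ : Weight β) (j : Q0) (l : Fin (β j)) :
    appendWeight α β (γ, δ) j (Fin.natAdd (α j) l) = δ j l :=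
  Fin.append_right _ _ _

theorem inclU_mono (γ : Weight α) : inclU α β (mono γ) = mono (appendWeight α β (γ, 0)) :=
  AddMonoidAlgebra.mapDomain_single

theorem inclV_mono (δ : Weight β) : inclV α β (mono δ) = mono (appendWeight α β (0, δ)) :=
  AddMonoidAlgebra.mapDomain_single

theorem inclU_mul_inclV_mono (γ : Weight α) (δ : Weight β) :
    inclU α β (mono γ) * inclV α β (mono δ) = mono (appendWeight α β (γ, δ)) := by
  rw [inclU_mono, inclV_mono, mono_mul, ← map_add, Prod.mk_add_mk, add_zero, zero_add]

variable [DecidableEq Q0]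

theorem appendWeight_eps_left (j : Q0) (k : Fin (α j)) :
    appendWeight α β (eps j k, 0) = eps j (Fin.castAdd (β j) k) := by
  funext i m
  rcases eq_or_ne i j with rfl | h
  · refine Fin.addCases (fun m => ?_) (fun m => ?_) m
    · simp [eps, Pi.single_apply]
    · have h : Fin.natAdd (α i) m ≠ Fin.castAdd (β i) k := fun h => by
        have := congrArg Fin.val h
        simp at this
        omega
      simp [eps, h]
  · refine Fin.addCases (fun m => ?_) (fun m => ?_) m <;> simp [eps, Pi.single_eq_of_ne h]

theorem appendWeight_eps_right (j : Q0) (l : Fin (β j)) :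
    appendWeight α β (0, eps j l) = eps j (Fin.natAdd (α j) l) := by
  funext i m
  rcases eq_or_ne i j with rfl | h
  · refine Fin.addCases (fun m => ?_) (fun m => ?_) m
    · have h : Fin.castAdd (β i) m ≠ Fin.natAdd (α i) l := fun h => by
        have := congrArg Fin.val h
        simp at this
        omega
      simp [eps, h]
    · simp [eps, Pi.single_apply]
  · refine Fin.addCases (fun m => ?_) (fun m => ?_) m <;> simp [eps, Pi.single_eq_of_ne h]

end Append

/-! ### The Laurent polynomial `R` -/

section Raising

variable {Q0 : Type*} [Fintype Q0] [DecidableEq Q0]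

/-- The Laurent polynomial `∏_j ∏_{k < l} (1 - x_l^{(j)} / x_k^{(j)})`. -/
def vertexRaising (n : Q0 → ℕ) : TorusRing n :=
  ∏ i, ∏ p : Fin (n i) × Fin (n i) with p.1 < p.2, (1 - mono (eps i p.2 - eps i p.1))

theorem mono_rho_mul_vertexRaising (n : Q0 → ℕ) :
    mono (rho n) * vertexRaising n = antisymmetrize (mono (rho n)) :=
  mono_rho_mul_prod

/-- The factor `∏_j ∏_{k,l} (1 - v_l^{(j)} / u_k^{(j)})`. -/
def crossFactor (α β : Q0 → ℕ) : TorusRing fun j => α j + β j :=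
  ∏ j, ∏ k : Fin (α j), ∏ l : Fin (β j),
    (1 - mono (eps j (Fin.natAdd (α j) l) - eps j (Fin.castAdd (β j) k)))

theorem prod_lt_add {M : Type*} [CommMonoid M] {a b : ℕ} (f : Fin (a + b) → Fin (a + b) → M) :
    ∏ p : Fin (a + b) × Fin (a + b) with p.1 < p.2, f p.1 p.2 =
      (∏ p : Fin a × Fin a with p.1 < p.2, f (Fin.castAdd b p.1) (Fin.castAdd b p.2)) *
        (∏ p : Fin b × Fin b with p.1 < p.2, f (Fin.natAdd a p.1) (Fin.natAdd a p.2)) *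
        ∏ k : Fin a, ∏ l : Fin b, f (Fin.castAdd b k) (Fin.natAdd a l) := by
  have h1 : ∀ (k : Fin a) (l : Fin b), Fin.castAdd b k < Fin.natAdd a l := fun k l =>
    Fin.lt_def.mpr (by simp; omega)
  have h2 : ∀ (k : Fin a) (l : Fin b), ¬ Fin.natAdd a l < Fin.castAdd b k := fun k l =>
    not_lt.mpr (h1 k l).le
  have h3 : ∀ k l : Fin a, Fin.castAdd b k < Fin.castAdd b l ↔ k < l := fun k l => Iff.rfl
  have h4 : ∀ k l : Fin b, Fin.natAdd a k < Fin.natAdd a l ↔ k < l := fun k l => by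
    rw [Fin.lt_def, Fin.lt_def, Fin.val_natAdd, Fin.val_natAdd]
    omega
  simp only [Finset.prod_filter, Fintype.prod_prod_type, Fin.prod_univ_add, h1, h2, h3, h4, if_true,
    if_false, Finset.prod_const_one, mul_one, Finset.prod_mul_distrib]
  rw [mul_assoc]
  congr 1
  exact mul_comm _ _

/-- Listing `u` before `v` makes the mixed pairs contribute `1 - v_l / u_k`; at the vertex of the
current this is the factor supplied by `Ω[-U^* X^{(i)}]^⊥`. -/
theorem vertexRaising_add (α β : Q0 → ℕ) : vertexRaising (fun j => α j + β j) =
    crossFactor α β * (inclU α β (vertexRaising α) * inclV α β (vertexRaising β)) := by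
  rw [vertexRaising, vertexRaising, vertexRaising, crossFactor, map_prod, map_prod,
    ← Finset.prod_mul_distrib, ← Finset.prod_mul_distrib]
  refine Finset.prod_congr rfl fun j _ => ?_
  refine (prod_lt_add
    (fun k l => (1 - mono (eps j l - eps j k) : TorusRing fun j => α j + β j))).trans ?_
  rw [mul_comm]
  simp only [map_prod, map_sub, map_one, inclU_mono, inclV_mono]
  congr 2
  · refine Finset.prod_congr rfl fun p _ => ?_
    rw [← appendWeight_eps_left, ← appendWeight_eps_left, ← map_sub, Prod.mk_sub_mk, sub_zero]
  · refine Finset.prod_congr rfl fun p _ => ?_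
    rw [← appendWeight_eps_right, ← appendWeight_eps_right, ← map_sub, Prod.mk_sub_mk, sub_zero]

end Raising

/-! ### Pairing Laurent polynomials with products of complete symmetric functions -/

section Pairing

variable {Q0 Q1 : Type*} [Fintype Q0] [DecidableEq Q0]

/-- The additive map `x^δ ↦ ∏ h_{γ - δ}` from Laurent polynomials to quiver symmetric functions. -/
def completePairing (Q1 : Type*) {n : Q0 → ℕ} (γ : Weight n) : TorusRing n →+ QSym Q0 Q1 :=
  (Finsupp.liftAddHom fun δ : Weight n => (qsymSmulHom (completeProd Q1 (γ - δ))).comp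
    (Int.castAddHom (ArrowRing Q1))).comp AddMonoidAlgebra.coeffAddEquiv.toAddMonoidHom

theorem completePairing_apply {n : Q0 → ℕ} (γ : Weight n) (f : TorusRing n) :
    completePairing Q1 γ f =
      f.coeff.sum fun δ c => (c : ArrowRing Q1) • completeProd Q1 (γ - δ) := by
  simp only [← qsymSmulHom_apply]
  rfl

theorem completePairing_mono {n : Q0 → ℕ} (γ δ : Weight n) :
    completePairing Q1 γ (mono δ) = completeProd Q1 (γ - δ) := by
  rw [completePairing_apply, mono, AddMonoidAlgebra.coeff_single, Finsupp.sum_single_index]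
  · rw [Int.cast_one, one_smul]
  · rw [Int.cast_zero, zero_smul]

/-- The pairing depends on `γ - δ` only. Through this identity, factors of a power series are
transferred to the Laurent polynomial. -/
theorem completePairing_mono_mul {n : Q0 → ℕ} (γ δ : Weight n) (f : TorusRing n) :
    completePairing Q1 γ (mono δ * f) = completePairing Q1 (γ - δ) f := by
  induction f using torus_induction with
  | hm κ => rw [mono_mul, completePairing_mono, completePairing_mono, sub_sub]
  | ha f g hf hg => rw [mul_add, map_add, map_add, hf, hg]
  | hn f hf => rw [mul_neg, map_neg, map_neg, hf]
  | h0 => rw [mul_zero, map_zero, map_zero]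

/-- Translating by `ρ` replaces `R` by `z^ρ R = J(z^ρ)`, whose signed monomials are the terms of the
Jacobi–Trudi sum. -/
theorem completePairing_vertexRaising {n : Q0 → ℕ} (γ : Weight n) :
    completePairing Q1 γ (vertexRaising n) = vertexJacobiTrudi Q1 (γ + rho n) := by
  have h := completePairing_mono_mul (Q1 := Q1) (γ + rho n) (rho n) (vertexRaising n)
  rw [add_sub_cancel_right] at h
  rw [← h, mono_rho_mul_vertexRaising, antisymmetrize_eq, map_sum, vertexJacobiTrudi]
  refine Finset.sum_congr rfl fun w _ => ?_
  rw [map_zsmul, qsym_zsmul_eq, permute_mono, completePairing_mono]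

theorem completeProd_appendWeight {α β : Q0 → ℕ} (γ : Weight α) (δ : Weight β) :
    completeProd Q1 (appendWeight α β (γ, δ)) = completeProd Q1 γ * completeProd Q1 δ := by
  rw [completeProd, completeProd, completeProd, ← Finset.prod_mul_distrib]
  refine Finset.prod_congr rfl fun j _ => ?_
  rw [Fin.prod_univ_add, atVertex, atVertex, atVertex, ← map_mul]
  simp only [appendWeight_castAdd, appendWeight_natAdd]

theorem completePairing_appendWeight {α β : Q0 → ℕ} (γ : Weight α) (δ : Weight β)
    (f : TorusRing α) (g : TorusRing β) :
    completePairing Q1 (appendWeight α β (γ, δ)) (inclU α β f * inclV α β g) =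
      completePairing Q1 γ f * completePairing Q1 δ g := by
  induction f using torus_induction with
  | hm κ =>
    induction g using torus_induction with
    | hm κ' =>
      rw [inclU_mul_inclV_mono, completePairing_mono, completePairing_mono, completePairing_mono,
        ← map_sub, Prod.mk_sub_mk, completeProd_appendWeight]
    | ha f g hf hg => rw [map_add, mul_add, map_add, map_add, hf, hg, mul_add]
    | hn f hf =>
      rw [map_neg, mul_neg, map_neg, map_neg, hf]
      exact (map_neg (AddMonoidHom.mulLeft (completePairing Q1 γ (mono κ))) _).symm
    | h0 => rw [map_zero, mul_zero, map_zero, map_zero, mul_zero]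
  | ha f g hf hg => rw [map_add, add_mul, map_add, map_add, hf, hg, add_mul]
  | hn f hf =>
    rw [map_neg, neg_mul, map_neg, map_neg, hf]
    exact (map_neg (AddMonoidHom.mulRight (completePairing Q1 δ g)) _).symm
  | h0 => rw [map_zero, zero_mul, map_zero, map_zero, zero_mul]

end Pairing

/-! ### A single vertex -/

section SingleVertex

variable {Q0 Q1 : Type*} [DecidableEq Q0] (i : Q0) {a : ℕ}

/-- The index of a variable at the vertex `i` for the dimension vector `a f^{(i)}`. -/
def vertexIndex (a : ℕ) : Fin a ≃ Fin ((Pi.single i a : Q0 → ℕ) i) :=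
  finCongr (by rw [Pi.single_eq_same])

theorem vertexWeight_vertexIndex (μ : Fin a → ℤ) (k : Fin a) :
    vertexWeight i μ i (vertexIndex i a k) = μ k := by
  rw [vertexWeight, dif_pos rfl]
  exact congrArg μ (Fin.ext rfl)

theorem weight_ext_vertexIndex {γ δ : Weight (Pi.single i a : Q0 → ℕ)}
    (h : ∀ k, γ i (vertexIndex i a k) = δ i (vertexIndex i a k)) : γ = δ := by
  funext j k
  rcases eq_or_ne j i with rfl | hj
  · obtain ⟨k, rfl⟩ := (vertexIndex j a).surjective k
    exact h k
  · exact (Fin.cast (by rw [Pi.single_eq_of_ne hj]) k : Fin 0).elim0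

/-- `vertexWeight` as an additive homomorphism. -/
def vertexWeightHom (a : ℕ) : (Fin a → ℤ) →+ Weight (Pi.single i a : Q0 → ℕ) where
  toFun := vertexWeight i
  map_zero' := weight_ext_vertexIndex i fun k => by rw [vertexWeight_vertexIndex]; rfl
  map_add' := fun γ δ => weight_ext_vertexIndex i fun k => by
    rw [vertexWeight_vertexIndex, Pi.add_apply, Pi.add_apply, Pi.add_apply,
      vertexWeight_vertexIndex, vertexWeight_vertexIndex]

theorem vertexWeightHom_apply (γ : Fin a → ℤ) : vertexWeightHom i a γ = vertexWeight i γ := rfl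

theorem vertexWeight_single (k : Fin a) :
    vertexWeight i (Pi.single k 1) = eps i (vertexIndex i a k) := by
  refine weight_ext_vertexIndex i fun l => ?_
  rw [vertexWeight_vertexIndex, eps, Pi.single_eq_same, Pi.single_apply, Pi.single_apply]
  exact if_congr (vertexIndex i a).injective.eq_iff.symm rfl rfl

variable [Fintype Q0]

theorem prod_single_vertex {M : Type*} [CommMonoid M]
    (f : (j : Q0) → Fin ((Pi.single i a : Q0 → ℕ) j) → M) :
    ∏ j, ∏ k, f j k = ∏ k : Fin a, f i (vertexIndex i a k) := by
  rw [Finset.prod_eq_single i, ← Equiv.prod_comp (vertexIndex i a)]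
  · intro j _ hj
    have : IsEmpty (Fin ((Pi.single i a : Q0 → ℕ) j)) := by
      rw [Pi.single_eq_of_ne hj]; infer_instance
    exact Finset.prod_of_isEmpty _
  · simp

theorem completeProd_vertexWeight (γ : Fin a → ℤ) : completeProd Q1 (vertexWeight i γ) =
    ∏ k, atVertex i (completeInt (ArrowRing Q1) (γ k)) := by
  rw [completeProd]
  simp only [atVertex, map_prod]
  rw [prod_single_vertex i (fun j k => PiTensorProduct.singleAlgHom (R := ArrowRing Q1)
    (A := fun _ : Q0 => Sym (ArrowRing Q1)) j (completeInt (ArrowRing Q1) (vertexWeight i γ j k)))]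
  simp only [vertexWeight_vertexIndex]

/-- The identification of Laurent polynomials in `u₁, …, u_a` with those at the vertex `i`. -/
def vertexTorus (a : ℕ) :
    AddMonoidAlgebra ℤ (Fin a → ℤ) →+* TorusRing (Pi.single i a : Q0 → ℕ) :=
  AddMonoidAlgebra.mapDomainRingHom ℤ (vertexWeightHom i a)

theorem vertexTorus_raising :
    vertexTorus i a (raising a) = vertexRaising (Pi.single i a : Q0 → ℕ) := by
  have h : ∀ γ : Fin a → ℤ, vertexTorus i a (AddMonoidAlgebra.single γ 1) =
      mono (vertexWeight i γ) := fun γ => AddMonoidAlgebra.mapDomain_single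
  rw [raising, vertexRaising, Finset.prod_eq_single i]
  · simp only [map_prod, map_sub, map_one, h]
    simp only [Finset.prod_filter]
    rw [← Equiv.prod_comp ((vertexIndex i a).prodCongr (vertexIndex i a))]
    refine Finset.prod_congr rfl fun p _ => ?_
    refine if_congr Iff.rfl ?_ rfl
    rw [← vertexWeightHom_apply, map_sub, vertexWeightHom_apply, vertexWeightHom_apply,
      vertexWeight_single, vertexWeight_single]
    rfl
  · intro j _ hj
    have : IsEmpty (Fin ((Pi.single i a : Q0 → ℕ) j)) := by
      rw [Pi.single_eq_of_ne hj]; infer_instance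
    exact Finset.prod_of_isEmpty _
  · simp

theorem completePairing_vertexTorus (γ : Fin a → ℤ) (f : AddMonoidAlgebra ℤ (Fin a → ℤ)) :
    completePairing Q1 (vertexWeight i γ) (vertexTorus i a f) =
      f.coeff.sum fun δ c => (c : ArrowRing Q1) •
        ∏ k, atVertex i (completeInt (ArrowRing Q1) (γ k - δ k)) := by
  have h1 : (vertexTorus i a f).coeff = f.coeff.mapDomain (vertexWeightHom i a) := rfl
  rw [completePairing_apply, h1, Finsupp.sum_mapDomain_index]
  · refine Finsupp.sum_congr fun δ _ => ?_
    rw [← vertexWeightHom_apply, ← map_sub, vertexWeightHom_apply, completeProd_vertexWeight]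
    rfl
  · intro δ
    rw [Int.cast_zero, zero_smul]
  · intro δ c d
    rw [Int.cast_add, add_smul]

theorem crossFactor_single_vertex (β : Q0 → ℕ) : crossFactor (Pi.single i a) β =
    ∏ k : Fin a, ∏ l : Fin (β i), (1 - mono (appendWeight (Pi.single i a) β
      (-vertexWeight i (Pi.single k 1), eps i l))) := by
  have h := prod_single_vertex (M := TorusRing fun j => (Pi.single i a : Q0 → ℕ) j + β j) (a := a) i
    fun j k => ∏ l : Fin (β j), (1 - mono (eps (ν := fun j => (Pi.single i a : Q0 → ℕ) j + β j) j
      (Fin.natAdd ((Pi.single i a : Q0 → ℕ) j) l) - eps j (Fin.castAdd (β j) k)))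
  refine Eq.trans h ?_
  refine Finset.prod_congr rfl fun k _ => Finset.prod_congr rfl fun l _ => congrArg (1 - ·) ?_
  refine congrArg mono ?_
  rw [← appendWeight_eps_left, ← appendWeight_eps_right, ← map_sub, Prod.mk_sub_mk, zero_sub,
    sub_zero, vertexWeight_single]

end SingleVertex

/-! ### Evaluation of the skewing series -/

section OneVariable

variable {S σ : Type*} [CommRing S]

theorem coeff_toMvPowerSeries_single (k : σ) (m : ℕ) (f : PowerSeries S) :
    MvPowerSeries.coeff (Finsupp.single k m) (f.toMvPowerSeries k) = PowerSeries.coeff m f := by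
  have h := MvPowerSeries.coeff_embDomain_rename (Function.Embedding.punit k) f
    (Finsupp.single () m)
  rw [Finsupp.embDomain_single] at h
  exact h

theorem coeff_toMvPowerSeries_of_ne {k : σ} {q : σ →₀ ℕ} (h : q ≠ Finsupp.single k (q k))
    (f : PowerSeries S) : MvPowerSeries.coeff q (f.toMvPowerSeries k) = 0 := by
  refine MvPowerSeries.coeff_rename_eq_zero _ _ ?_
  rintro ⟨m, rfl⟩
  refine h ?_
  have h1 : m = Finsupp.single () (m ()) := Finsupp.ext fun x => by simp
  rw [h1, Finsupp.mapDomain_single, Finsupp.single_eq_same]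

/-- Each factor involves its own variable only, so an exponent can be distributed in a single way.
-/
theorem coeff_prod_toMvPowerSeries [Fintype σ] (f : σ → PowerSeries S) (q : σ →₀ ℕ) :
    MvPowerSeries.coeff q (∏ k, (f k).toMvPowerSeries k) = ∏ k, PowerSeries.coeff (q k) (f k) := by
  classical
  rw [MvPowerSeries.coeff_prod]
  let l : σ →₀ σ →₀ ℕ := Finsupp.equivFunOnFinite.symm fun k => Finsupp.single k (q k)
  rw [Finset.sum_eq_single l]
  · exact Finset.prod_congr rfl fun k _ => coeff_toMvPowerSeries_single k _ _
  · intro l' hl' hne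
    by_contra h0
    have h1 : ∀ k, l' k = Finsupp.single k (l' k k) := fun k => by
      by_contra h
      exact h0 (Finset.prod_eq_zero (Finset.mem_univ k) (coeff_toMvPowerSeries_of_ne h _))
    refine hne (Finsupp.ext fun k => ?_)
    have h2 := (Finset.mem_finsuppAntidiag.mp hl').1
    have h3 : q k = l' k k := by
      rw [← h2, Finset.sum_apply', Finset.sum_eq_single k]
      · intro j _ hj
        rw [h1 j, Finsupp.single_eq_of_ne hj.symm]
      · simp
    rw [h1 k, ← h3]
    rfl
  · intro h
    exfalso
    refine h (Finset.mem_finsuppAntidiag.mpr ⟨?_, Finset.subset_univ _⟩)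
    refine Finsupp.ext fun k => ?_
    rw [Finset.sum_apply', Finset.sum_eq_single k]
    · exact Finsupp.single_eq_same
    · intro j _ hj
      exact Finsupp.single_eq_of_ne hj.symm
    · simp

end OneVariable

/-! ### Reciprocals of the series `Ω` in finitely many variables -/

section EvalOmega

variable {Q0 Q1 : Type*} (n : Q0 → ℕ)

/-- The one-variable series `Ω[c X^{(j)}]` in the variables at the vertices. -/
def omegaFactor (c : ArrowRing Q1) (j : Q0) :
    PowerSeries (MvPowerSeries (Vars n) (ArrowRing Q1)) :=
  PowerSeries.mk fun m => MvPowerSeries.C c ^ m * vertexEval Q1 n j (complete (ArrowRing Q1) m)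

/-- The series `1 - s x w_k`, in the variable `x = x_l^{(j)}` and the series variables `w`. -/
def binomial {a : ℕ} (s : ArrowRing Q1) (x : Vars n) (k : Fin a) :
    MvPowerSeries (Fin a) (MvPowerSeries (Vars n) (ArrowRing Q1)) :=
  1 - MvPowerSeries.C (MvPowerSeries.C s * MvPowerSeries.X x) * MvPowerSeries.X k

/-- The generating identity of the `h_m`, with the series variable rescaled by `c`. -/
theorem omegaFactor_mul (c : ArrowRing Q1) (j : Q0) :
    omegaFactor n c j * ∏ l : Fin (n j), (1 - PowerSeries.C
      (MvPowerSeries.C c * MvPowerSeries.X (⟨j, l⟩ : Vars n)) * PowerSeries.X) = 1 := by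
  have h := congrArg (fun f => PowerSeries.rescale (MvPowerSeries.C c) (PowerSeries.map
    (MvPowerSeries.rename (R := ArrowRing Q1) (varEmb n j)).toRingHom f))
    (mk_complete_mul_prod (R := ArrowRing Q1) (n j))
  simp only [map_mul, map_prod, map_sub, map_one, PowerSeries.map_C, PowerSeries.map_X,
    PowerSeries.rescale_X, completeInt_natCast] at h
  refine (congrArg₂ (· * ·) ?_ (Finset.prod_congr rfl fun l _ => ?_)).trans h
  · ext m : 1
    rw [PowerSeries.coeff_rescale, PowerSeries.coeff_map, omegaFactor, PowerSeries.coeff_mk,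
      PowerSeries.coeff_mk]
    rfl
  · have h1 : (MvPowerSeries.rename (R := ArrowRing Q1) (varEmb n j)).toRingHom
        (MvPowerSeries.X l) = MvPowerSeries.X (⟨j, l⟩ : Vars n) := MvPowerSeries.rename_X _ l
    have h2 : PowerSeries.rescale (MvPowerSeries.C c) (PowerSeries.C
        (MvPowerSeries.X (⟨j, l⟩ : Vars n) : MvPowerSeries (Vars n) (ArrowRing Q1))) =
        PowerSeries.C (MvPowerSeries.X (⟨j, l⟩ : Vars n)) := by
      ext m : 1
      rw [PowerSeries.coeff_rescale, PowerSeries.coeff_C]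
      split_ifs with hm
      · rw [hm, pow_zero, one_mul]
      · rw [mul_zero]
    rw [h1, h2, map_mul]
    ring

theorem toMvPowerSeries_omegaFactor_mul {a : ℕ} (c : ArrowRing Q1) (j : Q0) (k : Fin a) :
    (omegaFactor n c j).toMvPowerSeries k * ∏ l : Fin (n j), binomial n c ⟨j, l⟩ k = 1 := by
  have h := congrArg (PowerSeries.toMvPowerSeries k) (omegaFactor_mul n c j)
  rw [map_mul, map_prod, map_one] at h
  refine (congrArg (_ * ·) (Finset.prod_congr rfl fun l _ => ?_)).trans h
  rw [binomial, map_sub, map_one, map_mul (PowerSeries.toMvPowerSeries k),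
    PowerSeries.toMvPowerSeries_C, PowerSeries.toMvPowerSeries_X]

variable [Fintype Q0] [DecidableEq Q0]

theorem map_eval_omega (a : ℕ) (c : ArrowRing Q1) (j : Q0) :
    MvPowerSeries.map (eval Q1 n).toRingHom (omega a c j) =
      ∏ k, (omegaFactor n c j).toMvPowerSeries k := by
  ext q : 1
  rw [MvPowerSeries.coeff_map, coeff_prod_toMvPowerSeries]
  have h : eval Q1 n (c ^ q.degree • ∏ k, atVertex j (complete (ArrowRing Q1) (q k))) =
      ∏ k, PowerSeries.coeff (q k) (omegaFactor n c j) := by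
    simp only [omegaFactor, PowerSeries.coeff_mk, Finset.prod_mul_distrib, Finset.prod_pow_eq_pow_sum]
    rw [map_smul, map_prod, Algebra.smul_def, ← Finsupp.degree_eq_sum, map_pow]
    simp only [eval_atVertex]
    rfl
  exact h

theorem map_eval_omega_mul (a : ℕ) (c : ArrowRing Q1) (j : Q0) :
    MvPowerSeries.map (eval Q1 n).toRingHom (omega a c j) *
      ∏ k : Fin a, ∏ l : Fin (n j), binomial n c ⟨j, l⟩ k = 1 := by
  rw [map_eval_omega, ← Finset.prod_mul_distrib]
  exact Finset.prod_eq_one fun k _ => toMvPowerSeries_omegaFactor_mul n c j k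

theorem constantCoeff_omega (a : ℕ) (c : ArrowRing Q1) (j : Q0) :
    MvPowerSeries.constantCoeff (omega a c j : MvPowerSeries (Fin a) (QSym Q0 Q1)) = 1 := by
  have h : (c ^ (0 : Fin a →₀ ℕ).degree • ∏ k : Fin a, atVertex j
      (complete (ArrowRing Q1) ((0 : Fin a →₀ ℕ) k)) : QSym Q0 Q1) = 1 := by
    simp only [map_zero, pow_zero, one_smul, Finsupp.coe_zero, Pi.zero_apply, complete_zero,
      atVertex, map_one, Finset.prod_const_one]
  exact h

variable [Fintype Q1] [DecidableEq Q1]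

/-- The product of the series `Ω[t_b W X^{(hb)}]` over the arrows `b` out of `i`. -/
def outSeries (tl hd : Q1 → Q0) (i : Q0) (a : ℕ) :
    MvPowerSeries (Fin a) (MvPowerSeries (Vars n) (ArrowRing Q1)) :=
  ∏ b : Q1 with tl b = i, ∏ k, (omegaFactor n (arrowVar b) (hd b)).toMvPowerSeries k

/-- Evaluation is a ring homomorphism, so it preserves reciprocals, and `1 / Ω[W X^{(i)}]` becomes
the polynomial `∏ (1 - w_k x_l^{(i)})`. -/
theorem map_eval_skewSeries (tl hd : Q1 → Q0) (i : Q0) (a : ℕ) :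
    MvPowerSeries.map (eval Q1 n).toRingHom (skewSeries tl hd i a) =
      (∏ k : Fin a, ∏ l : Fin (n i), binomial n 1 ⟨i, l⟩ k) * outSeries n tl hd i a := by
  rw [skewSeries, map_mul, map_prod, outSeries]
  simp only [map_eval_omega n a (arrowVar _)]
  congr 1
  have h1 := congrArg (MvPowerSeries.map (eval Q1 n).toRingHom)
    (MvPowerSeries.mul_invOfUnit (omega a (1 : ArrowRing Q1) i) 1 (constantCoeff_omega a 1 i))
  rw [map_mul, map_one] at h1
  exact left_inv_eq_right_inv (by rw [mul_comm]; exact h1) (map_eval_omega_mul n a 1 i)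

theorem outSeries_mul (tl hd : Q1 → Q0) (i : Q0) (a : ℕ) :
    outSeries n tl hd i a * ∏ b : Q1 with tl b = i, ∏ k : Fin a, ∏ l : Fin (n (hd b)),
      binomial n (arrowVar b) ⟨hd b, l⟩ k = 1 := by
  rw [outSeries, ← Finset.prod_mul_distrib]
  refine Finset.prod_eq_one fun b _ => ?_
  rw [← Finset.prod_mul_distrib]
  exact Finset.prod_eq_one fun k _ => toMvPowerSeries_omegaFactor_mul n _ _ k

end EvalOmega

/-! ### Coefficients of series in two sets of variables -/

section Bicoeff

variable {R σ τ : Type*} [CommRing R]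

/-- The coefficient of `w^q x^m` in a series in the variables `w` and `x`. -/
def bicoeff (p : (σ →₀ ℕ) × (τ →₀ ℕ)) : MvPowerSeries σ (MvPowerSeries τ R) →+ R :=
  (MvPowerSeries.coeff (R := R) p.2).toAddMonoidHom.comp
    (MvPowerSeries.coeff (R := MvPowerSeries τ R) p.1).toAddMonoidHom

theorem bicoeff_apply (p : (σ →₀ ℕ) × (τ →₀ ℕ)) (K : MvPowerSeries σ (MvPowerSeries τ R)) :
    bicoeff p K = MvPowerSeries.coeff p.2 (MvPowerSeries.coeff p.1 K) := rfl

/-- The monomial `s w^q x^m`. -/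
def bimonomial (e : (σ →₀ ℕ) × (τ →₀ ℕ)) (s : R) : MvPowerSeries σ (MvPowerSeries τ R) :=
  MvPowerSeries.monomial e.1 (MvPowerSeries.monomial e.2 s)

theorem bicoeff_bimonomial_mul (e p : (σ →₀ ℕ) × (τ →₀ ℕ)) (s : R)
    (K : MvPowerSeries σ (MvPowerSeries τ R)) :
    bicoeff (p + e) (bimonomial e s * K) = s * bicoeff p K := by
  rw [bicoeff_apply, bimonomial, Prod.fst_add, Prod.snd_add, add_comm p.1, add_comm p.2,
    MvPowerSeries.coeff_add_monomial_mul, MvPowerSeries.coeff_add_monomial_mul, bicoeff_apply]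

theorem bicoeff_bimonomial_mul_eq_zero {e p : (σ →₀ ℕ) × (τ →₀ ℕ)} (h : ∀ p', p ≠ p' + e) (s : R)
    (K : MvPowerSeries σ (MvPowerSeries τ R)) : bicoeff p (bimonomial e s * K) = 0 := by
  classical
  rw [bicoeff_apply, bimonomial, MvPowerSeries.coeff_monomial_mul]
  split_ifs with h1
  · rw [MvPowerSeries.coeff_monomial_mul]
    split_ifs with h2
    · exact absurd (Prod.ext (tsub_add_cancel_of_le h1).symm (tsub_add_cancel_of_le h2).symm)
        (h (p.1 - e.1, p.2 - e.2))
    · rfl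
  · rw [map_zero]

/-- Multiplication by a monomial shifts the summation index. -/
theorem finsum_bimonomial_mul {N : Type*} [AddCommMonoid N] (φ : (σ →₀ ℕ) × (τ →₀ ℕ) → R →+ N)
    (e : (σ →₀ ℕ) × (τ →₀ ℕ)) (s : R) (K : MvPowerSeries σ (MvPowerSeries τ R)) :
    ∑ᶠ p, φ p (bicoeff p (bimonomial e s * K)) = ∑ᶠ p, φ (p + e) (s * bicoeff p K) := by
  classical
  have h1 : ∀ p, φ p (bicoeff p (bimonomial e s * K)) =
      ∑ᶠ _ : p ∈ Set.range (· + e), φ p (bicoeff p (bimonomial e s * K)) := fun p => by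
    rw [finsum_eq_if]
    split_ifs with h
    · rfl
    · rw [bicoeff_bimonomial_mul_eq_zero, map_zero]
      rintro p' rfl
      exact h ⟨p', rfl⟩
  rw [finsum_congr h1, finsum_mem_range (add_left_injective e)]
  simp only [bicoeff_bimonomial_mul]

theorem bicoeff_one [DecidableEq σ] [DecidableEq τ] (p : (σ →₀ ℕ) × (τ →₀ ℕ)) :
    bicoeff p (1 : MvPowerSeries σ (MvPowerSeries τ R)) = if p = 0 then 1 else 0 := by
  rw [bicoeff_apply, MvPowerSeries.coeff_one]
  by_cases h1 : p.1 = 0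
  · rw [if_pos h1, MvPowerSeries.coeff_one]
    exact if_congr ⟨fun h => Prod.ext h1 h, fun h => congrArg Prod.snd h⟩ rfl rfl
  · rw [if_neg h1, map_zero, if_neg fun h => h1 (congrArg Prod.fst h)]

end Bicoeff

/-! ### Series with restricted exponents -/

section SupportIn

variable {Q1 σ τ : Type*}

/-- The exponents of the monomials `w^q x^m t^g` which occur in `K` belong to `S`. -/
def SupportIn (S : AddSubmonoid ((σ →₀ ℕ) × (τ →₀ ℕ) × (Q1 → ℤ)))
    (K : MvPowerSeries σ (MvPowerSeries τ (ArrowRing Q1))) : Prop :=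
  ∀ p g, (bicoeff p K).coeff g ≠ 0 → (p.1, p.2, g) ∈ S

variable {S : AddSubmonoid ((σ →₀ ℕ) × (τ →₀ ℕ) × (Q1 → ℤ))}
  {K K' : MvPowerSeries σ (MvPowerSeries τ (ArrowRing Q1))}

theorem SupportIn.mul (hK : SupportIn S K) (hK' : SupportIn S K') : SupportIn S (K * K') := by
  classical
  intro p g h
  rw [bicoeff_apply, MvPowerSeries.coeff_mul, map_sum, AddMonoidAlgebra.coeff_sum,
    Finsupp.finsetSum_apply] at h
  obtain ⟨q, hq, h⟩ := Finset.exists_ne_zero_of_sum_ne_zero h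
  rw [MvPowerSeries.coeff_mul, AddMonoidAlgebra.coeff_sum, Finsupp.finsetSum_apply] at h
  obtain ⟨m, hm, h⟩ := Finset.exists_ne_zero_of_sum_ne_zero h
  obtain ⟨g1, hg1, g2, hg2, rfl⟩ := Finset.mem_add.mp
    (AddMonoidAlgebra.support_coeff_mul_subset _ _ (Finsupp.mem_support_iff.mpr h))
  have h1 := S.add_mem (hK (q.1, m.1) g1 (Finsupp.mem_support_iff.mp hg1))
    (hK' (q.2, m.2) g2 (Finsupp.mem_support_iff.mp hg2))
  rwa [Prod.mk_add_mk, Prod.mk_add_mk, Finset.HasAntidiagonal.mem_antidiagonal.mp hq,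
    Finset.HasAntidiagonal.mem_antidiagonal.mp hm] at h1

theorem SupportIn.one : SupportIn S (1 : MvPowerSeries σ (MvPowerSeries τ (ArrowRing Q1))) := by
  classical
  intro p g h
  rw [bicoeff_one] at h
  split_ifs at h with hp
  · rw [AddMonoidAlgebra.one_def, AddMonoidAlgebra.coeff_single, Finsupp.single_apply] at h
    split_ifs at h with hg
    · rw [hp, ← hg]
      exact S.zero_mem
    · exact absurd rfl h
  · exact absurd rfl h

theorem SupportIn.prod {ι : Type*} (s : Finset ι)
    (F : ι → MvPowerSeries σ (MvPowerSeries τ (ArrowRing Q1))) (h : ∀ k ∈ s, SupportIn S (F k)) :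
    SupportIn S (∏ k ∈ s, F k) :=
  Finset.prod_induction _ _ (fun _ _ => SupportIn.mul) SupportIn.one h

theorem SupportIn.sub (hK : SupportIn S K) (hK' : SupportIn S K') : SupportIn S (K - K') := by
  intro p g h
  rw [map_sub, AddMonoidAlgebra.coeff_sub, Finsupp.sub_apply] at h
  by_cases h1 : (bicoeff p K).coeff g = 0
  · exact hK' p g fun h2 => h (by rw [h1, h2, sub_zero])
  · exact hK p g h1

theorem SupportIn.bimonomial {e : (σ →₀ ℕ) × (τ →₀ ℕ)} {s : ArrowRing Q1}
    (h : ∀ g, s.coeff g ≠ 0 → (e.1, e.2, g) ∈ S) : SupportIn S (bimonomial e s) := by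
  classical
  intro p g hp
  rw [bicoeff_apply, QuiverCurrents.bimonomial, MvPowerSeries.coeff_monomial] at hp
  split_ifs at hp with h1
  · rw [MvPowerSeries.coeff_monomial] at hp
    split_ifs at hp with h2
    · rw [h1, h2]
      exact h g hp
    · exact absurd rfl hp
  · exact absurd rfl hp

end SupportIn

/-! ### Homogeneity of the skewing series -/

section Homogeneity

variable {Q0 Q1 : Type*} {n : Q0 → ℕ}

theorem coeff_vertexEval_complete (j : Q0) (m : ℕ) {x : Vars n →₀ ℕ}
    (h : MvPowerSeries.coeff x (vertexEval Q1 n j (complete (ArrowRing Q1) m)) ≠ 0) :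
    x.degree = m ∧
      MvPowerSeries.coeff x (vertexEval Q1 n j (complete (ArrowRing Q1) m)) = 1 := by
  by_cases hx : x ∈ Set.range (Finsupp.mapDomain (varEmb n j))
  · obtain ⟨y, rfl⟩ := hx
    have h1 : MvPowerSeries.coeff (Finsupp.mapDomain (varEmb n j) y)
        (vertexEval Q1 n j (complete (ArrowRing Q1) m)) = if y.degree = m then 1 else 0 := by
      rw [← coeff_restrictHom_complete, ← Finsupp.embDomain_eq_mapDomain]
      exact MvPowerSeries.coeff_embDomain_rename _ _ _
    rw [h1] at h ⊢
    split_ifs at h ⊢ with h2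
    · refine ⟨?_, rfl⟩
      rw [← h2, Finsupp.degree_mapDomain]
    · exact absurd rfl h
  · exact absurd (MvPowerSeries.coeff_rename_eq_zero (varEmb n j) _ hx) h

theorem arrowVar_pow [DecidableEq Q1] (b : Q1) (m : ℕ) :
    arrowVar b ^ m = (AddMonoidAlgebra.single (m • Pi.single b 1) 1 : ArrowRing Q1) := by
  rw [arrowVar, AddMonoidAlgebra.single_pow, one_pow]

theorem binomial_eq {a : ℕ} (s : ArrowRing Q1) (x : Vars n) (k : Fin a) :
    binomial n s x k = 1 - bimonomial (Finsupp.single k 1, Finsupp.single x 1) s := by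
  rw [binomial, bimonomial, MvPowerSeries.X_def, MvPowerSeries.X_def,
    ← MvPowerSeries.monomial_zero_eq_C_apply, ← MvPowerSeries.monomial_zero_eq_C_apply,
    MvPowerSeries.monomial_mul_monomial, MvPowerSeries.monomial_mul_monomial, zero_add, zero_add,
    mul_one, mul_one]

/-- The exponents of the monomials `w^q x^m t^g` with `|q| = |m|`. -/
def homogeneousExponents (σ τ Q1 : Type*) : AddSubmonoid ((σ →₀ ℕ) × (τ →₀ ℕ) × (Q1 → ℤ)) where
  carrier := {x | x.1.degree = x.2.1.degree}
  zero_mem' := by simp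
  add_mem' := fun {x y} hx hy => by
    have hx' : x.1.degree = x.2.1.degree := hx
    have hy' : y.1.degree = y.2.1.degree := hy
    simp [hx', hy']

/-- The exponents of the monomials `w^q x^m t^g` with `|q| = |m| = |g|` and `g ≥ 0`. -/
def arrowExponents (σ τ Q1 : Type*) [Fintype Q1] :
    AddSubmonoid ((σ →₀ ℕ) × (τ →₀ ℕ) × (Q1 → ℤ)) where
  carrier := {x | x.1.degree = x.2.1.degree ∧ ∑ b, x.2.2 b = x.1.degree ∧ 0 ≤ x.2.2}
  zero_mem' := by simp
  add_mem' := fun {x y} hx hy => by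
    obtain ⟨h1, h2, h3⟩ := hx
    obtain ⟨h4, h5, h6⟩ := hy
    refine ⟨?_, ?_, add_nonneg h3 h6⟩
    · simp [h1, h4]
    · simp [Finset.sum_add_distrib, h2, h5]

theorem arrowExponents_le (σ τ Q1 : Type*) [Fintype Q1] :
    arrowExponents σ τ Q1 ≤ homogeneousExponents σ τ Q1 := fun _ hx => hx.1

theorem SupportIn.mono {σ τ : Type*} {S S' : AddSubmonoid ((σ →₀ ℕ) × (τ →₀ ℕ) × (Q1 → ℤ))}
    {K : MvPowerSeries σ (MvPowerSeries τ (ArrowRing Q1))} (hK : SupportIn S K) (h : S ≤ S') :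
    SupportIn S' K := fun p g hp => h (hK p g hp)

/-- No arrow variable occurs here, so only `|q| = |m|` is available. Finiteness of the pairing sums
comes instead from the vanishing of `h` at negative indices. -/
theorem supportIn_binomial_one {a : ℕ} (x : Vars n) (k : Fin a) :
    SupportIn (homogeneousExponents (Fin a) (Vars n) Q1) (binomial n 1 x k) := by
  rw [binomial_eq]
  refine SupportIn.one.sub (SupportIn.bimonomial fun g _ => ?_)
  change (Finsupp.single k 1).degree = (Finsupp.single x 1).degree
  rw [Finsupp.degree_single, Finsupp.degree_single]

variable [Fintype Q1] [DecidableEq Q1]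

theorem mem_arrowExponents {σ τ : Type*} {q : σ →₀ ℕ} {x : τ →₀ ℕ} {m : ℕ} (hq : q.degree = m)
    (hx : x.degree = m) (b : Q1) : (q, x, m • Pi.single b 1) ∈ arrowExponents σ τ Q1 := by
  refine ⟨hq.trans hx.symm, ?_, ?_⟩
  · simp [hq, ← Finset.mul_sum]
  · exact nsmul_nonneg (Pi.single_nonneg.mpr zero_le_one) m

theorem supportIn_binomial_arrowVar {a : ℕ} (b : Q1) (x : Vars n) (k : Fin a) :
    SupportIn (arrowExponents (Fin a) (Vars n) Q1) (binomial n (arrowVar b) x k) := by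
  rw [binomial_eq]
  refine SupportIn.one.sub (SupportIn.bimonomial fun g hg => ?_)
  rw [arrowVar, AddMonoidAlgebra.coeff_single, Finsupp.single_apply] at hg
  split_ifs at hg with h
  · rw [← h, ← one_smul ℕ (Pi.single b 1)]
    exact mem_arrowExponents (Finsupp.degree_single _ _) (Finsupp.degree_single _ _) b
  · exact absurd rfl hg

theorem supportIn_omegaFactor {a : ℕ} (b : Q1) (j : Q0) (k : Fin a) :
    SupportIn (arrowExponents (Fin a) (Vars n) Q1)
      ((omegaFactor n (arrowVar b) j).toMvPowerSeries k) := by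
  intro p g h
  rw [bicoeff_apply] at h
  by_cases hp : p.1 = Finsupp.single k (p.1 k)
  · rw [hp, coeff_toMvPowerSeries_single, omegaFactor, PowerSeries.coeff_mk, ← map_pow,
      MvPowerSeries.coeff_C_mul] at h
    obtain ⟨h1, h2⟩ := coeff_vertexEval_complete (Q1 := Q1) j (p.1 k) (x := p.2) fun h0 => by
      rw [h0, mul_zero] at h
      exact h rfl
    rw [h2, mul_one, arrowVar_pow, AddMonoidAlgebra.coeff_single, Finsupp.single_apply] at h
    split_ifs at h with hg
    · rw [← hg]
      exact mem_arrowExponents (by conv_lhs => rw [hp, Finsupp.degree_single]) h1 b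
    · exact absurd rfl h
  · rw [coeff_toMvPowerSeries_of_ne hp, map_zero] at h
    exact absurd rfl h

/-- Every `w_k` is accompanied by one `x` and one arrow variable. Hence each `t^g` occurs with
finitely many monomials, and `w = u`, `x = v⁻¹` may be substituted. -/
theorem supportIn_outSeries [DecidableEq Q0] (tl hd : Q1 → Q0) (i : Q0) (a : ℕ) :
    SupportIn (arrowExponents (Fin a) (Vars n) Q1) (outSeries n tl hd i a) :=
  SupportIn.prod _ _ fun _ _ => SupportIn.prod _ _ fun _ _ => supportIn_omegaFactor _ _ _

end Homogeneity

/-! ### The weight of an exponent -/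

section ExponentWeight

variable {Q0 : Type*} [DecidableEq Q0] (i : Q0) (a : ℕ) (β : Q0 → ℕ)

/-- The weight of `u^q v^{-m}`. -/
def exponentWeight : ((Fin a →₀ ℕ) × (Vars β →₀ ℕ)) →+
    Weight (fun j => (Pi.single i a : Q0 → ℕ) j + β j) where
  toFun := fun p => appendWeight (Pi.single i a) β
    (vertexWeightHom i a (fun k => (p.1 k : ℤ)), -expWeight p.2)
  map_zero' := by
    rw [← map_zero (appendWeight (Pi.single i a) β)]
    refine congrArg _ (Prod.ext ?_ ?_)
    · exact map_zero (vertexWeightHom i a)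
    · funext j k
      simp [expWeight]
  map_add' := fun p q => by
    rw [← map_add]
    refine congrArg _ (Prod.ext ?_ ?_)
    · refine Eq.trans (congrArg (vertexWeightHom i a) ?_) (map_add (vertexWeightHom i a)
        (fun k => (p.1 k : ℤ)) fun k => (q.1 k : ℤ))
      funext k
      simp
    · exact (congrArg Neg.neg (expWeight_add p.2 q.2)).trans (neg_add _ _)

variable {i a β}

theorem exponentWeight_apply (p : (Fin a →₀ ℕ) × (Vars β →₀ ℕ)) : exponentWeight i a β p =
    appendWeight (Pi.single i a) β (vertexWeight i (fun k => (p.1 k : ℤ)), -expWeight p.2) := rfl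

theorem expWeight_single (j : Q0) (l : Fin (β j)) :
    expWeight (Finsupp.single (⟨j, l⟩ : Vars β) 1) = eps j l := by
  funext j' l'
  rw [expWeight, eps]
  rcases eq_or_ne j' j with rfl | h
  · rw [Pi.single_eq_same, Finsupp.single_apply, Pi.single_apply]
    have h1 : (⟨j', l⟩ : Vars β) = ⟨j', l'⟩ ↔ l' = l :=
      ⟨fun h => (eq_of_heq (Sigma.mk.inj h).2).symm, fun h => by rw [h]⟩
    by_cases h2 : l' = l
    · rw [if_pos (h1.mpr h2), if_pos h2]; rfl
    · rw [if_neg fun h => h2 (h1.mp h), if_neg h2]; rfl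
  · rw [Pi.single_eq_of_ne h, Finsupp.single_eq_of_ne fun h' => h (congrArg Sigma.fst h')]
    rfl

theorem exponentWeight_single (k : Fin a) (j : Q0) (l : Fin (β j)) :
    exponentWeight i a β (Finsupp.single k 1, Finsupp.single ⟨j, l⟩ 1) =
      appendWeight (Pi.single i a) β (eps i (vertexIndex i a k), -eps j l) := by
  rw [exponentWeight_apply, expWeight_single, ← vertexWeight_single]
  refine congrArg (fun γ => appendWeight (Pi.single i a) β (vertexWeight i γ, -eps j l)) ?_
  funext m
  rw [Finsupp.single_apply, Pi.single_apply, Nat.cast_ite, Nat.cast_one, Nat.cast_zero]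
  exact if_congr eq_comm rfl rfl

end ExponentWeight

/-! ### The coefficients of the shuffle kernel -/

section Kernel

variable {Q0 Q1 : Type*} [DecidableEq Q0] (i : Q0) {a : ℕ} {β : Q0 → ℕ}

/-- The coefficient of `t^g` in the series obtained from `K` by substituting `u` and `v⁻¹`. -/
def kernelCoeff (K : MvPowerSeries (Fin a) (MvPowerSeries (Vars β) (ArrowRing Q1))) (g : Q1 → ℤ) :
    TorusRing fun j => (Pi.single i a : Q0 → ℕ) j + β j :=
  ∑ᶠ p, (bicoeff p K).coeff g • mono (exponentWeight i a β p)

/-- The additive map `r ↦ [t^g] r • x^δ`. -/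
def coeffSmulMono {ν : Q0 → ℕ} (g : Q1 → ℤ) (δ : Weight ν) : ArrowRing Q1 →+ TorusRing ν where
  toFun := fun r => r.coeff g • mono δ
  map_zero' := by rw [AddMonoidAlgebra.coeff_zero, Finsupp.zero_apply, zero_smul]
  map_add' := fun r s => by rw [AddMonoidAlgebra.coeff_add, Finsupp.add_apply, add_smul]

theorem coeffSmulMono_apply {ν : Q0 → ℕ} (g : Q1 → ℤ) (δ : Weight ν) (r : ArrowRing Q1) :
    coeffSmulMono g δ r = r.coeff g • mono δ := rfl

variable [Fintype Q1]

theorem finite_bicoeff [Finite Q0]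
    {K : MvPowerSeries (Fin a) (MvPowerSeries (Vars β) (ArrowRing Q1))}
    (hK : SupportIn (arrowExponents (Fin a) (Vars β) Q1) K) (g : Q1 → ℤ) :
    {p | (bicoeff p K).coeff g ≠ 0}.Finite := by
  refine ((Finsupp.finite_of_degree_le (∑ b, g b).toNat).prod
    (Finsupp.finite_of_degree_le (∑ b, g b).toNat)).subset fun p hp => ?_
  obtain ⟨h1, h2, -⟩ := hK p g hp
  have h1' : p.1.degree = p.2.degree := h1
  have h2' : ∑ b, g b = p.1.degree := h2
  exact ⟨by change p.1.degree ≤ _; omega, by change p.2.degree ≤ _; omega⟩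

theorem hasFiniteSupport_kernelCoeff [Finite Q0]
    {K : MvPowerSeries (Fin a) (MvPowerSeries (Vars β) (ArrowRing Q1))}
    (hK : SupportIn (arrowExponents (Fin a) (Vars β) Q1) K) (g : Q1 → ℤ) :
    Function.HasFiniteSupport fun p =>
      (bicoeff p K).coeff g • mono (exponentWeight i a β p) :=
  (finite_bicoeff hK g).subset fun p hp h => hp (by simp only [h, zero_smul])

theorem isPWO_nonneg : {g : Q1 → ℤ | 0 ≤ g}.IsPWO := by
  have h : (Set.univ.pi fun _ : Q1 => Set.range fun n : ℕ => (n : ℤ)).IsPWO := by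
    refine Set.IsPWO.pi fun _ => ?_
    rw [← Set.image_univ]
    exact (Set.isPWO_of_wellQuasiOrderedLE _).image_of_monotone fun m n h => Int.ofNat_le.mpr h
  exact h.mono fun g hg b _ => ⟨(g b).toNat, Int.toNat_of_nonneg (hg b)⟩

theorem exists_kernelSeries {K : MvPowerSeries (Fin a) (MvPowerSeries (Vars β) (ArrowRing Q1))}
    (hK : SupportIn (arrowExponents (Fin a) (Vars β) Q1) K) :
    ∃ H : Completed Q1 fun j => (Pi.single i a : Q0 → ℕ) j + β j,
      ∀ g, H.coeff g = kernelCoeff i K g := by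
  refine ⟨⟨kernelCoeff i K, isPWO_nonneg.mono fun g hg => ?_⟩, fun g => rfl⟩
  by_contra h
  refine hg (finsum_eq_zero_of_forall_eq_zero fun p => ?_)
  by_cases hp : (bicoeff p K).coeff g = 0
  · rw [hp, zero_smul]
  · exact absurd (hK p g hp).2.2 h

variable [DecidableEq Q1]

theorem coeff_arrowVar_mul (b : Q1) (r : ArrowRing Q1) (g : Q1 → ℤ) :
    (arrowVar b * r).coeff g = r.coeff (g - Pi.single b 1) := by
  rw [arrowVar, AddMonoidAlgebra.coeff_single_mul_apply, one_mul, neg_add_eq_sub]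

/-- Multiplication by `t_b w_k x` shifts `p` by `e` and `g` by one unit at `b`; after the
substitution the first shift is multiplication by a fixed monomial. -/
theorem kernelCoeff_binomial_mul [Finite Q0]
    {K : MvPowerSeries (Fin a) (MvPowerSeries (Vars β) (ArrowRing Q1))}
    (hK : SupportIn (arrowExponents (Fin a) (Vars β) Q1) K) (b : Q1) (x : Vars β) (k : Fin a)
    (g : Q1 → ℤ) : kernelCoeff i (binomial β (arrowVar b) x k * K) g = kernelCoeff i K g -
      mono (exponentWeight i a β (Finsupp.single k 1, Finsupp.single x 1)) *
        kernelCoeff i K (g - Pi.single b 1) := by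
  set e : (Fin a →₀ ℕ) × (Vars β →₀ ℕ) := (Finsupp.single k 1, Finsupp.single x 1) with he
  have h1 : bimonomial e (arrowVar b) * K = K - binomial β (arrowVar b) x k * K := by
    rw [binomial_eq]
    ring
  have hM : SupportIn (arrowExponents (Fin a) (Vars β) Q1) (bimonomial e (arrowVar b) * K) := by
    rw [h1]
    exact hK.sub ((supportIn_binomial_arrowVar b x k).mul hK)
  have h2 : ∑ᶠ p, (bicoeff p (bimonomial e (arrowVar b) * K)).coeff g •
      mono (exponentWeight i a β p) =
      mono (exponentWeight i a β e) * kernelCoeff i K (g - Pi.single b 1) := by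
    refine (finsum_bimonomial_mul (fun p => coeffSmulMono g (exponentWeight i a β p)) e _ K).trans ?_
    have h3 := (AddMonoidHom.mulLeft (mono (exponentWeight i a β e))).map_finsum
      (hasFiniteSupport_kernelCoeff i hK (g - Pi.single b 1))
    refine Eq.trans (finsum_congr fun p => ?_) h3.symm
    rw [coeffSmulMono_apply, coeff_arrowVar_mul, map_add, add_comm, ← mono_mul]
    exact (mul_smul_comm _ _ _).symm
  rw [← h2, kernelCoeff, kernelCoeff, ← finsum_sub_distrib (hasFiniteSupport_kernelCoeff i hK g)
    (hasFiniteSupport_kernelCoeff i hM g)]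
  refine finsum_congr fun p => ?_
  rw [← sub_smul, ← Finsupp.sub_apply, ← AddMonoidAlgebra.coeff_sub, ← map_sub, h1, sub_sub_cancel]

theorem kernelCoeff_one (g : Q1 → ℤ) : kernelCoeff i
    (1 : MvPowerSeries (Fin a) (MvPowerSeries (Vars β) (ArrowRing Q1))) g =
      (1 : Completed Q1 fun j => (Pi.single i a : Q0 → ℕ) j + β j).coeff g := by
  classical
  rw [kernelCoeff, finsum_eq_single _ 0]
  · rw [bicoeff_one, if_pos rfl, map_zero, mono_zero, HahnSeries.coeff_one,
      AddMonoidAlgebra.one_def, AddMonoidAlgebra.coeff_single, Finsupp.single_apply]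
    by_cases h : g = 0
    · rw [if_pos h, if_pos h.symm, one_smul]
    · rw [if_neg h, if_neg (Ne.symm h), zero_smul]
  · intro p hp
    rw [bicoeff_one, if_neg hp, AddMonoidAlgebra.coeff_zero, Finsupp.zero_apply, zero_smul]

/-- Multiplication by `P` on series corresponds to multiplication by `P'` on Hahn series. -/
def KernelRelated (P : MvPowerSeries (Fin a) (MvPowerSeries (Vars β) (ArrowRing Q1)))
    (P' : Completed Q1 fun j => (Pi.single i a : Q0 → ℕ) j + β j) : Prop :=
  ∀ K H, SupportIn (arrowExponents (Fin a) (Vars β) Q1) K → (∀ g, H.coeff g = kernelCoeff i K g) →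
    SupportIn (arrowExponents (Fin a) (Vars β) Q1) (P * K) ∧
      ∀ g, (P' * H).coeff g = kernelCoeff i (P * K) g

theorem KernelRelated.prod {ι : Type*} (s : Finset ι)
    (P : ι → MvPowerSeries (Fin a) (MvPowerSeries (Vars β) (ArrowRing Q1)))
    (P' : ι → Completed Q1 fun j => (Pi.single i a : Q0 → ℕ) j + β j)
    (h : ∀ k, KernelRelated i (P k) (P' k)) :
    KernelRelated i (∏ k ∈ s, P k) (∏ k ∈ s, P' k) := by
  refine Finset.prod_hom_rel (r := KernelRelated i) ?_ ?_
  · intro K H hK hH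
    rw [one_mul, one_mul]
    exact ⟨hK, hH⟩
  · intro k p p' hp K H hK hH
    rw [mul_assoc, mul_assoc]
    exact h k _ _ (hp K H hK hH).1 (hp K H hK hH).2

theorem kernelRelated_binomial [Finite Q0] (b : Q1) (x : Vars β) (k : Fin a) :
    KernelRelated i (binomial β (arrowVar b) x k) (1 - arrowMonomial b
      (exponentWeight i a β (Finsupp.single k 1, Finsupp.single x 1))) := by
  intro K H hK hH
  refine ⟨(supportIn_binomial_arrowVar b x k).mul hK, fun g => ?_⟩
  rw [sub_mul, one_mul, HahnSeries.coeff_sub, arrowMonomial, HahnSeries.coeff_single_mul, hH, hH,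
    kernelCoeff_binomial_mul i hK]

theorem prod_vertex_eq_ite {M : Type*} [CommMonoid M]
    (f : (j : Q0) → Fin ((Pi.single i a : Q0 → ℕ) j) → M) (j : Q0) :
    ∏ k, f j k = if j = i then ∏ k : Fin a, f i (vertexIndex i a k) else 1 := by
  split_ifs with h
  · subst h
    exact (Equiv.prod_comp (vertexIndex j a) (f j)).symm
  · have : IsEmpty (Fin ((Pi.single i a : Q0 → ℕ) j)) := by
      rw [Pi.single_eq_of_ne h]; infer_instance
    exact Finset.prod_of_isEmpty _

/-- The factor `∏_l (1 - t_b x_k^{(j)} / v_l^{(hb)})` of `shuffleDenominator`. -/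
def arrowFactor (a : ℕ) (β : Q0 → ℕ) (hd : Q1 → Q0) (b : Q1) (j : Q0)
    (k : Fin ((Pi.single i a : Q0 → ℕ) j)) :
    Completed Q1 fun j => (Pi.single i a : Q0 → ℕ) j + β j :=
  ∏ l : Fin (β (hd b)), (1 - arrowMonomial b (eps j (Fin.castAdd (β j) k) -
    eps (hd b) (Fin.natAdd ((Pi.single i a : Q0 → ℕ) (hd b)) l)))

theorem arrowFactor_vertexIndex (hd : Q1 → Q0) (b : Q1) (k : Fin a) :
    arrowFactor i a β hd b i (vertexIndex i a k) = ∏ l : Fin (β (hd b)), (1 - arrowMonomial b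
      (exponentWeight i a β (Finsupp.single k 1, Finsupp.single ⟨hd b, l⟩ 1))) := by
  refine Finset.prod_congr rfl fun l _ => ?_
  have h : eps i (Fin.castAdd (β i) (vertexIndex i a k)) -
      eps (hd b) (Fin.natAdd ((Pi.single i a : Q0 → ℕ) (hd b)) l) =
      exponentWeight i a β (Finsupp.single k 1, Finsupp.single ⟨hd b, l⟩ 1) := by
    rw [exponentWeight_single, ← appendWeight_eps_left, ← appendWeight_eps_right, ← map_sub,
      Prod.mk_sub_mk, zero_sub, sub_zero]
  rw [h]

/-- The denominator of the shuffle kernel. -/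
def shuffleDenominator (tl hd : Q1 → Q0) (α β : Q0 → ℕ) : Completed Q1 fun j => α j + β j :=
  ∏ b : Q1, ∏ k : Fin (α (tl b)), ∏ l : Fin (β (hd b)), (1 - arrowMonomial b
    (eps (tl b) (Fin.castAdd (β (tl b)) k) - eps (hd b) (Fin.natAdd (α (hd b)) l)))

theorem shuffleKernel_mul_shuffleDenominator (tl hd : Q1 → Q0) (α β : Q0 → ℕ) :
    shuffleKernel tl hd α β * shuffleDenominator tl hd α β = 1 := by
  rw [shuffleKernel, shuffleDenominator, ← Finset.prod_mul_distrib]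
  refine Finset.prod_eq_one fun b _ => ?_
  rw [← Finset.prod_mul_distrib]
  refine Finset.prod_eq_one fun k _ => ?_
  rw [← Finset.prod_mul_distrib]
  exact Finset.prod_eq_one fun l _ => Ring.inverse_mul_cancel _ (isUnit_one_sub_arrowMonomial _ _)

theorem shuffleKernel_mul (tl hd : Q1 → Q0) : shuffleKernel tl hd (Pi.single i a) β *
    ∏ b : Q1 with tl b = i, ∏ k : Fin a, ∏ l : Fin (β (hd b)), (1 - arrowMonomial b
      (exponentWeight i a β (Finsupp.single k 1, Finsupp.single ⟨hd b, l⟩ 1))) = 1 := by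
  simp only [← arrowFactor_vertexIndex]
  rw [Finset.prod_filter]
  refine Eq.trans (congrArg (_ * ·) (Finset.prod_congr rfl fun b _ => ?_))
    (shuffleKernel_mul_shuffleDenominator tl hd (Pi.single i a) β)
  exact (prod_vertex_eq_ite i (arrowFactor i a β hd b) (tl b)).symm

/-- The substituted `outSeries` is inverse to `∏ (1 - t_b u_k / v_l)`, because `outSeries` is
inverse to `∏ (1 - t_b w_k x_l)`. The kernel is inverse to the same product, and inverses are
unique. -/
theorem coeff_shuffleKernel [Fintype Q0] (tl hd : Q1 → Q0) (g : Q1 → ℤ) :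
    (shuffleKernel tl hd (Pi.single i a) β).coeff g =
      kernelCoeff i (outSeries β tl hd i a) g := by
  obtain ⟨H, hH⟩ := exists_kernelSeries i (supportIn_outSeries (n := β) tl hd i a)
  have h := (KernelRelated.prod i (Finset.univ.filter fun b : Q1 => tl b = i) _ _ fun b =>
    KernelRelated.prod i Finset.univ _ _ fun k : Fin a => KernelRelated.prod i Finset.univ _ _
      fun l : Fin (β (hd b)) => kernelRelated_binomial i b ⟨hd b, l⟩ k) _ H
      (supportIn_outSeries tl hd i a) hH
  rw [mul_comm _ (outSeries β tl hd i a), outSeries_mul] at h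
  have h1 : _ * H = 1 := HahnSeries.ext (funext fun g => (h.2 g).trans (kernelCoeff_one i g))
  rw [left_inv_eq_right_inv (shuffleKernel_mul i tl hd) h1, hH]

end Kernel

/-! ### Pairing series with Laurent polynomials -/

section PairingSum

variable {Q0 Q1 : Type*} [Fintype Q0] [DecidableEq Q0] {β : Q0 → ℕ}

theorem finite_sub_expWeight_nonneg (δ : Weight β) :
    {m : Vars β →₀ ℕ | ∀ j k, 0 ≤ (δ - expWeight m) j k}.Finite := by
  refine (Finsupp.finite_of_degree_le (∑ x : Vars β, (δ x.1 x.2).toNat)).subset fun m hm => ?_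
  change m.degree ≤ _
  rw [Finsupp.degree_eq_sum]
  refine Finset.sum_le_sum fun x _ => ?_
  have h : 0 ≤ δ x.1 x.2 - (m x : ℤ) := hm x.1 x.2
  omega

theorem exists_nonneg_of_completePairing_ne_zero {γ : Weight β} {f : TorusRing β}
    (h : completePairing Q1 γ f ≠ 0) : ∃ δ ∈ f.coeff.support, ∀ j k, 0 ≤ (γ - δ) j k := by
  by_contra! h1
  refine h ?_
  rw [completePairing_apply]
  refine Finset.sum_eq_zero fun δ hδ => ?_
  obtain ⟨j, k, hjk⟩ := h1 δ hδ
  exact (congrArg _ (completeProd_eq_zero hjk)).trans (smul_zero _)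

variable (i : Q0) {a : ℕ} (γ : Weight fun j => (Pi.single i a : Q0 → ℕ) j + β j)

/-- The pairing of a series in `w = u` and `x = v⁻¹` with a Laurent polynomial. -/
def pairingSum (K : MvPowerSeries (Fin a) (MvPowerSeries (Vars β) (ArrowRing Q1)))
    (f : TorusRing fun j => (Pi.single i a : Q0 → ℕ) j + β j) : QSym Q0 Q1 :=
  ∑ᶠ p, bicoeff p K • completePairing Q1 (γ + exponentWeight i a β p) f

/-- A nonzero pairing requires nonnegative entries for one of the finitely many monomials of `f`.
The entries at `v` bound `m` from above, and homogeneity then bounds `q`. -/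
theorem hasFiniteSupport_pairingSum
    {K : MvPowerSeries (Fin a) (MvPowerSeries (Vars β) (ArrowRing Q1))}
    (hK : SupportIn (homogeneousExponents (Fin a) (Vars β) Q1) K)
    (f : TorusRing fun j => (Pi.single i a : Q0 → ℕ) j + β j) :
    Function.HasFiniteSupport fun p =>
      bicoeff p K • completePairing Q1 (γ + exponentWeight i a β p) f := by
  have h1 : (⋃ δ ∈ f.coeff.support, {m : Vars β →₀ ℕ | ∀ j k,
      0 ≤ ((fun j k => (γ - δ) j (Fin.natAdd _ k) : Weight β) - expWeight m) j k}).Finite :=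
    Set.Finite.biUnion f.coeff.support.finite_toSet fun δ _ => finite_sub_expWeight_nonneg _
  have h2 : (⋃ m ∈ h1.toFinset, {p : (Fin a →₀ ℕ) × (Vars β →₀ ℕ) |
      p.1.degree = m.degree ∧ p.2 = m}).Finite := by
    refine Set.Finite.biUnion (Finset.finite_toSet _) fun m _ => ?_
    exact ((Finsupp.finite_of_degree_eq m.degree).prod (Set.finite_singleton m)).subset
      fun p hp => hp
  refine h2.subset fun p hp => ?_
  have hp1 : bicoeff p K ≠ 0 := fun h => hp (by simp only [h, zero_smul])
  have hp2 : completePairing Q1 (γ + exponentWeight i a β p) f ≠ 0 := fun h =>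
    hp (by simp only [h, smul_zero])
  obtain ⟨g, hg⟩ : ∃ g, (bicoeff p K).coeff g ≠ 0 := by
    by_contra! h
    exact hp1 (AddMonoidAlgebra.ext (Finsupp.ext h))
  obtain ⟨δ, hδ, hnn⟩ := exists_nonneg_of_completePairing_ne_zero hp2
  refine Set.mem_biUnion (x := p.2) ?_ ⟨hK p g hg, rfl⟩
  refine h1.mem_toFinset.mpr (Set.mem_biUnion hδ fun j k => ?_)
  have h3 := hnn j (Fin.natAdd _ k)
  rw [Pi.sub_apply, Pi.sub_apply, Pi.add_apply, Pi.add_apply, exponentWeight_apply,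
    appendWeight_natAdd] at h3
  rw [Pi.sub_apply, Pi.sub_apply, Pi.sub_apply, Pi.sub_apply]
  have h4 : (-expWeight p.2) j k = -(expWeight p.2 j k) := rfl
  omega

theorem pairingSum_add_left
    {K K' : MvPowerSeries (Fin a) (MvPowerSeries (Vars β) (ArrowRing Q1))}
    (hK : SupportIn (homogeneousExponents (Fin a) (Vars β) Q1) K)
    (hK' : SupportIn (homogeneousExponents (Fin a) (Vars β) Q1) K')
    (f : TorusRing fun j => (Pi.single i a : Q0 → ℕ) j + β j) :
    pairingSum i γ (K + K') f = pairingSum i γ K f + pairingSum i γ K' f := by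
  refine Eq.trans (finsum_congr fun p => ?_) (finsum_add_distrib
    (hasFiniteSupport_pairingSum i γ hK f) (hasFiniteSupport_pairingSum i γ hK' f))
  rw [map_add, add_smul]

theorem pairingSum_add_right
    {K : MvPowerSeries (Fin a) (MvPowerSeries (Vars β) (ArrowRing Q1))}
    (hK : SupportIn (homogeneousExponents (Fin a) (Vars β) Q1) K)
    (f f' : TorusRing fun j => (Pi.single i a : Q0 → ℕ) j + β j) :
    pairingSum i γ K (f + f') = pairingSum i γ K f + pairingSum i γ K f' := by
  refine Eq.trans (finsum_congr fun p => ?_) (finsum_add_distrib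
    (hasFiniteSupport_pairingSum i γ hK f) (hasFiniteSupport_pairingSum i γ hK f'))
  rw [map_add, smul_add]

/-- Shifting the summation index by `e` translates the base weight, and the pairing converts this
into multiplication by `z^{-e}`, the quotient of a variable `v` by a variable `u`. -/
theorem pairingSum_binomial_mul
    {K : MvPowerSeries (Fin a) (MvPowerSeries (Vars β) (ArrowRing Q1))}
    (hK : SupportIn (homogeneousExponents (Fin a) (Vars β) Q1) K) (x : Vars β) (k : Fin a)
    (f : TorusRing fun j => (Pi.single i a : Q0 → ℕ) j + β j) :
    pairingSum i γ (binomial β 1 x k * K) f = pairingSum i γ K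
      ((1 - mono (-exponentWeight i a β (Finsupp.single k 1, Finsupp.single x 1))) * f) := by
  set e : (Fin a →₀ ℕ) × (Vars β →₀ ℕ) := (Finsupp.single k 1, Finsupp.single x 1) with he
  have h1 : bimonomial e (1 : ArrowRing Q1) * K = K - binomial β 1 x k * K := by
    rw [binomial_eq]
    ring
  have hM : SupportIn (homogeneousExponents (Fin a) (Vars β) Q1)
      (bimonomial e (1 : ArrowRing Q1) * K) := by
    rw [h1]
    exact hK.sub ((supportIn_binomial_one x k).mul hK)
  have h2 : pairingSum i γ (bimonomial e (1 : ArrowRing Q1) * K) f =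
      pairingSum i γ K (mono (-exponentWeight i a β e) * f) := by
    have h3 := finsum_bimonomial_mul
      (fun p => qsymSmulHom (completePairing Q1 (γ + exponentWeight i a β p) f)) e 1 K
    simp only [qsymSmulHom_apply] at h3
    refine h3.trans (finsum_congr fun p => ?_)
    rw [one_mul, completePairing_mono_mul, sub_neg_eq_add, map_add, add_assoc]
  have h3 := pairingSum_add_left i γ ((supportIn_binomial_one x k).mul hK) hM f
  have h4 := pairingSum_add_right i γ hK
    ((1 - mono (-exponentWeight i a β e)) * f) (mono (-exponentWeight i a β e) * f)
  rw [h1, add_sub_cancel, ← h1, h2] at h3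
  rw [← add_mul, sub_add_cancel, one_mul, h3] at h4
  have h5 := congrArg (tensorBasis Q0 Q1).repr h4
  rw [map_add, map_add] at h5
  exact (tensorBasis Q0 Q1).repr.injective (add_right_cancel h5)

/-- Multiplication of the series by `P` corresponds to multiplication of the Laurent polynomial
by `P'`. -/
def PairingRelated (P : MvPowerSeries (Fin a) (MvPowerSeries (Vars β) (ArrowRing Q1)))
    (P' : TorusRing fun j => (Pi.single i a : Q0 → ℕ) j + β j) : Prop :=
  ∀ K, SupportIn (homogeneousExponents (Fin a) (Vars β) Q1) K →
    SupportIn (homogeneousExponents (Fin a) (Vars β) Q1) (P * K) ∧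
      ∀ f, pairingSum i γ (P * K) f = pairingSum i γ K (P' * f)

theorem PairingRelated.prod {ι : Type*} (s : Finset ι)
    (P : ι → MvPowerSeries (Fin a) (MvPowerSeries (Vars β) (ArrowRing Q1)))
    (P' : ι → TorusRing fun j => (Pi.single i a : Q0 → ℕ) j + β j)
    (h : ∀ k, PairingRelated i γ (P k) (P' k)) :
    PairingRelated i γ (∏ k ∈ s, P k) (∏ k ∈ s, P' k) := by
  refine Finset.prod_hom_rel (r := PairingRelated i γ) ?_ ?_
  · intro K hK
    rw [one_mul]
    exact ⟨hK, fun f => by rw [one_mul]⟩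
  · intro k p p' hp K hK
    rw [mul_assoc]
    refine ⟨(h k _ (hp K hK).1).1, fun f => ?_⟩
    rw [(h k _ (hp K hK).1).2, (hp K hK).2, ← mul_assoc, mul_comm p']

theorem pairingSum_prod_binomial_mul
    {K : MvPowerSeries (Fin a) (MvPowerSeries (Vars β) (ArrowRing Q1))}
    (hK : SupportIn (homogeneousExponents (Fin a) (Vars β) Q1) K)
    (f : TorusRing fun j => (Pi.single i a : Q0 → ℕ) j + β j) :
    pairingSum i γ ((∏ k : Fin a, ∏ l : Fin (β i), binomial β 1 ⟨i, l⟩ k) * K) f =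
      pairingSum i γ K (crossFactor (Pi.single i a) β * f) := by
  have h := (PairingRelated.prod i γ Finset.univ _ _ fun k : Fin a => PairingRelated.prod i γ
    Finset.univ _ _ fun l : Fin (β i) => fun K hK =>
      ⟨(supportIn_binomial_one (⟨i, l⟩ : Vars β) k).mul hK,
        pairingSum_binomial_mul i γ hK (⟨i, l⟩ : Vars β) k⟩) K hK
  have h1 : (∏ k : Fin a, ∏ l : Fin (β i),
      (1 - mono (-exponentWeight i a β (Finsupp.single k 1, Finsupp.single ⟨i, l⟩ 1)))) =
      crossFactor (Pi.single i a) β := by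
    rw [crossFactor_single_vertex]
    refine Finset.prod_congr rfl fun k _ => Finset.prod_congr rfl fun l _ => ?_
    rw [exponentWeight_single, ← map_neg, Prod.neg_mk, neg_neg, vertexWeight_single]
  rw [← h1]
  exact h.2 f

end PairingSum

/-! ### The action of a current on a tensor Schur function -/

section Current

variable {Q0 Q1 : Type*} [Fintype Q0] [DecidableEq Q0]

theorem coeff_omega_one (i : Q0) (a : ℕ) (p : Fin a →₀ ℕ) :
    MvPowerSeries.coeff p (omega a (1 : ArrowRing Q1) i) =
      ∏ k, atVertex i (completeInt (ArrowRing Q1) (p k)) := by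
  have h : MvPowerSeries.coeff p (omega a (1 : ArrowRing Q1) i) =
      (1 : ArrowRing Q1) ^ p.degree • ∏ k, atVertex i (complete (ArrowRing Q1) (p k)) := rfl
  rw [h, one_pow, one_smul]
  simp only [completeInt_natCast]

theorem finite_raising {a : ℕ} (γ : Fin a → ℤ) :
    {p : Fin a →₀ ℕ | (raising a).coeff (fun k => γ k - p k) ≠ 0}.Finite := by
  refine Set.Finite.preimage (f := fun p : Fin a →₀ ℕ => fun k => γ k - p k) ?_
    (raising a).coeff.hasFiniteSupport
  intro p _ q _ h
  refine Finsupp.ext fun k => ?_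
  have := congrFun h k
  simp only at this
  omega

/-- The product of `R(U)` and `Ω[U X^{(i)}]`. -/
theorem finsum_raising_smul (i : Q0) {a : ℕ} (γ : Fin a → ℤ) :
    ∑ᶠ p : Fin a →₀ ℕ, ((raising a).coeff (fun k => γ k - p k) : ArrowRing Q1) •
      MvPowerSeries.coeff p (omega a (1 : ArrowRing Q1) i) =
      completePairing Q1 (vertexWeight i γ) (vertexRaising (Pi.single i a : Q0 → ℕ)) := by
  rw [← vertexTorus_raising, completePairing_vertexTorus]
  let H : (Fin a → ℤ) → QSym Q0 Q1 := fun κ => ∏ k, atVertex i (completeInt (ArrowRing Q1) (κ k))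
  let e : (Fin a →₀ ℕ) → Fin a → ℤ := fun p k => p k
  have he : Function.Injective e := fun p q h => Finsupp.ext fun k => by
    have h1 := congrFun h k
    exact Int.ofNat_inj.mp h1
  have h1 : ((raising a).coeff.sum fun δ c => (c : ArrowRing Q1) • H (γ - δ)) =
      ∑ᶠ δ, ((raising a).coeff δ : ArrowRing Q1) • H (γ - δ) := by
    refine (finsum_eq_sum_of_support_subset _ fun δ hδ => ?_).symm
    refine Finsupp.mem_support_iff.mpr fun h => hδ ?_
    simp only [h, Int.cast_zero, zero_smul]
  have h2 : ∑ᶠ δ, ((raising a).coeff δ : ArrowRing Q1) • H (γ - δ) =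
      ∑ᶠ κ, ((raising a).coeff (γ - κ) : ArrowRing Q1) • H κ := by
    rw [← finsum_comp_equiv (Equiv.subLeft γ)]
    refine finsum_congr fun κ => ?_
    rw [Equiv.subLeft_apply, sub_sub_cancel]
  -- Indices `κ` with a negative entry contribute `0`, so only the exponents of power series in `U`
  -- remain.
  have h3 : ∀ κ, ((raising a).coeff (γ - κ) : ArrowRing Q1) • H κ = ∑ᶠ _ : κ ∈ Set.range e,
      ((raising a).coeff (γ - κ) : ArrowRing Q1) • H κ := fun κ => by
    classical
    rw [finsum_eq_if]
    split_ifs with h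
    · rfl
    · have hκ : ∃ k, κ k < 0 := by
        by_contra! hκ
        refine h ⟨Finsupp.equivFunOnFinite.symm fun k => (κ k).toNat, funext fun k => ?_⟩
        exact Int.toNat_of_nonneg (hκ k)
      obtain ⟨k, hk⟩ := hκ
      have h0 : H κ = 0 := Finset.prod_eq_zero (Finset.mem_univ k) (by
        rw [completeInt_of_neg hk, atVertex, map_zero])
      rw [h0, smul_zero]
  refine Eq.trans ?_ (h1.trans (h2.trans ((finsum_congr h3).trans (finsum_mem_range he)))).symm
  refine finsum_congr fun p => ?_
  rw [coeff_omega_one]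
  rfl

variable [Fintype Q1] [DecidableEq Q1]

/-- The resulting Jacobi–Trudi elements are written as pairings with `R(V)`, so that they can be
merged with the `R(U)` of the current. -/
theorem perp_skewSeries (tl hd : Q1 → Q0) (i : Q0) {a : ℕ} {β : Q0 → ℕ} (ξ : Q0 → YoungDiagram)
    (hξ : ∀ j, (ξ j).colLen 0 ≤ β j) (q : Fin a →₀ ℕ) :
    perp (MvPowerSeries.coeff q (skewSeries tl hd i a)) (tensorSchur Q1 ξ) =
      ∑ m ∈ (finite_sub_expWeight_nonneg ((partitionWeight β ξ).1 + rho β)).toFinset,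
        bicoeff (q, m) ((∏ k : Fin a, ∏ l : Fin (β i), binomial β 1 ⟨i, l⟩ k) *
          outSeries β tl hd i a) •
          completePairing Q1 ((partitionWeight β ξ).1 - expWeight m) (vertexRaising β) := by
  rw [← vertexJacobiTrudi_partitionWeight ξ hξ, perp_vertexJacobiTrudi _ _ _ fun m hm =>
    (finite_sub_expWeight_nonneg ((partitionWeight β ξ).1 + rho β)).mem_toFinset.mpr hm]
  refine Finset.sum_congr rfl fun m _ => ?_
  rw [completePairing_vertexRaising, sub_add_eq_add_sub, ← map_eval_skewSeries, bicoeff_apply,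
    MvPowerSeries.coeff_map]
  rfl

/-- A nonzero skewing forces `|q| = |m|` for one of finitely many `m`; for fixed `q` the finitely
many terms of `R(U)` bound the other exponent. This permits summing in either order. -/
theorem finite_current_support (tl hd : Q1 → Q0) (i : Q0) {a : ℕ} (μ : Fin a → ℤ) {β : Q0 → ℕ}
    (ξ : Q0 → YoungDiagram) (hξ : ∀ j, (ξ j).colLen 0 ≤ β j) :
    {qp : (Fin a →₀ ℕ) × (Fin a →₀ ℕ) |
      (raising a).coeff (fun k => μ k - qp.2 k + qp.1 k) ≠ 0 ∧
      perp (MvPowerSeries.coeff qp.1 (skewSeries tl hd i a)) (tensorSchur Q1 ξ) ≠ 0}.Finite := by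
  set s := (finite_sub_expWeight_nonneg ((partitionWeight β ξ).1 + rho β)).toFinset
  have h1 : (⋃ m ∈ s, {q : Fin a →₀ ℕ | q.degree = m.degree}).Finite :=
    Set.Finite.biUnion s.finite_toSet fun m _ => Finsupp.finite_of_degree_eq _
  have h2 : (⋃ q ∈ h1.toFinset, (fun p => (q, p)) '' {p : Fin a →₀ ℕ |
      (raising a).coeff (fun k => (μ k + q k) - p k) ≠ 0}).Finite :=
    Set.Finite.biUnion (Finset.finite_toSet _) fun q _ => (finite_raising _).image _
  refine h2.subset fun qp hqp => ?_
  obtain ⟨hr, hp⟩ := hqp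
  refine Set.mem_biUnion (x := qp.1) ?_ ⟨qp.2, ?_, rfl⟩
  · refine h1.mem_toFinset.mpr ?_
    rw [perp_skewSeries tl hd i ξ hξ] at hp
    obtain ⟨m, hm, hne⟩ := Finset.exists_ne_zero_of_sum_ne_zero hp
    refine Set.mem_biUnion hm ?_
    by_contra hdeg
    refine hne ?_
    have h0 : bicoeff (qp.1, m) ((∏ k : Fin a, ∏ l : Fin (β i), binomial β 1 ⟨i, l⟩ k) *
          outSeries β tl hd i a) = 0 := by
      refine AddMonoidAlgebra.ext (Finsupp.ext fun g => ?_)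
      by_contra hg
      refine hdeg ?_
      have hS : SupportIn (homogeneousExponents (Fin a) (Vars β) Q1)
          ((∏ k : Fin a, ∏ l : Fin (β i), binomial β 1 ⟨i, l⟩ k) * outSeries β tl hd i a) :=
        (SupportIn.prod _ _ fun k _ => SupportIn.prod _ _ fun l _ =>
          supportIn_binomial_one _ _).mul ((supportIn_outSeries tl hd i a).mono
            (arrowExponents_le _ _ _))
      exact hS (qp.1, m) g hg
    rw [h0, zero_smul]
  · have h3 : (fun k => μ k + qp.1 k - qp.2 k) = fun k => μ k - qp.2 k + qp.1 k :=
      funext fun k => by ring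
    change (raising a).coeff (fun k => μ k + qp.1 k - qp.2 k) ≠ 0
    rw [h3]
    exact hr

theorem current_eq_finsum (tl hd : Q1 → Q0) (i : Q0) {a : ℕ} (μ : Fin a → ℤ) {β : Q0 → ℕ}
    (ξ : Q0 → YoungDiagram) (hξ : ∀ j, (ξ j).colLen 0 ≤ β j) :
    current tl hd i μ (tensorSchur Q1 ξ) = ∑ᶠ q : Fin a →₀ ℕ,
      completePairing Q1 (vertexWeight i fun k => μ k + q k) (vertexRaising (Pi.single i a)) *
        perp (MvPowerSeries.coeff q (skewSeries tl hd i a)) (tensorSchur Q1 ξ) := by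
  have h1 : current tl hd i μ (tensorSchur Q1 ξ) =
      ∑ᶠ qp : (Fin a →₀ ℕ) × (Fin a →₀ ℕ),
        ((raising a).coeff (fun k => (μ k + qp.1 k) - qp.2 k) : ArrowRing Q1) •
        (MvPowerSeries.coeff qp.2 (omega a (1 : ArrowRing Q1) i) *
          perp (MvPowerSeries.coeff qp.1 (skewSeries tl hd i a)) (tensorSchur Q1 ξ)) := by
    rw [current, ← finsum_comp_equiv (Equiv.prodComm _ _)]
    refine finsum_congr fun qp => ?_
    rw [qsym_zsmul_eq]
    have h3 : (fun k => μ k + qp.1 k - qp.2 k) = fun k => μ k - qp.2 k + qp.1 k :=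
      funext fun k => by ring
    rw [h3]
    rfl
  rw [h1, finsum_curry]
  · refine finsum_congr fun q => ?_
    rw [← finsum_raising_smul]
    have h2 := (AddMonoidHom.mulRight (perp (MvPowerSeries.coeff q (skewSeries tl hd i a))
      (tensorSchur Q1 ξ))).map_finsum (f := fun p : Fin a →₀ ℕ =>
        ((raising a).coeff (fun k => (μ k + q k) - p k) : ArrowRing Q1) •
          MvPowerSeries.coeff p (omega a (1 : ArrowRing Q1) i))
      ((finite_raising fun k => μ k + q k).subset fun p hp h => hp (by simp only [h, Int.cast_zero, zero_smul]))
    refine Eq.trans (finsum_congr fun p => ?_) h2.symm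
    exact (qsym_smul_mul _ _ _).symm
  · refine (finite_current_support tl hd i μ ξ hξ).subset fun qp hqp => ⟨fun h => hqp ?_, fun h => hqp ?_⟩
    · have h3 : (fun k => μ k + qp.1 k - qp.2 k) = fun k => μ k - qp.2 k + qp.1 k :=
        funext fun k => by ring
      simp only [h3, h, Int.cast_zero, zero_smul]
    · simp only [h, mul_zero, smul_zero]

/-- The weight of `u^μ v^ξ`. -/
def startWeight (i : Q0) {a : ℕ} (μ : Fin a → ℤ) (β : Q0 → ℕ) (ξ : Q0 → YoungDiagram) :
    Weight fun j => (Pi.single i a : Q0 → ℕ) j + β j :=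
  appendWeight (Pi.single i a) β (vertexWeight i μ, (partitionWeight β ξ).1)

theorem startWeight_add (i : Q0) {a : ℕ} (μ : Fin a → ℤ) (β : Q0 → ℕ) (ξ : Q0 → YoungDiagram)
    (p : (Fin a →₀ ℕ) × (Vars β →₀ ℕ)) : startWeight i μ β ξ + exponentWeight i a β p =
      appendWeight (Pi.single i a) β (vertexWeight i fun k => μ k + p.1 k,
        (partitionWeight β ξ).1 - expWeight p.2) := by
  rw [startWeight, exponentWeight_apply, ← map_add, Prod.mk_add_mk, ← sub_eq_add_neg]
  refine congrArg (fun γ => appendWeight (Pi.single i a) β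
    (γ, (partitionWeight β ξ).1 - expWeight p.2)) ?_
  exact (map_add (vertexWeightHom i a) μ fun k => (p.1 k : ℤ)).symm

/-- Splitting `R(U + V)` and moving its mixed factor into the series restores `∏ (1 - w_k
x_l^{(i)})`, hence the evaluated skewing series. Each remaining pairing is a product of one
determinant in `u` and one in `v`. -/
theorem current_eq_pairingSum (tl hd : Q1 → Q0) (i : Q0) {a : ℕ} (μ : Fin a → ℤ) {β : Q0 → ℕ}
    (ξ : Q0 → YoungDiagram) (hξ : ∀ j, (ξ j).colLen 0 ≤ β j) :
    current tl hd i μ (tensorSchur Q1 ξ) = pairingSum i (startWeight i μ β ξ)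
      (outSeries β tl hd i a) (vertexRaising fun j => (Pi.single i a : Q0 → ℕ) j + β j) := by
  have hK : SupportIn (homogeneousExponents (Fin a) (Vars β) Q1) (outSeries β tl hd i a) :=
    (supportIn_outSeries tl hd i a).mono (arrowExponents_le _ _ _)
  have hS : SupportIn (homogeneousExponents (Fin a) (Vars β) Q1)
      ((∏ k : Fin a, ∏ l : Fin (β i), binomial β 1 ⟨i, l⟩ k) * outSeries β tl hd i a) :=
    (SupportIn.prod _ _ fun k _ => SupportIn.prod _ _ fun l _ =>
      supportIn_binomial_one _ _).mul hK
  rw [vertexRaising_add, ← pairingSum_prod_binomial_mul i _ hK, pairingSum,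
    finsum_curry _ (hasFiniteSupport_pairingSum i _ hS _), current_eq_finsum tl hd i μ ξ hξ]
  refine finsum_congr fun q => ?_
  rw [perp_skewSeries tl hd i ξ hξ, Finset.mul_sum]
  refine Eq.trans (Finset.sum_congr rfl fun m _ => ?_)
    (finsum_eq_sum_of_support_subset _ fun m hm => ?_).symm
  · rw [startWeight_add, completePairing_appendWeight]
    exact qsym_mul_smul _ _ _
  -- Outside the finite set, `ξ + ρ - m` has a negative entry, so the determinant in `v` is zero.
  · by_contra hm'
    refine hm ?_
    have h1 : ¬ ∀ j k, 0 ≤ ((partitionWeight β ξ).1 + rho β - expWeight m) j k := fun h =>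
      hm' (Set.Finite.mem_toFinset _ |>.mpr h)
    push Not at h1
    obtain ⟨j, k, hjk⟩ := h1
    simp only [startWeight_add, completePairing_appendWeight]
    rw [completePairing_vertexRaising (_ - expWeight m), sub_add_eq_add_sub,
      vertexJacobiTrudi_eq_zero hjk, mul_zero, smul_zero]

/-- The coefficients of a current acting on a tensor Schur function. -/
theorem coeff_repr_current (tl hd : Q1 → Q0) (i : Q0) {a : ℕ} (μ : Fin a → ℤ) {β : Q0 → ℕ}
    (ξ : Q0 → YoungDiagram) (hξ : ∀ j, (ξ j).colLen 0 ≤ β j) (lam : Q0 → YoungDiagram)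
    (g : Q1 → ℤ) (hlam : ∀ j, (lam j).colLen 0 ≤ (Pi.single i a : Q0 → ℕ) j + β j) :
    ((tensorBasis Q0 Q1).repr (current tl hd i μ (tensorSchur Q1 ξ)) lam).coeff g =
      ∑ᶠ p, (bicoeff p (outSeries β tl hd i a)).coeff g *
        altCoeff (startWeight i μ β ξ + exponentWeight i a β p + rho _)
          ((partitionWeight _ lam).1 + rho _) := by
  have hK : SupportIn (homogeneousExponents (Fin a) (Vars β) Q1) (outSeries β tl hd i a) :=
    (supportIn_outSeries tl hd i a).mono (arrowExponents_le _ _ _)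
  let φ : QSym Q0 Q1 →+ ℤ :=
    { toFun := fun F => ((tensorBasis Q0 Q1).repr F lam).coeff g
      map_zero' := by rw [map_zero, Finsupp.zero_apply, AddMonoidAlgebra.coeff_zero,
        Finsupp.zero_apply]
      map_add' := fun F G => by rw [map_add, Finsupp.add_apply, AddMonoidAlgebra.coeff_add,
        Finsupp.add_apply] }
  have h := φ.map_finsum (hasFiniteSupport_pairingSum i (startWeight i μ β ξ) hK
    (vertexRaising fun j => (Pi.single i a : Q0 → ℕ) j + β j))
  rw [current_eq_pairingSum tl hd i μ ξ hξ]
  refine h.trans (finsum_congr fun p => ?_)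
  change ((tensorBasis Q0 Q1).repr (_ • _) lam).coeff g = _
  rw [map_smul, Finsupp.smul_apply, completePairing_vertexRaising, repr_vertexJacobiTrudi,
    if_pos hlam, smul_eq_mul, mul_comm, ← zsmul_eq_mul, AddMonoidAlgebra.coeff_smul,
    Finsupp.smul_apply, smul_eq_mul, mul_comm]

theorem repr_current_eq_zero (tl hd : Q1 → Q0) (i : Q0) {a : ℕ} (μ : Fin a → ℤ) {β : Q0 → ℕ}
    (ξ : Q0 → YoungDiagram) (hξ : ∀ j, (ξ j).colLen 0 ≤ β j) (lam : Q0 → YoungDiagram)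
    (hlam : ¬ ∀ j, (lam j).colLen 0 ≤ (Pi.single i a : Q0 → ℕ) j + β j) :
    (tensorBasis Q0 Q1).repr (current tl hd i μ (tensorSchur Q1 ξ)) lam = 0 := by
  have hK : SupportIn (homogeneousExponents (Fin a) (Vars β) Q1) (outSeries β tl hd i a) :=
    (supportIn_outSeries tl hd i a).mono (arrowExponents_le _ _ _)
  have h := ((Finsupp.applyAddHom lam).comp
    (tensorBasis Q0 Q1).repr.toLinearMap.toAddMonoidHom).map_finsum
      (hasFiniteSupport_pairingSum i (startWeight i μ β ξ) hK
        (vertexRaising fun j => (Pi.single i a : Q0 → ℕ) j + β j))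
  rw [current_eq_pairingSum tl hd i μ ξ hξ]
  refine h.trans (finsum_eq_zero_of_forall_eq_zero fun p => ?_)
  change (tensorBasis Q0 Q1).repr (_ • _) lam = _
  rw [map_smul, Finsupp.smul_apply, completePairing_vertexRaising, repr_vertexJacobiTrudi,
    if_neg hlam, smul_zero]

end Current

/-! ### Schur expansions of completed Laurent polynomials -/

section SchurExpansion

variable {Q0 Q1 : Type*} [Fintype Q0] [DecidableEq Q0] {ν : Q0 → ℕ}

theorem coeff_antisymmetrizeSeries (F : Completed Q1 ν) (g : Q1 → ℤ) :
    (antisymmetrizeSeries F).coeff g = antisymmetrize (F.coeff g) := by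
  rw [antisymmetrizeSeries, HahnSeries.coeff_sum]
  rfl

theorem antisymmetrizeSeries_C (f : TorusRing ν) :
    antisymmetrizeSeries (HahnSeries.C f : Completed Q1 ν) = HahnSeries.C (antisymmetrize f) := by
  classical
  ext g : 2
  rw [coeff_antisymmetrizeSeries, HahnSeries.C_apply, HahnSeries.C_apply, HahnSeries.coeff_single,
    HahnSeries.coeff_single]
  split_ifs
  · rfl
  · exact map_zero (antisymmetrizeHom ν)

theorem coeff_C_mul (f : TorusRing ν) (F : Completed Q1 ν) (g : Q1 → ℤ) :
    (HahnSeries.C f * F).coeff g = f * F.coeff g := by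
  rw [HahnSeries.C_mul_eq_smul, HahnSeries.coeff_smul, smul_eq_mul]

/-- The defining equation of the Demazure operator. -/
theorem antisymmetrize_mul_coeff_demazure (F : Completed Q1 ν) (g : Q1 → ℤ) :
    antisymmetrize (mono (rho ν)) * (demazure F).coeff g =
      antisymmetrize (mono (rho ν) * F.coeff g) := by
  let b : TorusRing ν := antisymmetrize (mono (rho ν))
  let A : Completed Q1 ν := antisymmetrizeSeries (HahnSeries.C (mono (rho ν)) * F)
  have hA : ∀ g, A.coeff g = antisymmetrize (mono (rho ν) * F.coeff g) := fun g => by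
    rw [coeff_antisymmetrizeSeries, coeff_C_mul]
  have hb : ∀ g, b * exactQuot (A.coeff g) b = A.coeff g := fun g =>
    mul_exactQuot (by rw [hA]; exact antisymmetrize_dvd _)
  -- The denominator does not involve the arrow variables, so the quotient is taken coefficientwise;
  -- since the denominator is not a zero divisor, the support does not grow.
  let Q : Completed Q1 ν := ⟨fun g => exactQuot (A.coeff g) b, A.isPWO_support.mono fun g hg h => by
    have h1 := hb g
    rw [h] at h1
    refine hg ?_
    change exactQuot (A.coeff g) b = 0
    rw [h]
    exact ((mul_eq_zero.mp h1).resolve_left antisymmetrize_mono_rho_ne_zero)⟩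
  have hdvd : HahnSeries.C b ∣ A := ⟨Q, by
    ext g : 2
    rw [coeff_C_mul]
    exact (hb g).symm⟩
  have h := mul_exactQuot hdvd
  rw [← hA, ← h, ← coeff_C_mul, demazure, antisymmetrizeSeries_C]

/-- The coefficient of `x^δ` as an additive map. -/
def torusCoeffHom (δ : Weight ν) : TorusRing ν →+ ℤ :=
  (Finsupp.applyAddHom δ).comp AddMonoidAlgebra.coeffAddEquiv.toAddMonoidHom

theorem torusCoeffHom_apply (δ : Weight ν) (f : TorusRing ν) : torusCoeffHom δ f = f.coeff δ := rfl

/-- The coefficient of a Schur polynomial in the image of the Demazure operator. -/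
def demazureCoeff (F : Completed Q1 ν) (lam : DominantWeight ν) : HahnSeries (Q1 → ℤ) ℤ :=
  F.map ((torusCoeffHom (lam.1 + rho ν)).comp
    ((antisymmetrizeHom ν).comp (AddMonoidHom.mulLeft (mono (rho ν)))))

theorem coeff_demazureCoeff (F : Completed Q1 ν) (lam : DominantWeight ν) (g : Q1 → ℤ) :
    (demazureCoeff F lam).coeff g =
      (antisymmetrize (mono (rho ν) * F.coeff g)).coeff (lam.1 + rho ν) := rfl

/-- Multiplication of a Schur expansion by the denominator. -/
theorem antisymmetrize_mul_finsum (c : DominantWeight ν → ℤ) (hc : {lam | c lam ≠ 0}.Finite) :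
    antisymmetrize (mono (rho ν)) * ∑ᶠ lam, c lam • schurPoly lam.1 =
      ∑ᶠ lam : DominantWeight ν, c lam • antisymmetrize (mono (lam.1 + rho ν)) := by
  have h := (AddMonoidHom.mulLeft (antisymmetrize (mono (rho ν)))).map_finsum
    (f := fun lam : DominantWeight ν => c lam • schurPoly lam.1)
    (hc.subset fun lam h h0 => h (by simp only [h0, zero_smul]))
  refine h.trans (finsum_congr fun lam => ?_)
  rw [← antisymmetrize_mul_schurPoly]
  exact mul_smul_comm _ _ _

theorem coeff_finsum_antisymmetrize (c : DominantWeight ν → ℤ) (hc : {lam | c lam ≠ 0}.Finite)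
    (mu : DominantWeight ν) :
    (∑ᶠ lam : DominantWeight ν, c lam • antisymmetrize (mono (lam.1 + rho ν))).coeff
      (mu.1 + rho ν) = c mu := by
  classical
  have h := (torusCoeffHom (mu.1 + rho ν)).map_finsum
    (f := fun lam : DominantWeight ν => c lam • antisymmetrize (mono (lam.1 + rho ν)))
    (hc.subset fun lam h h0 => h (by simp only [h0, zero_smul]))
  refine h.trans ?_
  simp only [torusCoeffHom_apply, coeff_zsmul_torus, coeff_antisymmetrize_mono, altCoeff_add_rho]
  rw [finsum_eq_single _ mu]
  · rw [if_pos rfl, mul_one]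
  · intro lam h
    rw [if_neg h.symm, mul_zero]

/-- Multiplying by `J(z^ρ)` turns a Schur expansion into an expansion in alternants, which exists
for every antisymmetric polynomial and is determined by the coefficients at `λ + ρ`. -/
theorem isSchurExpansion_demazure_iff (F : Completed Q1 ν)
    (d : DominantWeight ν → HahnSeries (Q1 → ℤ) ℤ) :
    IsSchurExpansion (demazure F) d ↔ d = demazureCoeff F := by
  constructor
  · intro h
    funext mu
    ext g : 2
    obtain ⟨h1, h2⟩ := h g
    rw [coeff_demazureCoeff, ← antisymmetrize_mul_coeff_demazure, h2,
      antisymmetrize_mul_finsum _ h1, coeff_finsum_antisymmetrize _ h1]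
  · rintro rfl g
    obtain ⟨h1, h2⟩ := antisymmetrize_eq_finsum (mono (rho ν) * F.coeff g)
    refine ⟨h1, mul_left_cancel₀ antisymmetrize_mono_rho_ne_zero ?_⟩
    rw [antisymmetrize_mul_coeff_demazure]
    exact h2.trans (antisymmetrize_mul_finsum _ h1).symm

end SchurExpansion

/-! ### Symmetrization over the variables `u` and `v` separately -/

section Levi

variable {Q0 Q1 : Type*} {α β : Q0 → ℕ}

/-- The permutations of the variables `u` and `v` at each vertex. -/
def leviPerm (w : VertexPerm α × VertexPerm β) : VertexPerm fun j => α j + β j :=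
  fun j => finSumFinEquiv.permCongr (Equiv.Perm.sumCongr (w.1 j) (w.2 j))

theorem leviPerm_symm_castAdd (w : VertexPerm α × VertexPerm β) (j : Q0) (k : Fin (α j)) :
    (leviPerm w j).symm (Fin.castAdd (β j) k) = Fin.castAdd (β j) ((w.1 j).symm k) := by
  rw [Equiv.symm_apply_eq]
  simp [leviPerm, Equiv.permCongr_apply]

theorem leviPerm_symm_natAdd (w : VertexPerm α × VertexPerm β) (j : Q0) (l : Fin (β j)) :
    (leviPerm w j).symm (Fin.natAdd (α j) l) = Fin.natAdd (α j) ((w.2 j).symm l) := by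
  rw [Equiv.symm_apply_eq]
  simp [leviPerm, Equiv.permCongr_apply]

theorem permWeight_leviPerm (w : VertexPerm α × VertexPerm β) (γ : Weight α) (δ : Weight β) :
    permWeight (leviPerm w) (appendWeight α β (γ, δ)) =
      appendWeight α β (permWeight w.1 γ, permWeight w.2 δ) := by
  funext j k
  refine Fin.addCases (fun k => ?_) (fun k => ?_) k
  · rw [permWeight_apply, leviPerm_symm_castAdd, appendWeight_castAdd, appendWeight_castAdd,
      permWeight_apply]
  · rw [permWeight_apply, leviPerm_symm_natAdd, appendWeight_natAdd, appendWeight_natAdd,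
      permWeight_apply]

theorem permute_inclU (w : VertexPerm α × VertexPerm β) (f : TorusRing α) :
    permute (leviPerm w) (inclU α β f) = inclU α β (permute w.1 f) := by
  induction f using torus_induction with
  | hm γ => rw [inclU_mono, permute_mono, permWeight_leviPerm, permute_mono, inclU_mono, map_zero]
  | ha f g hf hg => simp only [map_add, hf, hg]
  | hn f hf => simp only [map_neg, hf]
  | h0 => simp only [map_zero]

theorem permute_inclV (w : VertexPerm α × VertexPerm β) (f : TorusRing β) :
    permute (leviPerm w) (inclV α β f) = inclV α β (permute w.2 f) := by
  induction f using torus_induction with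
  | hm γ => rw [inclV_mono, permute_mono, permWeight_leviPerm, permute_mono, inclV_mono, map_zero]
  | ha f g hf hg => simp only [map_add, hf, hg]
  | hn f hf => simp only [map_neg, hf]
  | h0 => simp only [map_zero]

variable [Fintype Q0]

theorem vertexSign_leviPerm (w : VertexPerm α × VertexPerm β) :
    vertexSign (leviPerm w) = vertexSign w.1 * vertexSign w.2 := by
  rw [vertexSign, vertexSign, vertexSign, ← Finset.prod_mul_distrib]
  refine Finset.prod_congr rfl fun j _ => ?_
  rw [leviPerm, Equiv.Perm.sign_permCongr, Equiv.Perm.sign_sumCongr, Units.val_mul]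

variable [DecidableEq Q0]

/-- The full antisymmetrizer absorbs a permutation of `u` and `v` up to its sign, so all terms of
the inner antisymmetrizers contribute equally. Consequently `f` and `f'` matter only through their
own antisymmetrizations, once the group order is cancelled over `ℤ`. -/
theorem card_smul_antisymmetrize_levi (f : TorusRing α) (f' : TorusRing β)
    (k : TorusRing fun j => α j + β j)
    (hk : ∀ w : VertexPerm α × VertexPerm β, permute (leviPerm w) k = k) :
    (Fintype.card (VertexPerm α × VertexPerm β) : ℤ) •
      antisymmetrize (inclU α β f * inclV α β f' * k) = antisymmetrize
        (inclU α β (antisymmetrize f) * inclV α β (antisymmetrize f') * k) := by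
  have h1 : inclU α β (antisymmetrize f) * inclV α β (antisymmetrize f') * k =
      ∑ w : VertexPerm α × VertexPerm β, vertexSign (leviPerm w) •
        permute (leviPerm w) (inclU α β f * inclV α β f' * k) := by
    rw [antisymmetrize_eq, antisymmetrize_eq, map_sum, map_sum, Finset.sum_mul_sum,
      ← Fintype.sum_prod_type', Finset.sum_mul]
    refine Finset.sum_congr rfl fun w _ => ?_
    rw [map_mul, map_mul, permute_inclU, permute_inclV, hk, vertexSign_leviPerm, map_zsmul,
      map_zsmul, smul_mul_smul_comm, smul_mul_assoc]
  rw [h1, ← antisymmetrizeHom_apply (∑ w, _), map_sum]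
  have h2 : ∀ w : VertexPerm α × VertexPerm β, antisymmetrizeHom _ (vertexSign (leviPerm w) •
      permute (leviPerm w) (inclU α β f * inclV α β f' * k)) =
      antisymmetrize (inclU α β f * inclV α β f' * k) := fun w => by
    rw [map_zsmul, antisymmetrizeHom_apply, antisymmetrize_permute, smul_smul, vertexSign_mul_self,
      one_smul]
  simp only [h2]
  rw [Finset.sum_const, Finset.card_univ, natCast_zsmul]

theorem antisymmetrize_levi_congr {f g : TorusRing α} {f' g' : TorusRing β}
    {k : TorusRing fun j => α j + β j}
    (hk : ∀ w : VertexPerm α × VertexPerm β, permute (leviPerm w) k = k)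
    (hf : antisymmetrize f = antisymmetrize g) (hf' : antisymmetrize f' = antisymmetrize g') :
    antisymmetrize (inclU α β f * inclV α β f' * k) =
      antisymmetrize (inclU α β g * inclV α β g' * k) := by
  have h := card_smul_antisymmetrize_levi f f' k hk
  rw [hf, hf', ← card_smul_antisymmetrize_levi g g' k hk] at h
  refine AddMonoidAlgebra.ext (Finsupp.ext fun δ => ?_)
  have h1 := congrArg (fun f => f.coeff δ) h
  simp only [coeff_zsmul_torus] at h1
  exact mul_left_cancel₀ (Int.natCast_ne_zero.mpr Fintype.card_ne_zero) h1

/-- The correction is `∏ u_k^{β}` at each vertex; being symmetric in `u`, it can be absorbed into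
the kernel. -/
theorem mono_rho_add : (mono (rho fun j => α j + β j) : TorusRing fun j => α j + β j) =
    inclU α β (mono (rho α)) * inclV α β (mono (rho β)) *
      inclU α β (mono fun j _ => (β j : ℤ)) := by
  rw [inclU_mul_inclV_mono, inclU_mono, mono_mul, ← map_add]
  refine congrArg mono (funext fun j => funext fun k => ?_)
  refine Fin.addCases (fun k => ?_) (fun k => ?_) k
  · rw [Prod.mk_add_mk, appendWeight_castAdd]
    simp [rho]
    ring
  · rw [Prod.mk_add_mk, appendWeight_natAdd]
    simp [rho]
    ring

/-- Schur polynomials in `u` and `v` can be replaced by monomials under antisymmetrization. -/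
theorem antisymmetrize_mono_rho_mul_schurPoly (γ : Weight α) (δ : Weight β)
    {k : TorusRing fun j => α j + β j}
    (hk : ∀ w : VertexPerm α × VertexPerm β, permute (leviPerm w) k = k) :
    antisymmetrize (mono (rho fun j => α j + β j) *
      (inclU α β (schurPoly γ) * inclV α β (schurPoly δ) * k)) =
      antisymmetrize (mono (rho fun j => α j + β j) * (mono (appendWeight α β (γ, δ)) * k)) := by
  -- A symmetric factor leaves the antisymmetrizer, so both sides are `J(z^{κ+ρ})`.
  have hs : ∀ {ν : Q0 → ℕ} (κ : Weight ν), antisymmetrize (mono (rho ν) * schurPoly κ) =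
      antisymmetrize (mono (rho ν) * mono κ) := fun κ => by
    rw [antisymmetrize_mul_of_symmetric _ _ fun w => permute_schurPoly w κ,
      antisymmetrize_mul_schurPoly, mono_mul, add_comm]
  have hk' : ∀ w : VertexPerm α × VertexPerm β,
      permute (leviPerm w) (inclU α β (mono fun j _ => (β j : ℤ)) * k) =
        inclU α β (mono fun j _ => (β j : ℤ)) * k := fun w => by
    rw [map_mul, hk, permute_inclU, permute_mono]
    rfl
  have h := antisymmetrize_levi_congr hk' (hs γ) (hs δ)
  rw [← inclU_mul_inclV_mono, mono_rho_add]
  simp only [map_mul] at h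
  refine Eq.trans (congrArg antisymmetrize ?_) (h.trans (congrArg antisymmetrize ?_)) <;> ring

end Levi

/-! ### The shuffle kernel is symmetric in `u` and in `v` -/

section KernelSymmetry

variable {Q0 Q1 : Type*} {ν : Q0 → ℕ}

/-- The action of a permutation on each coefficient. -/
def permuteSeries (Q1 : Type*) (w : VertexPerm ν) : Completed Q1 ν →+* Completed Q1 ν where
  toFun := fun F => F.map (permute w)
  map_one' := HahnSeries.map_one (permute w).toMonoidWithZeroHom
  map_mul' := fun _ _ => HahnSeries.map_mul (permute w : TorusRing ν →ₙ+* TorusRing ν)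
  map_zero' := HahnSeries.map_zero (permute w : ZeroHom (TorusRing ν) (TorusRing ν))
  map_add' := fun _ _ => HahnSeries.map_add (permute w : TorusRing ν →+ TorusRing ν)

theorem coeff_permuteSeries (w : VertexPerm ν) (F : Completed Q1 ν) (g : Q1 → ℤ) :
    (permuteSeries Q1 w F).coeff g = permute w (F.coeff g) := rfl

theorem permuteSeries_arrowMonomial [DecidableEq Q1] (w : VertexPerm ν) (b : Q1) (γ : Weight ν) :
    permuteSeries Q1 w (arrowMonomial b γ) = arrowMonomial b (permWeight w γ) := by
  ext g : 2
  rw [coeff_permuteSeries, arrowMonomial, arrowMonomial, HahnSeries.coeff_single,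
    HahnSeries.coeff_single]
  split_ifs
  · exact permute_mono w γ
  · exact map_zero _

theorem permWeight_eps [DecidableEq Q0] (w : VertexPerm ν) (j : Q0) (k : Fin (ν j)) :
    permWeight w (eps j k) = eps j (w j k) := by
  funext j' k'
  rw [permWeight_apply, eps, eps]
  rcases eq_or_ne j' j with rfl | h
  · rw [Pi.single_eq_same, Pi.single_eq_same, Pi.single_apply, Pi.single_apply]
    exact if_congr (Equiv.symm_apply_eq _) rfl rfl
  · rw [Pi.single_eq_of_ne h, Pi.single_eq_of_ne h]
    rfl

variable [DecidableEq Q0] [Fintype Q1] [DecidableEq Q1] {α β : Q0 → ℕ}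

theorem permWeight_leviPerm_eps_sub (w : VertexPerm α × VertexPerm β) (j j' : Q0) (k : Fin (α j))
    (l : Fin (β j')) : permWeight (leviPerm w)
      (eps j (Fin.castAdd (β j) k) - eps j' (Fin.natAdd (α j') l)) =
      eps j (Fin.castAdd (β j) (w.1 j k)) - eps j' (Fin.natAdd (α j') (w.2 j' l)) := by
  rw [map_sub, ← appendWeight_eps_left, ← appendWeight_eps_right, permWeight_leviPerm,
    permWeight_leviPerm, permWeight_eps, permWeight_eps, map_zero, map_zero, appendWeight_eps_left,
    appendWeight_eps_right]

theorem permuteSeries_shuffleDenominator (tl hd : Q1 → Q0) (w : VertexPerm α × VertexPerm β) :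
    permuteSeries Q1 (leviPerm w) (shuffleDenominator tl hd α β) =
      shuffleDenominator tl hd α β := by
  refine (map_prod _ _ _).trans (Finset.prod_congr rfl fun b _ => ?_)
  refine (map_prod _ _ _).trans ((Finset.prod_congr rfl fun k _ => ?_).trans
    (Equiv.prod_comp (w.1 (tl b)) _))
  refine (map_prod _ _ _).trans ((Finset.prod_congr rfl fun l _ => ?_).trans
    (Equiv.prod_comp (w.2 (hd b)) _))
  rw [map_sub (permuteSeries Q1 (leviPerm w)), map_one, permuteSeries_arrowMonomial,
    permWeight_leviPerm_eps_sub]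

/-- Such permutations merely rearrange the factors of the denominator, and the kernel is its unique
inverse. -/
theorem permute_coeff_shuffleKernel (tl hd : Q1 → Q0) (w : VertexPerm α × VertexPerm β)
    (g : Q1 → ℤ) : permute (leviPerm w) ((shuffleKernel tl hd α β).coeff g) =
      (shuffleKernel tl hd α β).coeff g := by
  have h := congrArg (permuteSeries Q1 (leviPerm w))
    (shuffleKernel_mul_shuffleDenominator tl hd α β)
  rw [map_mul, map_one, permuteSeries_shuffleDenominator] at h
  rw [← coeff_permuteSeries, left_inv_eq_right_inv h
    ((mul_comm _ _).trans (shuffleKernel_mul_shuffleDenominator tl hd α β))]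

end KernelSymmetry

/-! ### The shuffle product of two Schur polynomials -/

section ShuffleSchur

variable {Q0 Q1 : Type*} [Fintype Q0] [DecidableEq Q0] [Fintype Q1] [DecidableEq Q1]

theorem coeff_map_C {ν ν' : Q0 → ℕ} (f : TorusRing ν) (φ : TorusRing ν →+* TorusRing ν') :
    (HahnSeries.C f : Completed Q1 ν).map φ = HahnSeries.C (φ f) :=
  HahnSeries.map_C f φ

/-- The coefficients of the shuffle product of Schur polynomials. -/
theorem coeff_demazureCoeff_schurPoly (tl hd : Q1 → Q0) (i : Q0) {a : ℕ} (μ : Fin a → ℤ)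
    (β : Q0 → ℕ) (ξ : Q0 → YoungDiagram)
    (lam : DominantWeight fun j => (Pi.single i a : Q0 → ℕ) j + β j) (g : Q1 → ℤ) :
    (demazureCoeff ((HahnSeries.C (schurPoly (vertexWeight i μ)) :
        Completed Q1 (Pi.single i a)).map (inclU (Pi.single i a) β) *
      (HahnSeries.C (schurPoly (partitionWeight β ξ).1) : Completed Q1 β).map
        (inclV (Pi.single i a) β) * shuffleKernel tl hd (Pi.single i a) β) lam).coeff g =
      ∑ᶠ p, (bicoeff p (outSeries β tl hd i a)).coeff g *
        altCoeff (startWeight i μ β ξ + exponentWeight i a β p + rho _) (lam.1 + rho _) := by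
  rw [coeff_demazureCoeff, coeff_map_C, coeff_map_C, ← map_mul, coeff_C_mul,
    antisymmetrize_mono_rho_mul_schurPoly _ _ fun w => permute_coeff_shuffleKernel tl hd w g,
    coeff_shuffleKernel, ← mul_assoc, mono_mul, kernelCoeff]
  have h := ((torusCoeffHom (lam.1 + rho _)).comp ((antisymmetrizeHom _).comp
    (AddMonoidHom.mulLeft (mono (rho _ + startWeight i μ β ξ))))).map_finsum
      (hasFiniteSupport_kernelCoeff i (supportIn_outSeries (n := β) tl hd i a) g)
  refine h.trans (finsum_congr fun p => ?_)
  rw [AddMonoidHom.comp_apply, AddMonoidHom.comp_apply, map_zsmul, map_zsmul, map_zsmul,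
    smul_eq_mul, AddMonoidHom.coe_mulLeft, mono_mul, antisymmetrizeHom_apply, torusCoeffHom_apply,
    coeff_antisymmetrize_mono, altCoeff_comm, add_assoc, add_comm (rho _)]

end ShuffleSchur

end

end QuiverCurrents

theorem proposition5p5 {Q0 Q1 : Type*} [Fintype Q0] [DecidableEq Q0] [Fintype Q1] [DecidableEq Q1]
    (tl hd : Q1 → Q0) (i : Q0) (a : ℕ) (ha : 0 < a) (μ : Fin a → ℤ) (hμ : Antitone μ)
    (β : Q0 → ℕ) (ξ : Q0 → YoungDiagram) (hξ : ∀ j, (ξ j).colLen 0 ≤ β j) :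
    ∃ (c : (Q0 → YoungDiagram) →₀ ArrowRing Q1)
      (d : DominantWeight (fun j => (Pi.single i a : Q0 → ℕ) j + β j) → HahnSeries (Q1 → ℤ) ℤ),
      (∀ c', IsTensorSchurExpansion (current tl hd i μ (tensorSchur Q1 ξ)) c' ↔ c' = c) ∧
      (∀ d', IsSchurExpansion
        (shuffle tl hd (HahnSeries.C (schurPoly (vertexWeight i μ)) : Completed Q1 (Pi.single i a))
          (HahnSeries.C (schurPoly (partitionWeight β ξ).1) : Completed Q1 β)) d' ↔ d' = d) ∧
      (∀ lam : Q0 → YoungDiagram, (∀ j, (lam j).colLen 0 ≤ (Pi.single i a : Q0 → ℕ) j + β j) →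
        HahnSeries.ofFinsupp (c lam).coeff = d (partitionWeight _ lam)) ∧
      (∀ lam : Q0 → YoungDiagram, ¬ (∀ j, (lam j).colLen 0 ≤ (Pi.single i a : Q0 → ℕ) j + β j) →
        c lam = 0) := by
  refine ⟨(tensorBasis Q0 Q1).repr (current tl hd i μ (tensorSchur Q1 ξ)), demazureCoeff _,
    fun c' => isTensorSchurExpansion_iff _ _, fun d' => isSchurExpansion_demazure_iff _ _,
    fun lam hlam => ?_, fun lam hlam => repr_current_eq_zero tl hd i μ ξ hξ lam hlam⟩
  -- At each `t^g` both coefficients are the same finite sum over the exponents of `outSeries`.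
  ext g
  rw [coeff_demazureCoeff_schurPoly]
  exact coeff_repr_current tl hd i μ ξ hξ lam g hlam
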